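/- Let $n\ge 1$ and $q\in(0,1)$. For $a\in\mathbb C$ put $(a;q^2)_n=\prod_{k=0}^{n-1}(1-aq^{2k})$. **Algebras.** $\mathcal F(U_n)_q$ is the unital involutive $\mathbb C$-algebra generated by $z_1,\dots,z_n,f_0$ with the relations $$z_iz_j=q\,z_jz_i\ (i<j),\qquad z_i^*z_j=q\,z_jz_i^*\ (i\ne j),\qquad z_j^*z_j=q^2z_jz_j^*+(1-q^2)\Big(1-\sum_{k>j}z_kz_k^*\Big),$$ $$f_0^*=f_0^2=f_0,\qquad z_i^*f_0=f_0z_i=0 .$$ $\mathbb C[\mathbb C^n]_q$ is the subalgebra generated by $z_1,\dots,z_n$, with basis $\mathbf z^{m}=z_n^{m_n}\cdots z_1^{m_1}$, $m\in\mathbb Z_{\ge0}^n$. The space of finite functions is the two-sided ideal $\mathcal D(U_n)_q=\mathcal F(U_n)_q\,f_0\,\mathcal F(U_n)_q$. **Symmetry.** $U_q\mathfrak{su}_{n,1}$ is the algebra $U_q\mathfrak{sl}_{n+1}$ (generators $E_k,F_k,K_k^{\pm1}$, $1\le k\le n$, and the Drinfeld–Jimbo relations of type $A_n$) with $\Delta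 E_k=E_k\otimes1+K_k\otimes E_k$, $\Delta F_k=F_k\otimes K_k^{-1}+1\otimes F_k$, $\Delta K_k=K_k\otimes K_k$, antipode $S$, and the involution $E_n^*=-K_nF_n$, $F_n^*=-E_nK_n^{-1}$, $E_k^*=K_kF_k$, $F_k^*=E_kK_k^{-1}$ $(k<n)$, $K_k^*=K_k$. It acts on $\mathcal F(U_n)_q$, making it an involutive module algebra (in particular $(\xi f)^*=S(\xi)^*f^*$), by: for $k<n$, $K_kz_k=qz_k$, $K_kz_{k+1}=q^{-1}z_{k+1}$, $K_kz_i=z_i$ otherwise, $F_kz_k=q^{1/2}z_{k+1}$, $E_kz_{k+1}=q^{-1/2}z_k$, all other $F_kz_i,E_kz_i$ zero, $K_kf_0=f_0$, $E_kf_0=F_kf_0=0$; and $K_nz_n=q^2z_n$, $K_nz_i=qz_i$ $(i<n)$, $F_nz_n=q^{1/2}$, $F_nz_i=0$ $(i<n)$, $E_nz_i=-q^{1/2}z_nz_i$ (all $i$), $K_nf_0=f_0$, $F_nf_0=-\frac{q^{1/2}}{q^{-2}-1}f_0z_n^*$, $E_nf_0=-\frac{q^{1/2}}{1-q^2}z_nf_0$.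 The subspace $\mathcal D(U_n)_q$ is a submodule. **Distributions and integrals.** Let $H$ be the Fock module: it has a basis $\mathbf z^{m}e_0$, where $z_i^*e_0=0$ for all $i$, and $f_0$ acts as the projection onto $\mathbb C e_0$ along the other basis vectors. Write $x_{m,l}$ for the matrix entries of $x\in\mathcal F(U_n)_q$ in this basis ($x\,\mathbf z^{l}e_0=\sum_m x_{m,l}\mathbf z^me_0$). In this way $\mathcal D(U_n)_q$ is identified with the matrices having finitely many non-zero entries, and the space of distributions $\mathcal D(U_n)'_q$ is the space of all matrices $(\psi_{m,l})$, with the topology of entrywise convergence. For $\psi\in\mathcal D(U_n)'_q$ and $f\in\mathcal D(U_n)_q$ the product $\psi f$ is the matrix product, and $$\int_{U_n}\psi f\,d\nu_q=(q^2;q^2)_n\sum_{m}(\psi f)_{m,m}\,q^{-2nk_1+2k_2+\dots+2k_n},\qquad k_i=m_i+\dots+m_n .$$ For $\alpha>0$ let $$\int_{U_n}x\,dm_{\alpha,q}=(q^{2\alpha+2};q^2)_n\sum_m x_{m,m}\,q^{2(\alpha+1)k_1+2k_2+\dots+2k_n},\qquad (x,y)_{\alpha,q}=\int_{U_n}y^*x\,dm_{\alpha,q}.$$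 **Berezin transform.** The monomials $\mathbf z^m$ are pairwise orthogonal for $(\cdot,\cdot)_{\alpha,q}$. Let $P_{\alpha,q}$ be the orthogonal projection onto the closed span of $\mathbb C[\mathbb C^n]_q$; for $f\in\mathcal D(U_n)_q$ the Toeplitz operator on $\mathbb C[\mathbb C^n]_q$ is $T_f\psi=P_{\alpha,q}(f\psi)$. For an operator $A$ on $\mathbb C[\mathbb C^n]_q$ whose matrix $A\mathbf z^m=\sum_l A_{l,m}\mathbf z^l$ has only finitely many non-zero columns, put $$\mathrm{Tr}_q(A)=\frac{(q^2;q^2)_n}{(q^{2\alpha+2};q^2)_n}\sum_m A_{m,m}\,q^{-2nk_1+2k_2+\dots+2k_n},\qquad k_i=m_i+\dots+m_n.$$ The covariant symbol of an endomorphism $T$ of $\mathbb C[\mathbb C^n]_q$ is the unique $\sigma(T)\in\mathcal D(U_n)'_q$ with $\int_{U_n}\sigma(T)f\,d\nu_q=\mathrm{Tr}_q(T\,T_f)$ for all $f\in\mathcal D(U_n)_q$. With $t=q^{2\alpha}$ the $q$-Berezin transform is $B_{q,t}:\mathcal D(U_n)_q\to\mathcal D(U_n)'_q$, $B_{q,t}(f)=\sigma(T_f)$.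 **Proposition 4.1.** There is a sequence $(B_{q,j})_{j\ge1}$ of linear endomorphisms of $\mathcal D(U_n)_q$, independent of $t$, such that (i) each $B_{q,j}$ is a morphism of $U_q\mathfrak{su}_{n,1}$-modules; (ii) for every $\alpha>0$, with $t=q^{2\alpha}$, and every $f\in\mathcal D(U_n)_q$, $$B_{q,t}(f)=f+\sum_{j=1}^\infty B_{q,j}(f)\,t^j,$$ where the series converges (unconditionally) in $\mathcal D(U_n)'_q$. Moreover all matrix entries of $B_{q,t}$ are polynomials in $t$: for all $f,g\in\mathcal D(U_n)_q$ there is a polynomial $p\in\mathbb C[X]$ with $\int_{U_n}B_{q,t}(f)\,g\,d\nu_q=p(t)$ for all $t=q^{2\alpha}$, $\alpha>0$. -/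

import Mathlib

set_option linter.unusedSimpArgs false

namespace QuantumBall

/-- The deformation parameter `q`, a real number in the interval `(0, 1)`. -/
abbrev QParam : Type := Set.Ioo (0 : ℝ) 1

/-- `q` as a complex number. -/
noncomputable def qc (q : QParam) : ℂ := ((q : ℝ) : ℂ)

/-- `q ^ (1/2)` as a complex number. -/
noncomputable def rc (q : QParam) : ℂ := ((Real.sqrt (q : ℝ) : ℝ) : ℂ)

theorem rc_sq (q : QParam) : rc q ^ 2 = qc q := by
  unfold rc qc
  exact_mod_cast Real.sq_sqrt q.2.1.le

theorem qc_eq (q : QParam) : qc q = rc q ^ 2 := (rc_sq q).symm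

theorem qc_ne (q : QParam) : qc q ≠ 0 := by
  unfold qc; exact_mod_cast q.2.1.ne'

theorem rc_ne (q : QParam) : rc q ≠ 0 := by
  intro h; apply qc_ne q; rw [qc_eq, h]; simp

theorem one_sub_pow_ne (q : QParam) {k : ℕ} (hk : k ≠ 0) : 1 - qc q ^ k ≠ 0 := by
  unfold qc
  have : (q : ℝ) ^ k < 1 := pow_lt_one₀ q.2.1.le q.2.2 hk
  exact_mod_cast (sub_pos.2 this).ne'

/-! ### The involutive algebra of functions generated by `z_i`, `z_i^*` and `f_0` -/

/-- Generators of the algebra of functions on the quantum ball: `z i` and `zs i` stand for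
`z_{i+1}` and `z_{i+1}^*` (indices start at `0` here), `f0` is the distinguished finite
function. -/
inductive Gen (n : ℕ) : Type
  | z (i : Fin n) : Gen n
  | zs (i : Fin n) : Gen n
  | f0 : Gen n

open FreeAlgebra in
/-- Defining relations.  The list is closed under the antilinear involution `z_i ↔ z_i^*`,
`f_0 ↔ f_0`, so that this presents the unital `*`-algebra with these relations. -/
inductive Rel (n : ℕ) (q : QParam) :
    FreeAlgebra ℂ (Gen n) → FreeAlgebra ℂ (Gen n) → Prop
  | zz (i j : Fin n) (h : i < j) :
      Rel n q (ι ℂ (.z i) * ι ℂ (.z j)) (qc q • (ι ℂ (.z j) * ι ℂ (.z i)))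
  | zszs (i j : Fin n) (h : i < j) :
      Rel n q (ι ℂ (.zs j) * ι ℂ (.zs i)) (qc q • (ι ℂ (.zs i) * ι ℂ (.zs j)))
  | zsz (i j : Fin n) (h : i ≠ j) :
      Rel n q (ι ℂ (.zs i) * ι ℂ (.z j)) (qc q • (ι ℂ (.z j) * ι ℂ (.zs i)))
  | zsz_self (j : Fin n) :
      Rel n q (ι ℂ (.zs j) * ι ℂ (.z j))
        (qc q ^ 2 • (ι ℂ (.z j) * ι ℂ (.zs j)) +
          (1 - qc q ^ 2) • (1 - ∑ k ∈ Finset.Ioi j, ι ℂ (.z k) * ι ℂ (.zs k)))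
  | f0_sq : Rel n q (ι ℂ .f0 * ι ℂ .f0) (ι ℂ .f0)
  | zs_f0 (i : Fin n) : Rel n q (ι ℂ (.zs i) * ι ℂ .f0) 0
  | f0_z (i : Fin n) : Rel n q (ι ℂ .f0 * ι ℂ (.z i)) 0

/-- The algebra `F(U_n)_q` generated by the polynomial algebra `P(ℂ^n)_q` and `f_0`. -/
def FunAlg (n : ℕ) (q : QParam) : Type := RingQuot (Rel n q)

noncomputable instance instRingFunAlg (n : ℕ) (q : QParam) : Ring (FunAlg n q) :=
  inferInstanceAs (Ring (RingQuot (Rel n q)))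

noncomputable instance instAlgebraFunAlg (n : ℕ) (q : QParam) : Algebra ℂ (FunAlg n q) :=
  inferInstanceAs (Algebra ℂ (RingQuot (Rel n q)))

/-- The quotient map from the free algebra. -/
noncomputable def mk (n : ℕ) (q : QParam) : FreeAlgebra ℂ (Gen n) →ₐ[ℂ] FunAlg n q :=
  RingQuot.mkAlgHom ℂ (Rel n q)

/-- The class of a generator. -/
noncomputable def gen {n : ℕ} (q : QParam) (g : Gen n) : FunAlg n q :=
  mk n q (FreeAlgebra.ι ℂ g)

/-- The element `z_{i+1}`. -/
noncomputable def Z {n : ℕ} (q : QParam) (i : Fin n) : FunAlg n q := gen q (.z i)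

/-- The element `z_{i+1}^*`. -/
noncomputable def Zs {n : ℕ} (q : QParam) (i : Fin n) : FunAlg n q := gen q (.zs i)

/-- The element `f_0`. -/
noncomputable def P0 (n : ℕ) (q : QParam) : FunAlg n q := gen q .f0

section basics
variable {n : ℕ} {q : QParam}

theorem mk_surjective : Function.Surjective (mk n q) := RingQuot.mkAlgHom_surjective ℂ _

theorem mk_rel {x y : FreeAlgebra ℂ (Gen n)} (h : Rel n q x y) : mk n q x = mk n q y :=
  RingQuot.mkAlgHom_rel ℂ h

theorem mk_z (i : Fin n) : mk n q (FreeAlgebra.ι ℂ (.z i)) = Z q i := rfl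
theorem mk_zs (i : Fin n) : mk n q (FreeAlgebra.ι ℂ (.zs i)) = Zs q i := rfl
theorem mk_f0 : mk n q (FreeAlgebra.ι ℂ .f0) = P0 n q := rfl

theorem Z_Z {i j : Fin n} (h : i < j) : Z q i * Z q j = qc q • (Z q j * Z q i) := by
  simpa [mk_z] using mk_rel (q := q) (.zz i j h)

theorem Zs_Zs {i j : Fin n} (h : i < j) : Zs q j * Zs q i = qc q • (Zs q i * Zs q j) := by
  simpa [mk_zs] using mk_rel (q := q) (.zszs i j h)

theorem Zs_Z {i j : Fin n} (h : i ≠ j) : Zs q i * Z q j = qc q • (Z q j * Zs q i) := by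
  simpa [mk_z, mk_zs] using mk_rel (q := q) (.zsz i j h)

theorem Zs_Z_self (j : Fin n) : Zs q j * Z q j =
    qc q ^ 2 • (Z q j * Zs q j) +
      (1 - qc q ^ 2) • (1 - ∑ k ∈ Finset.Ioi j, Z q k * Zs q k) := by
  simpa [mk_z, mk_zs] using mk_rel (q := q) (.zsz_self j)

theorem P0_sq : P0 n q * P0 n q = P0 n q := by
  simpa [mk_f0] using mk_rel (q := q) .f0_sq

theorem Zs_P0 (i : Fin n) : Zs q i * P0 n q = 0 := by
  simpa [mk_zs, mk_f0] using mk_rel (q := q) (.zs_f0 i)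

theorem P0_Z (i : Fin n) : P0 n q * Z q i = 0 := by
  simpa [mk_z, mk_f0] using mk_rel (q := q) (.f0_z i)

/-- Universal property of `F(U_n)_q`. -/
noncomputable def liftF {B : Type*} [Ring B] [Algebra ℂ B] (f : Gen n → B)
    (h : ∀ x y, Rel n q x y → FreeAlgebra.lift ℂ f x = FreeAlgebra.lift ℂ f y) :
    FunAlg n q →ₐ[ℂ] B :=
  RingQuot.liftAlgHom ℂ ⟨FreeAlgebra.lift ℂ f, fun x y hxy => h x y hxy⟩

theorem liftF_mk {B : Type*} [Ring B] [Algebra ℂ B] (f : Gen n → B)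
    (h : ∀ x y, Rel n q x y → FreeAlgebra.lift ℂ f x = FreeAlgebra.lift ℂ f y)
    (x : FreeAlgebra ℂ (Gen n)) : liftF f h (mk n q x) = FreeAlgebra.lift ℂ f x :=
  RingQuot.liftAlgHom_mkAlgHom_apply ℂ (FreeAlgebra.lift ℂ f) (fun x y hxy => h x y hxy) x

theorem liftF_gen {B : Type*} [Ring B] [Algebra ℂ B] (f : Gen n → B)
    (h : ∀ x y, Rel n q x y → FreeAlgebra.lift ℂ f x = FreeAlgebra.lift ℂ f y) (g : Gen n) :
    liftF f h (gen q g) = f g := by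
  rw [gen, liftF_mk]
  simp

theorem algHom_ext {B : Type*} [Ring B] [Algebra ℂ B] {f g : FunAlg n q →ₐ[ℂ] B}
    (h : ∀ x, f (gen q x) = g (gen q x)) : f = g := by
  apply RingQuot.ringQuot_ext' ℂ
  apply FreeAlgebra.hom_ext
  funext x
  exact h x

/-- `D (a b) = D a · τ b + σ a · D b`. -/
def IsSkew (σ τ : FunAlg n q →ₐ[ℂ] FunAlg n q) (D : FunAlg n q →ₗ[ℂ] FunAlg n q) : Prop :=
  ∀ a b, D (a * b) = D a * τ b + σ a * D b

theorem IsSkew.eq_zero {σ τ : FunAlg n q →ₐ[ℂ] FunAlg n q} {D : FunAlg n q →ₗ[ℂ] FunAlg n q}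
    (hD : IsSkew σ τ D) (h : ∀ g, D (gen q g) = 0) : D = 0 := by
  have h1 : D 1 = 0 := by
    have := hD 1 1
    simpa using this
  ext x
  obtain ⟨y, rfl⟩ := mk_surjective x
  induction y using FreeAlgebra.induction with
  | grade0 c => rw [AlgHom.commutes, Algebra.algebraMap_eq_smul_one, map_smul, h1]; simp
  | grade1 g => exact h g
  | mul a b ha hb => simp_all [hD (mk n q a)]
  | add a b ha hb => simp_all

theorem IsSkew.ext {σ τ : FunAlg n q →ₐ[ℂ] FunAlg n q} {D D' : FunAlg n q →ₗ[ℂ] FunAlg n q}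
    (hD : IsSkew σ τ D) (hD' : IsSkew σ τ D') (h : ∀ g, D (gen q g) = D' (gen q g)) : D = D' := by
  have : IsSkew σ τ (D - D') := by
    intro a b
    simp only [LinearMap.sub_apply, hD a b, hD' a b]
    noncomm_ring
  exact sub_eq_zero.1 (this.eq_zero fun g => by simp [h g])

/-- The homomorphism of the free algebra into `2 × 2` matrices that encodes a skew derivation. -/
noncomputable def skewHom (σ τ : FunAlg n q →ₐ[ℂ] FunAlg n q) (d : Gen n → FunAlg n q) :
    FreeAlgebra ℂ (Gen n) →ₐ[ℂ] Matrix (Fin 2) (Fin 2) (FunAlg n q) :=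
  FreeAlgebra.lift ℂ fun g => !![σ (gen q g), d g; 0, τ (gen q g)]

/-- The skew derivation on the free algebra with values `d g` on the generators. -/
noncomputable def skewFree (σ τ : FunAlg n q →ₐ[ℂ] FunAlg n q) (d : Gen n → FunAlg n q) :
    FreeAlgebra ℂ (Gen n) →ₗ[ℂ] FunAlg n q where
  toFun x := skewHom σ τ d x 0 1
  map_add' x y := by simp
  map_smul' c x := by simp

theorem skewHom_diag (σ τ : FunAlg n q →ₐ[ℂ] FunAlg n q) (d : Gen n → FunAlg n q)
    (x : FreeAlgebra ℂ (Gen n)) :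
    skewHom σ τ d x 0 0 = σ (mk n q x) ∧ skewHom σ τ d x 1 0 = 0 ∧
      skewHom σ τ d x 1 1 = τ (mk n q x) := by
  induction x using FreeAlgebra.induction with
  | grade0 c => simp [Matrix.algebraMap_matrix_apply]
  | grade1 g => simp [skewHom, gen]
  | mul a b ha hb => simp [Matrix.mul_apply, Fin.sum_univ_two, ha, hb]
  | add a b ha hb => simp [ha, hb]

theorem skewFree_gen (σ τ : FunAlg n q →ₐ[ℂ] FunAlg n q) (d : Gen n → FunAlg n q) (g : Gen n) :
    skewFree σ τ d (FreeAlgebra.ι ℂ g) = d g := by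
  simp [skewFree, skewHom]

theorem skewFree_mul (σ τ : FunAlg n q →ₐ[ℂ] FunAlg n q) (d : Gen n → FunAlg n q)
    (x y : FreeAlgebra ℂ (Gen n)) : skewFree σ τ d (x * y) =
      skewFree σ τ d x * τ (mk n q y) + σ (mk n q x) * skewFree σ τ d y := by
  simp [skewFree, Matrix.mul_apply, Fin.sum_univ_two, skewHom_diag, add_comm]

theorem skewFree_one (σ τ : FunAlg n q →ₐ[ℂ] FunAlg n q) (d : Gen n → FunAlg n q) :
    skewFree σ τ d 1 = 0 := by
  simp [skewFree]

/-- If a skew derivation of the algebra has the prescribed values on the generators, then it is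
induced by `skewFree`. -/
theorem skewFree_eq {σ τ : FunAlg n q →ₐ[ℂ] FunAlg n q} {d : Gen n → FunAlg n q}
    {D : FunAlg n q →ₗ[ℂ] FunAlg n q} (hD : IsSkew σ τ D) (h : ∀ g, D (gen q g) = d g)
    (x : FreeAlgebra ℂ (Gen n)) : skewFree σ τ d x = D (mk n q x) := by
  have h1 : D 1 = 0 := by
    have := hD 1 1
    simpa using this
  induction x using FreeAlgebra.induction with
  | grade0 c =>
    rw [AlgHom.commutes, Algebra.algebraMap_eq_smul_one, Algebra.algebraMap_eq_smul_one,
      map_smul, map_smul, h1, skewFree_one]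
  | grade1 g => rw [skewFree_gen, ← h]; rfl
  | mul a b ha hb => rw [skewFree_mul, map_mul, hD, ha, hb]
  | add a b ha hb => rw [map_add, map_add, map_add, ha, hb]

/-- The skew derivation of `F(U_n)_q` with values `d g` on the generators; the hypothesis says
that `d` is compatible with the defining relations. -/
noncomputable def skew (σ τ : FunAlg n q →ₐ[ℂ] FunAlg n q) (d : Gen n → FunAlg n q)
    (h : ∀ x y, Rel n q x y → skewFree σ τ d x = skewFree σ τ d y) :
    FunAlg n q →ₗ[ℂ] FunAlg n q where
  toFun x := liftF (q := q) (fun g => !![σ (gen q g), d g; 0, τ (gen q g)]) (by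
    intro x y hxy
    have e := mk_rel hxy
    have hx := skewHom_diag σ τ d x
    have hy := skewHom_diag σ τ d y
    have hs : skewHom σ τ d x 0 1 = skewHom σ τ d y 0 1 := h x y hxy
    change skewHom σ τ d x = skewHom σ τ d y
    ext i j
    fin_cases i <;> fin_cases j
    · change skewHom σ τ d x 0 0 = skewHom σ τ d y 0 0
      rw [hx.1, hy.1, e]
    · exact hs
    · change skewHom σ τ d x 1 0 = skewHom σ τ d y 1 0
      rw [hx.2.1, hy.2.1]
    · change skewHom σ τ d x 1 1 = skewHom σ τ d y 1 1
      rw [hx.2.2, hy.2.2, e]) x 0 1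
  map_add' x y := by simp
  map_smul' c x := by simp

theorem skew_mk {σ τ : FunAlg n q →ₐ[ℂ] FunAlg n q} {d : Gen n → FunAlg n q}
    (h : ∀ x y, Rel n q x y → skewFree σ τ d x = skewFree σ τ d y)
    (x : FreeAlgebra ℂ (Gen n)) : skew σ τ d h (mk n q x) = skewFree σ τ d x := by
  simp only [skew, skewFree, LinearMap.coe_mk, AddHom.coe_mk, liftF_mk]
  rfl

theorem skew_gen {σ τ : FunAlg n q →ₐ[ℂ] FunAlg n q} {d : Gen n → FunAlg n q}
    (h : ∀ x y, Rel n q x y → skewFree σ τ d x = skewFree σ τ d y) (g : Gen n) :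
    skew σ τ d h (gen q g) = d g := by
  rw [gen, skew_mk, skewFree_gen]

theorem skew_isSkew {σ τ : FunAlg n q →ₐ[ℂ] FunAlg n q} {d : Gen n → FunAlg n q}
    (h : ∀ x y, Rel n q x y → skewFree σ τ d x = skewFree σ τ d y) :
    IsSkew σ τ (skew σ τ d h) := by
  intro a b
  obtain ⟨x, rfl⟩ := mk_surjective a
  obtain ⟨y, rfl⟩ := mk_surjective b
  rw [← map_mul, skew_mk, skew_mk, skew_mk, skewFree_mul]

end basics

section torus
variable {n : ℕ} {q : QParam}

/-- The automorphism `z_i ↦ q ^ (w i) z_i`, `z_i^* ↦ q ^ (- w i) z_i^*`, `f_0 ↦ f_0`. -/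
noncomputable def torus (q : QParam) (w : Fin n → ℤ) : FunAlg n q →ₐ[ℂ] FunAlg n q :=
  liftF (fun g => match g with
    | .z i => (qc q ^ w i) • Z q i
    | .zs i => (qc q ^ (-w i)) • Zs q i
    | .f0 => P0 n q) (by
    have hq := qc_ne q
    intro x y h
    cases h with
    | zz i j h => simp [Z_Z h]; match_scalars; ring
    | zszs i j h => simp [Zs_Zs h]; match_scalars; ring
    | zsz i j h => simp [Zs_Z h]; match_scalars; ring
    | zsz_self j =>
      have h0 (i : Fin n) : qc q ^ w i * (qc q ^ w i)⁻¹ = 1 :=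
        mul_inv_cancel₀ (zpow_ne_zero _ hq)
      have h1 (i : Fin n) : (qc q ^ w i)⁻¹ * qc q ^ w i = 1 :=
        inv_mul_cancel₀ (zpow_ne_zero _ hq)
      simp [Zs_Z_self, smul_smul, h1, ← mul_assoc, h0]
    | f0_sq => simp [P0_sq]
    | zs_f0 i => simp [Zs_P0]
    | f0_z i => simp [P0_Z])

@[simp] theorem torus_Z (w : Fin n → ℤ) (i : Fin n) : torus q w (Z q i) = qc q ^ w i • Z q i := by
  simp [torus, Z, liftF_gen]

@[simp] theorem torus_Zs (w : Fin n → ℤ) (i : Fin n) :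
    torus q w (Zs q i) = qc q ^ (-w i) • Zs q i := by
  rw [torus, Zs, liftF_gen]; rfl

@[simp] theorem torus_P0 (w : Fin n → ℤ) : torus q w (P0 n q) = P0 n q := by
  simp [torus, P0, liftF_gen]

theorem torus_torus (w w' : Fin n → ℤ) (x : FunAlg n q) :
    torus q w (torus q w' x) = torus q (w + w') x := by
  have hq := qc_ne q
  have : (torus q w).comp (torus q w') = torus q (w + w') := by
    apply algHom_ext
    rintro (i | i | _)
    · change torus q w (torus q w' (Z q i)) = torus q (w + w') (Z q i)
      simp [smul_smul, zpow_add₀ hq, mul_comm]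
    · change torus q w (torus q w' (Zs q i)) = torus q (w + w') (Zs q i)
      simp [smul_smul, zpow_add₀ hq, mul_comm]
    · change torus q w (torus q w' (P0 n q)) = torus q (w + w') (P0 n q)
      simp
  exact DFunLike.congr_fun this x

theorem torus_zero (x : FunAlg n q) : torus q 0 x = x := by
  have : torus (n := n) q 0 = AlgHom.id ℂ _ := by
    apply algHom_ext
    rintro (i | i | _)
    · change torus q 0 (Z q i) = Z q i
      simp
    · change torus q 0 (Zs q i) = Zs q i
      simp
    · change torus q 0 (P0 n q) = P0 n q
      simp
  exact DFunLike.congr_fun this x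

end torus

section tables
variable {n : ℕ}

/-- `K_k z_i = q ^ (wtK k i) z_i`. The index `k` of a generator is the last one (`k = n` in the
usual numbering) exactly if `¬ k.val + 1 < n`. -/
def wtK (k i : Fin n) : ℤ :=
  if k.val + 1 < n then
    if i = k then 1 else if i.val = k.val + 1 then -1 else 0
  else if i = k then 2 else 1

/-- `E_k` on the generators. The values on `z_i^*` are the ones forced by
`(ξ f)^* = S(ξ)^* f^*`. -/
noncomputable def actEGen (q : QParam) (k : Fin n) : Gen n → FunAlg n q
  | .z i =>
    if k.val + 1 < n then (if i.val = k.val + 1 then (rc q)⁻¹ • Z q k else 0)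
    else -rc q • (Z q k * Z q i)
  | .zs i =>
    if h : k.val + 1 < n then (if i = k then -((rc q)⁻¹ ^ 3) • Zs q ⟨k.val + 1, h⟩ else 0)
    else (if i = k then ((rc q)⁻¹ ^ 3) • 1 else 0)
  | .f0 =>
    if k.val + 1 < n then 0 else -(rc q / (1 - qc q ^ 2)) • (Z q k * P0 n q)

/-- `F_k` on the generators. -/
noncomputable def actFGen (q : QParam) (k : Fin n) : Gen n → FunAlg n q
  | .z i =>
    if h : k.val + 1 < n then (if i = k then rc q • Z q ⟨k.val + 1, h⟩ else 0)
    else (if i = k then rc q • 1 else 0)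
  | .zs i =>
    if k.val + 1 < n then (if i.val = k.val + 1 then -(rc q ^ 3) • Zs q k else 0)
    else -(rc q ^ 5) • (Zs q i * Zs q k)
  | .f0 =>
    if k.val + 1 < n then 0 else -(rc q / ((qc q ^ 2)⁻¹ - 1)) • (P0 n q * Zs q k)

end tables

section compat
variable {n : ℕ} {q : QParam}

open FreeAlgebra in
theorem actE_compat_lin (k : Fin n) (hk : k.val + 1 < n) (x y : FreeAlgebra ℂ (Gen n))
    (h : Rel n q x y) :
    skewFree (torus q (wtK k)) (AlgHom.id ℂ _) (actEGen q k) x =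
      skewFree (torus q (wtK k)) (AlgHom.id ℂ _) (actEGen q k) y := by
  have hr := rc_ne q
  obtain ⟨k', hk'⟩ : ∃ k' : Fin n, k' = ⟨k.val + 1, hk⟩ := ⟨_, rfl⟩
  have hkv : k'.val = k.val + 1 := by rw [hk']
  have hlt : k < k' := by rw [Fin.lt_def]; omega
  have ez : ∀ i, actEGen q k (.z i) = if i = k' then (rc q)⁻¹ • Z q k else 0 := by
    intro i; simp only [actEGen, hk, if_true, Fin.ext_iff, hkv]
  have ezs : ∀ i, actEGen q k (.zs i) = if i = k then -((rc q)⁻¹ ^ 3) • Zs q k' else 0 := by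
    intro i; simp only [actEGen, hk, dif_pos, hk']
  have ef : actEGen q k .f0 = 0 := by simp only [actEGen, hk, if_true]
  have ww : ∀ i, wtK k i = if i = k then 1 else if i = k' then -1 else 0 := by
    intro i; simp only [wtK, hk, if_true, Fin.ext_iff, hkv]
  have hne : k' ≠ k := hlt.ne'
  cases h with
  | zz i j h =>
    simp only [skewFree_mul, skewFree_gen, map_smul, mk_z, ez, torus_Z, AlgHom.id_apply, ww]
    by_cases hi : i = k'
    · subst hi
      have hj : j ≠ i := h.ne'
      have hj' : j ≠ k := (hlt.trans h).ne'
      simp [hj, hj', Z_Z (q := q) (hlt.trans h)]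
      match_scalars; ring
    · by_cases hj : j = k'
      · subst hj
        by_cases hik : i = k
        · subst hik
          simp [hi]
          match_scalars; ring
        · have : i < k := by
            rw [Fin.lt_def] at h ⊢
            have : i.val ≠ k.val := fun e => hik (Fin.ext e)
            omega
          simp [hi, hik, Z_Z (q := q) this]
          match_scalars; ring
      · simp [hi, hj]
  | zszs i j h =>
    simp only [skewFree_mul, skewFree_gen, map_smul, mk_zs, ezs, torus_Zs, AlgHom.id_apply, ww]
    by_cases hi : i = k
    · subst hi
      have hj : j ≠ i := h.ne'
      by_cases hjk : j = k'
      · subst hjk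
        simp [hj]
        match_scalars; field_simp
      · have : k' < j := by
          rw [Fin.lt_def] at h ⊢
          have : j.val ≠ k'.val := fun e => hjk (Fin.ext e)
          omega
        simp [hj, hjk, Zs_Zs (q := q) this]
        match_scalars; ring
    · by_cases hj : j = k
      · subst hj
        have hik : i ≠ k' := (h.trans hlt).ne
        simp [hi, hik, Zs_Zs (q := q) (h.trans hlt)]
        match_scalars; ring
      · simp [hi, hj]
  | zsz i j h =>
    simp only [skewFree_mul, skewFree_gen, map_smul, mk_z, mk_zs, ez, ezs, torus_Z, torus_Zs,
      AlgHom.id_apply, ww]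
    by_cases hi : i = k
    · subst hi
      by_cases hj : j = k'
      · subst hj
        have hI : Finset.Ioi i = insert j (Finset.Ioi j) := by
          ext s
          simp only [Finset.mem_Ioi, Finset.mem_insert, Fin.lt_def, Fin.ext_iff, hkv]
          omega
        have hS : ∑ s ∈ Finset.Ioi i, Z q s * Zs q s =
            Z q j * Zs q j + ∑ s ∈ Finset.Ioi j, Z q s * Zs q s := by
          rw [hI, Finset.sum_insert (by simp)]
        simp [Zs_Z_self, hne, hS]
        rw [qc_eq]
        match_scalars <;> field_simp <;> ring
      · simp [hj, h.symm, Zs_Z (q := q) (Ne.symm hj)]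
        match_scalars; ring
    · by_cases hj : j = k'
      · subst hj
        simp [hi, h, Zs_Z (q := q) hi]
        match_scalars; ring
      · simp [hi, hj]
  | zsz_self j =>
    simp only [skewFree_mul, skewFree_gen, map_smul, map_add, map_sub, map_sum, skewFree_one,
      mk_z, mk_zs, ez, ezs, torus_Z, torus_Zs, AlgHom.id_apply, ww]
    have hs : ∑ s ∈ Finset.Ioi j, ((if s = k' then (rc q)⁻¹ • Z q k else 0) * Zs q s +
        qc q ^ (if s = k then (1 : ℤ) else if s = k' then -1 else 0) • Z q s *
          (if s = k then -((rc q)⁻¹ ^ 3) • Zs q k' else 0)) =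
        if j = k then (rc q)⁻¹ • (Z q k * Zs q k') else 0 := by
      have hterm : ∀ s, ((if s = k' then (rc q)⁻¹ • Z q k else 0) * Zs q s +
          qc q ^ (if s = k then (1 : ℤ) else if s = k' then -1 else 0) • Z q s *
          (if s = k then -((rc q)⁻¹ ^ 3) • Zs q k' else 0)) =
          (if s = k' then (rc q)⁻¹ • (Z q k * Zs q k') else 0) -
          (if s = k then (rc q)⁻¹ • (Z q k * Zs q k') else 0) := by
        intro s
        by_cases h1 : s = k
        · subst h1
          simp [hne.symm, qc_eq]
          match_scalars; field_simp
        · by_cases h2 : s = k'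
          · subst h2; simp [hne]
          · simp [h1, h2]
      rw [Finset.sum_congr rfl fun s _ => hterm s, Finset.sum_sub_distrib,
        Finset.sum_ite_eq', Finset.sum_ite_eq']
      simp only [Finset.mem_Ioi]
      by_cases hjk : j = k
      · subst hjk; simp [hlt]
      · by_cases hj : j < k
        · simp [hj, hj.trans hlt, hjk]
        · have : ¬ j < k' := by
            rw [Fin.lt_def] at hj ⊢
            have : j.val ≠ k.val := fun e => hjk (Fin.ext e)
            omega
          simp [hj, hjk, this]
    rw [hs]
    by_cases hj : j = k
    · subst hj
      simp [hne.symm, Zs_Z (q := q) hne, qc_eq]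
      match_scalars; field_simp; ring
    · by_cases hj' : j = k'
      · subst hj'
        simp [hne, Zs_Z (q := q) hne, qc_eq]
        match_scalars; field_simp
      · simp [hj, hj']
  | f0_sq => simp [skewFree_mul, skewFree_gen, ef]
  | zs_f0 i =>
    simp only [skewFree_mul, skewFree_gen, mk_zs, mk_f0, ezs, ef]
    split_ifs <;> simp [Zs_P0]
  | f0_z i =>
    simp only [skewFree_mul, skewFree_gen, mk_z, mk_f0, ez, ef]
    split_ifs <;> simp [P0_Z]

end compat

section omega
variable {n : ℕ} {q : QParam}

/-- The linear anti-automorphism that exchanges `z_i` and `z_i^*`, as a homomorphism into the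
opposite algebra. -/
noncomputable def flipHom (n : ℕ) (q : QParam) : FunAlg n q →ₐ[ℂ] (FunAlg n q)ᵐᵒᵖ :=
  liftF (fun g => match g with
    | .z i => MulOpposite.op (Zs q i)
    | .zs i => MulOpposite.op (Z q i)
    | .f0 => MulOpposite.op (P0 n q)) (by
    intro x y h
    cases h with
    | zz i j h => simp [← MulOpposite.op_mul, ← MulOpposite.op_smul, Zs_Zs h]
    | zszs i j h => simp [← MulOpposite.op_mul, ← MulOpposite.op_smul, Z_Z h]
    | zsz i j h => simp [← MulOpposite.op_mul, ← MulOpposite.op_smul, Zs_Z h.symm]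
    | zsz_self j =>
      simp [← MulOpposite.op_mul, ← MulOpposite.op_smul, Zs_Z_self,
        ← Finset.op_sum]
      rfl
    | f0_sq => simp [← MulOpposite.op_mul, P0_sq]
    | zs_f0 i => simp [← MulOpposite.op_mul, P0_Z]
    | f0_z i => simp [← MulOpposite.op_mul, Zs_P0])

/-- The linear anti-automorphism that exchanges `z_i` and `z_i^*`. -/
noncomputable def flip (x : FunAlg n q) : FunAlg n q := (flipHom n q x).unop

@[simp] theorem flip_add (x y : FunAlg n q) : flip (x + y) = flip x + flip y := by simp [flip]
@[simp] theorem flip_sub (x y : FunAlg n q) : flip (x - y) = flip x - flip y := by simp [flip]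
@[simp] theorem flip_neg (x : FunAlg n q) : flip (-x) = -flip x := by simp [flip]
@[simp] theorem flip_zero : flip (0 : FunAlg n q) = 0 := by simp [flip]
@[simp] theorem flip_one : flip (1 : FunAlg n q) = 1 := by simp [flip]
@[simp] theorem flip_smul (c : ℂ) (x : FunAlg n q) : flip (c • x) = c • flip x := by simp [flip]
@[simp] theorem flip_mul (x y : FunAlg n q) : flip (x * y) = flip y * flip x := by simp [flip]
@[simp] theorem flip_Z (i : Fin n) : flip (Z q i) = Zs q i := by
  rw [flip, Z, flipHom, liftF_gen]; rfl
@[simp] theorem flip_Zs (i : Fin n) : flip (Zs q i) = Z q i := by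
  rw [flip, Zs, flipHom, liftF_gen]; rfl
@[simp] theorem flip_P0 : flip (P0 n q) = P0 n q := by
  rw [flip, P0, flipHom, liftF_gen]; rfl

/-- Two multiplicative statements that hold on generators hold everywhere. -/
theorem FunAlg.induction {P : FunAlg n q → Prop} (hs : ∀ c : ℂ, P (c • 1))
    (hz : ∀ i, P (Z q i)) (hzs : ∀ i, P (Zs q i)) (h0 : P (P0 n q))
    (hm : ∀ a b, P a → P b → P (a * b)) (ha : ∀ a b, P a → P b → P (a + b))
    (x : FunAlg n q) : P x := by
  obtain ⟨y, rfl⟩ := mk_surjective x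
  induction y using FreeAlgebra.induction with
  | grade0 c => rw [AlgHom.commutes, Algebra.algebraMap_eq_smul_one]; exact hs c
  | grade1 g =>
    cases g with
    | z i => exact hz i
    | zs i => exact hzs i
    | f0 => exact h0
  | mul a b h1 h2 => rw [map_mul]; exact hm _ _ h1 h2
  | add a b h1 h2 => rw [map_add]; exact ha _ _ h1 h2

theorem flip_flip (x : FunAlg n q) : flip (flip x) = x := by
  induction x using FunAlg.induction <;> simp_all

theorem flip_torus (w : Fin n → ℤ) (x : FunAlg n q) :
    flip (torus q w x) = torus q (-w) (flip x) := by
  induction x using FunAlg.induction <;> simp_all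

theorem IsSkew.ext' {σ τ : FunAlg n q →ₐ[ℂ] FunAlg n q} {D D' : FunAlg n q →ₗ[ℂ] FunAlg n q}
    (hD : IsSkew σ τ D) (hD' : IsSkew σ τ D') (hz : ∀ i, D (Z q i) = D' (Z q i))
    (hzs : ∀ i, D (Zs q i) = D' (Zs q i)) (h0 : D (P0 n q) = D' (P0 n q)) : D = D' := by
  apply hD.ext hD'
  rintro (i | i | _)
  · exact hz i
  · exact hzs i
  · exact h0

end omega

section compat
variable {n : ℕ} {q : QParam}

/-- The inner skew derivation `x ↦ a x - (torus w x) a`. -/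
noncomputable def innerE (w : Fin n → ℤ) (a : FunAlg n q) : FunAlg n q →ₗ[ℂ] FunAlg n q :=
  LinearMap.mulLeft ℂ a - (LinearMap.mulRight ℂ a) ∘ₗ (torus q w).toLinearMap

theorem innerE_apply (w : Fin n → ℤ) (a x : FunAlg n q) :
    innerE w a x = a * x - torus q w x * a := rfl

theorem innerE_isSkew (w : Fin n → ℤ) (a : FunAlg n q) :
    IsSkew (torus q w) (AlgHom.id ℂ _) (innerE w a) := by
  intro x y
  simp only [innerE_apply, map_mul, AlgHom.id_apply]
  noncomm_ring

/-- The element that implements the last `E`. -/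
noncomputable def lastA (q : QParam) (k : Fin n) : FunAlg n q :=
  -(rc q / (1 - qc q ^ 2)) • Z q k

theorem inv_sub_ne (q : QParam) : (qc q ^ 2)⁻¹ - 1 ≠ 0 := by
  have h := one_sub_pow_ne q (k := 2) (by norm_num)
  have hq := qc_ne q
  intro e
  apply h
  have : (qc q ^ 2)⁻¹ = 1 := by linear_combination e
  rw [inv_eq_one] at this
  rw [this]; simp

theorem one_sub_rc_ne (q : QParam) : 1 - rc q ^ 4 ≠ 0 := by
  have h := one_sub_pow_ne q (k := 2) (by norm_num)
  rw [qc_eq] at h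
  ring_nf at h ⊢
  exact h

theorem last_eq {k i : Fin n} (hk : ¬ k.val + 1 < n) : i = k ∨ i < k := by
  rw [Fin.lt_def, Fin.ext_iff]; omega

theorem innerE_Z {k : Fin n} (hk : ¬ k.val + 1 < n) (i : Fin n) :
    innerE (wtK k) (lastA q k) (Z q i) = actEGen q k (.z i) := by
  have h := one_sub_rc_ne q
  simp only [innerE_apply, lastA, actEGen, hk, if_false, wtK, torus_Z]
  rcases last_eq (i := i) hk with rfl | hi
  · simp
    simp only [qc_eq]
    match_scalars; field_simp; ring
  · simp [hi.ne, Z_Z (q := q) hi]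
    simp only [qc_eq]
    match_scalars; field_simp; ring

theorem innerE_Zs {k : Fin n} (hk : ¬ k.val + 1 < n) (i : Fin n) :
    innerE (wtK k) (lastA q k) (Zs q i) = actEGen q k (.zs i) := by
  have h := one_sub_rc_ne q
  have hr := rc_ne q
  simp only [innerE_apply, lastA, actEGen, hk, dif_neg, if_false, wtK, torus_Zs, not_false_eq_true]
  rcases last_eq (i := i) hk with rfl | hi
  · have : Finset.Ioi i = ∅ := by
      ext s; simp only [Finset.mem_Ioi, Fin.lt_def, Finset.notMem_empty, iff_false]; omega
    simp [Zs_Z_self, this]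
    simp only [qc_eq]
    match_scalars <;> field_simp
    ring
  · simp [hi.ne, Zs_Z (q := q) hi.ne]
    simp only [qc_eq]
    match_scalars; field_simp; ring

theorem innerE_P0 {k : Fin n} (hk : ¬ k.val + 1 < n) :
    innerE (wtK k) (lastA q k) (P0 n q) = actEGen q k .f0 := by
  simp [innerE_apply, lastA, actEGen, hk, P0_Z]

theorem actE_compat (k : Fin n) (x y : FreeAlgebra ℂ (Gen n)) (h : Rel n q x y) :
    skewFree (torus q (wtK k)) (AlgHom.id ℂ _) (actEGen q k) x =
      skewFree (torus q (wtK k)) (AlgHom.id ℂ _) (actEGen q k) y := by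
  by_cases hk : k.val + 1 < n
  · exact actE_compat_lin k hk x y h
  · have hg : ∀ g, innerE (wtK k) (lastA q k) (gen q g) = actEGen q k g := by
      rintro (i | i | _)
      · exact innerE_Z hk i
      · exact innerE_Zs hk i
      · exact innerE_P0 hk
    rw [skewFree_eq (innerE_isSkew _ _) hg, skewFree_eq (innerE_isSkew _ _) hg, mk_rel h]

/-- The action of `E_k` on `F(U_n)_q`: the linear map with the values `actEGen` on the
generators and with `E_k (a b) = E_k a · b + K_k a · E_k b`. -/
noncomputable def actE (q : QParam) (k : Fin n) : FunAlg n q →ₗ[ℂ] FunAlg n q :=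
  skew (torus q (wtK k)) (AlgHom.id ℂ _) (actEGen q k) (actE_compat k)

theorem actE_mul (k : Fin n) (x y : FunAlg n q) :
    actE q k (x * y) = actE q k x * y + torus q (wtK k) x * actE q k y :=
  skew_isSkew (actE_compat k) x y

theorem actE_gen (k : Fin n) (g : Gen n) : actE q k (gen q g) = actEGen q k g :=
  skew_gen (actE_compat k) g

/-- `flip` composed with `E_k` composed with `flip`. -/
noncomputable def flipE (q : QParam) (k : Fin n) : FunAlg n q →ₗ[ℂ] FunAlg n q where
  toFun x := (if k.val + 1 < n then -(rc q ^ 4) else rc q ^ 4) • flip (actE q k (flip x))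
  map_add' x y := by simp
  map_smul' c x := by simp [smul_comm c]

theorem flipE_apply (k : Fin n) (x : FunAlg n q) : flipE q k x =
    (if k.val + 1 < n then -(rc q ^ 4) else rc q ^ 4) • flip (actE q k (flip x)) := rfl

theorem flipE_isSkew (k : Fin n) :
    IsSkew (AlgHom.id ℂ _) (torus q (-wtK k)) (flipE q k) := by
  intro x y
  simp only [flipE_apply, flip_mul, actE_mul, flip_add, flip_torus, flip_flip, AlgHom.id_apply]
  rw [smul_add, smul_mul_assoc, mul_smul_comm, add_comm]

theorem flipE_gen (k : Fin n) (g : Gen n) : flipE q k (gen q g) = actFGen q k g := by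
  have hr := rc_ne q
  have h := one_sub_rc_ne q
  have h' := inv_sub_ne q
  cases g with
  | z i =>
    change flipE q k (Z q i) = _
    rw [flipE_apply, flip_Z, Zs, actE_gen]
    simp only [actEGen, actFGen]
    split_ifs
    · simp; match_scalars; field_simp
    · simp
    · simp; match_scalars; field_simp
    · simp
  | zs i =>
    change flipE q k (Zs q i) = _
    rw [flipE_apply, flip_Zs, Z, actE_gen]
    simp only [actEGen, actFGen]
    split_ifs
    · simp; match_scalars; field_simp
    · simp
    · simp; match_scalars; ring
  | f0 =>
    change flipE q k (P0 n q) = _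
    rw [flipE_apply, flip_P0, P0, actE_gen]
    simp only [actEGen, actFGen]
    rw [qc_eq] at h' ⊢
    split_ifs
    · simp
    · have e : ((rc q ^ 2) ^ 2)⁻¹ - 1 = (1 - rc q ^ 4) / rc q ^ 4 := by field_simp
      rw [e]
      simp; match_scalars; field_simp

theorem actF_compat (k : Fin n) (x y : FreeAlgebra ℂ (Gen n)) (h : Rel n q x y) :
    skewFree (AlgHom.id ℂ _) (torus q (-wtK k)) (actFGen q k) x =
      skewFree (AlgHom.id ℂ _) (torus q (-wtK k)) (actFGen q k) y := by
  rw [skewFree_eq (flipE_isSkew k) (flipE_gen k), skewFree_eq (flipE_isSkew k) (flipE_gen k),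
    mk_rel h]

/-- The action of `F_k` on `F(U_n)_q`: the linear map with the values `actFGen` on the
generators and with `F_k (a b) = F_k a · K_k⁻¹ b + a · F_k b`. -/
noncomputable def actF (q : QParam) (k : Fin n) : FunAlg n q →ₗ[ℂ] FunAlg n q :=
  skew (AlgHom.id ℂ _) (torus q (-wtK k)) (actFGen q k) (actF_compat k)

theorem actF_mul (k : Fin n) (x y : FunAlg n q) :
    actF q k (x * y) = actF q k x * torus q (-wtK k) y + x * actF q k y :=
  skew_isSkew (actF_compat k) x y

theorem actF_gen (k : Fin n) (g : Gen n) : actF q k (gen q g) = actFGen q k g :=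
  skew_gen (actF_compat k) g

/-- The action of `K_k`. -/
noncomputable def actK (q : QParam) (k : Fin n) : FunAlg n q →ₗ[ℂ] FunAlg n q :=
  (torus q (wtK k)).toLinearMap

/-- The action of `K_k⁻¹`. -/
noncomputable def actKinv (q : QParam) (k : Fin n) : FunAlg n q →ₗ[ℂ] FunAlg n q :=
  (torus q (-wtK k)).toLinearMap

theorem actF_eq_flip (k : Fin n) : actF q k = flipE q k :=
  (skew_isSkew (actF_compat k)).ext (flipE_isSkew k) fun g => by
    rw [flipE_gen]; exact actF_gen k g

theorem actE_eq_inner {k : Fin n} (hk : ¬ k.val + 1 < n) :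
    actE q k = innerE (wtK k) (lastA q k) :=
  (skew_isSkew (actE_compat k)).ext' (innerE_isSkew _ _)
    (fun i => (actE_gen k _).trans (innerE_Z hk i).symm)
    (fun i => (actE_gen k _).trans (innerE_Zs hk i).symm)
    ((actE_gen k _).trans (innerE_P0 hk).symm)

end compat

section relations
variable {n : ℕ} {q : QParam}

/-- The weight of `E_k` with respect to `torus w`. -/
def wtE (w : Fin n → ℤ) (k : Fin n) : ℤ :=
  if h : k.val + 1 < n then w k - w ⟨k.val + 1, h⟩ else w k

theorem wtE_neg (w : Fin n → ℤ) (k : Fin n) : wtE (-w) k = -wtE w k := by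
  unfold wtE; split_ifs <;> simp [Pi.neg_apply]; ring

theorem wtE_wtK (i j : Fin n) : wtE (wtK i) j = CartanMatrix.A n i j := by
  simp only [wtE, wtK, CartanMatrix.A, Matrix.of_apply, Fin.ext_iff]
  split_ifs <;> omega

theorem torus_actE (w : Fin n → ℤ) (k : Fin n) (x : FunAlg n q) :
    torus q w (actE q k x) = qc q ^ wtE w k • actE q k (torus q w x) := by
  have hq := qc_ne q
  have key : (torus q w).toLinearMap ∘ₗ actE q k =
      qc q ^ wtE w k • (actE q k ∘ₗ (torus q w).toLinearMap) := by
    refine IsSkew.ext' (σ := (torus q w).comp (torus q (wtK k))) (τ := torus q w) ?_ ?_ ?_ ?_ ?_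
    · intro a b
      simp [actE_mul]
    · intro a b
      have : torus q (wtK k) (torus q w a) = torus q w (torus q (wtK k) a) := by
        rw [torus_torus, torus_torus, add_comm]
      simp [actE_mul, this]
    · intro i
      change torus q w (actE q k (Z q i)) = qc q ^ wtE w k • actE q k (torus q w (Z q i))
      rw [torus_Z, map_smul, show actE q k (Z q i) = actEGen q k (.z i) from actE_gen k _]
      simp only [actEGen, wtE]
      split_ifs with h1 h2
      · have : i = ⟨k.val + 1, h1⟩ := Fin.ext h2
        subst this
        simp [smul_smul]
        rw [zpow_sub₀ hq]; field_simp
      · simp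
      · simp [smul_smul]
        match_scalars; ring
    · intro i
      change torus q w (actE q k (Zs q i)) = qc q ^ wtE w k • actE q k (torus q w (Zs q i))
      rw [torus_Zs, map_smul, show actE q k (Zs q i) = actEGen q k (.zs i) from actE_gen k _]
      simp only [actEGen, wtE]
      split_ifs with h1 h2 h2
      · subst h2
        simp [smul_smul]
        rw [zpow_sub₀ hq]; field_simp
      · simp
      · subst h2
        simp [smul_smul]
        field_simp
      · simp
    · change torus q w (actE q k (P0 n q)) = qc q ^ wtE w k • actE q k (torus q w (P0 n q))
      rw [torus_P0, show actE q k (P0 n q) = actEGen q k .f0 from actE_gen k _]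
      simp only [actEGen, wtE]
      split_ifs with h1
      · simp
      · simp [smul_smul]
        match_scalars; ring
  exact LinearMap.congr_fun key x

theorem torus_actE' (i j : Fin n) (x : FunAlg n q) :
    torus q (wtK i) (actE q j x) = qc q ^ CartanMatrix.A n i j • actE q j (torus q (wtK i) x) := by
  rw [torus_actE, wtE_wtK]

theorem actF_apply (k : Fin n) (x : FunAlg n q) : actF q k x =
    (if k.val + 1 < n then -(rc q ^ 4) else rc q ^ 4) • flip (actE q k (flip x)) := by
  rw [actF_eq_flip]; rfl

theorem torus_actF (i j : Fin n) (x : FunAlg n q) :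
    torus q (wtK i) (actF q j x) =
      qc q ^ (-CartanMatrix.A n i j) • actF q j (torus q (wtK i) x) := by
  rw [actF_apply, actF_apply, map_smul, ← flip_flip (torus q (wtK i) (flip _)), flip_torus,
    flip_flip, torus_actE, flip_smul, wtE_neg, wtE_wtK, smul_comm, flip_torus]

theorem A_self (i : Fin n) : CartanMatrix.A n i i = 2 := by simp [CartanMatrix.A]

theorem A_adj {i j : Fin n} (h : i.val + 1 = j.val ∨ j.val + 1 = i.val) :
    CartanMatrix.A n i j = -1 := by
  simp only [CartanMatrix.A, Matrix.of_apply, Fin.ext_iff]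
  split_ifs <;> omega

theorem A_far {i j : Fin n} (h : ¬(i.val + 1 = j.val ∨ j.val + 1 = i.val)) (hne : i ≠ j) :
    CartanMatrix.A n i j = 0 := by
  simp only [CartanMatrix.A, Matrix.of_apply]
  simp [hne, h]

theorem torus_comm (w w' : Fin n → ℤ) (x : FunAlg n q) :
    torus q w (torus q w' x) = torus q w' (torus q w x) := by
  rw [torus_torus, torus_torus, add_comm]

/-! The values of the linear `E_k`. -/

theorem actE_Z {k : Fin n} (hk : k.val + 1 < n) (i : Fin n) :
    actE q k (Z q i) = if i.val = k.val + 1 then (rc q)⁻¹ • Z q k else 0 := by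
  rw [Z, actE_gen]; simp only [actEGen, hk, if_true]

theorem actE_Zs {k : Fin n} (hk : k.val + 1 < n) (i : Fin n) :
    actE q k (Zs q i) = if i = k then -((rc q)⁻¹ ^ 3) • Zs q ⟨k.val + 1, hk⟩ else 0 := by
  rw [Zs, actE_gen]; simp only [actEGen, hk, dif_pos]

theorem actE_P0 {k : Fin n} (hk : k.val + 1 < n) : actE q k (P0 n q) = 0 := by
  rw [P0, actE_gen]; simp only [actEGen, hk, if_true]

theorem actF_Z {k : Fin n} (hk : k.val + 1 < n) (i : Fin n) :
    actF q k (Z q i) = if i = k then rc q • Z q ⟨k.val + 1, hk⟩ else 0 := by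
  rw [Z, actF_gen]; simp only [actFGen, hk, dif_pos]

theorem actF_Zs {k : Fin n} (hk : k.val + 1 < n) (i : Fin n) :
    actF q k (Zs q i) = if i.val = k.val + 1 then -(rc q ^ 3) • Zs q k else 0 := by
  rw [Zs, actF_gen]; simp only [actFGen, hk, if_true]

theorem actF_P0 {k : Fin n} (hk : k.val + 1 < n) : actF q k (P0 n q) = 0 := by
  rw [P0, actF_gen]; simp only [actFGen, hk, if_true]

theorem actE_lastA_far {i j : Fin n} (h : ¬(i.val + 1 = j.val ∨ j.val + 1 = i.val))
    (hi : i.val + 1 < n) : actE q i (lastA q j) = 0 := by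
  rw [lastA, map_smul, actE_Z hi, if_neg (by omega), smul_zero]

theorem torus_lastA (w : Fin n → ℤ) (j : Fin n) :
    torus q w (lastA q j) = qc q ^ w j • lastA q j := by
  simp [lastA, smul_comm (qc q ^ w j)]

theorem actE_last {j : Fin n} (hj : ¬ j.val + 1 < n) (x : FunAlg n q) :
    actE q j x = lastA q j * x - torus q (wtK j) x * lastA q j := by
  rw [actE_eq_inner hj]; rfl

theorem EE_lin {i j : Fin n} (h : ¬(i.val + 1 = j.val ∨ j.val + 1 = i.val)) (hne : i ≠ j)
    (hi : i.val + 1 < n) (hj : j.val + 1 < n) (x : FunAlg n q) :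
    actE q i (actE q j x) = actE q j (actE q i x) := by
  have a1 := A_far h hne
  have a2 := A_far (i := j) (j := i) (by omega) hne.symm
  have key : actE q i ∘ₗ actE q j - actE q j ∘ₗ actE q i = 0 := by
    refine IsSkew.eq_zero (σ := (torus q (wtK i)).comp (torus q (wtK j))) (τ := AlgHom.id ℂ _) ?_ ?_
    · intro a b
      simp only [LinearMap.sub_apply, LinearMap.comp_apply, actE_mul, map_add, torus_actE', a1, a2,
        AlgHom.comp_apply, AlgHom.id_apply, zpow_zero, one_smul,
        torus_comm (wtK j) (wtK i)]
      noncomm_ring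
    · rintro (s | s | _)
      · change actE q i (actE q j (Z q s)) - actE q j (actE q i (Z q s)) = 0
        rw [actE_Z hi, actE_Z hj]
        split_ifs <;> simp [actE_Z hi, actE_Z hj] <;> omega
      · change actE q i (actE q j (Zs q s)) - actE q j (actE q i (Zs q s)) = 0
        rw [actE_Zs hi, actE_Zs hj]
        split_ifs <;> simp [actE_Zs hi, actE_Zs hj, Fin.ext_iff] <;> omega
      · change actE q i (actE q j (P0 n q)) - actE q j (actE q i (P0 n q)) = 0
        simp [actE_P0 hi, actE_P0 hj]
  exact sub_eq_zero.1 (LinearMap.congr_fun key x)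

theorem EE_last {i j : Fin n} (h : ¬(i.val + 1 = j.val ∨ j.val + 1 = i.val)) (hne : i ≠ j)
    (hi : i.val + 1 < n) (hj : ¬ j.val + 1 < n) (x : FunAlg n q) :
    actE q i (actE q j x) = actE q j (actE q i x) := by
  have a2 := A_far (i := j) (j := i) (by omega) hne.symm
  have w : wtK i j = 0 := by
    simp only [wtK, hi, if_true, hne.symm, if_false]
    rw [if_neg (by omega)]
  rw [actE_last hj, actE_last hj, map_sub, actE_mul, actE_mul, actE_lastA_far h hi, torus_lastA,
    w, torus_actE', a2]
  simp

theorem EE_comm {i j : Fin n} (h : ¬(i.val + 1 = j.val ∨ j.val + 1 = i.val)) (x : FunAlg n q) :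
    actE q i (actE q j x) = actE q j (actE q i x) := by
  by_cases hne : i = j
  · rw [hne]
  by_cases hi : i.val + 1 < n <;> by_cases hj : j.val + 1 < n
  · exact EE_lin h hne hi hj x
  · exact EE_last h hne hi hj x
  · exact (EE_last (by omega) (Ne.symm hne) hj hi x).symm
  · exact absurd (Fin.ext (by omega)) hne

theorem serreE_lin {i j : Fin n} (h : i.val + 1 = j.val ∨ j.val + 1 = i.val)
    (hi : i.val + 1 < n) (hj : j.val + 1 < n) (x : FunAlg n q) :
    actE q i (actE q i (actE q j x)) - (qc q + (qc q)⁻¹) • actE q i (actE q j (actE q i x)) +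
      actE q j (actE q i (actE q i x)) = 0 := by
  have hq := qc_ne q
  have a1 := A_adj h
  have a2 := A_adj (i := j) (j := i) (by omega)
  have key : actE q i ∘ₗ actE q i ∘ₗ actE q j -
      (qc q + (qc q)⁻¹) • (actE q i ∘ₗ actE q j ∘ₗ actE q i) +
      actE q j ∘ₗ actE q i ∘ₗ actE q i = 0 := by
    refine IsSkew.eq_zero
      (σ := (torus q (wtK i)).comp ((torus q (wtK i)).comp (torus q (wtK j))))
      (τ := AlgHom.id ℂ _) ?_ ?_
    · intro a b
      simp only [LinearMap.sub_apply, LinearMap.add_apply, LinearMap.smul_apply,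
        LinearMap.comp_apply, actE_mul, map_add, map_smul, torus_actE', a1, a2, A_self,
        AlgHom.comp_apply, AlgHom.id_apply, torus_comm (wtK j) (wtK i), zpow_neg_one, zpow_two,
        mul_add, add_mul, smul_mul_assoc, mul_smul_comm, smul_add, smul_smul, sub_mul, mul_sub]
      match_scalars <;> field_simp <;> ring
    · rintro (s | s | _)
      · change actE q i (actE q i (actE q j (Z q s))) -
          (qc q + (qc q)⁻¹) • actE q i (actE q j (actE q i (Z q s))) +
          actE q j (actE q i (actE q i (Z q s))) = 0
        rw [actE_Z hi, actE_Z hj]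
        split_ifs <;> simp [actE_Z hi, actE_Z hj] <;> split_ifs <;> simp [actE_Z hi] <;> omega
      · change actE q i (actE q i (actE q j (Zs q s))) -
          (qc q + (qc q)⁻¹) • actE q i (actE q j (actE q i (Zs q s))) +
          actE q j (actE q i (actE q i (Zs q s))) = 0
        rw [actE_Zs hi, actE_Zs hj]
        split_ifs <;> simp [actE_Zs hi, actE_Zs hj, Fin.ext_iff] <;> split_ifs <;>
          simp [actE_Zs hi, Fin.ext_iff] <;> omega
      · change actE q i (actE q i (actE q j (P0 n q))) -
          (qc q + (qc q)⁻¹) • actE q i (actE q j (actE q i (P0 n q))) +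
          actE q j (actE q i (actE q i (P0 n q))) = 0
        simp [actE_P0 hi, actE_P0 hj]
  exact LinearMap.congr_fun key x

end relations

section relations
variable {n : ℕ} {q : QParam}

theorem wtK_val {i j : Fin n} (h : i.val + 1 = j.val) (hj : ¬ j.val + 1 < n) :
    wtK i j = -1 ∧ wtK i i = 1 ∧ wtK j j = 2 ∧ wtK j i = 1 := by
  simp only [wtK, Fin.ext_iff]
  refine ⟨?_, ?_, ?_, ?_⟩ <;> split_ifs <;> omega

/-- Facts about `A` and `A' = E_i A`. -/
theorem lastA_facts {i j : Fin n} (h : i.val + 1 = j.val) (hj : ¬ j.val + 1 < n) :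
    ∃ A' : FunAlg n q, actE q i (lastA q j) = A' ∧ actE q i A' = 0 ∧
      torus q (wtK i) (lastA q j) = (qc q)⁻¹ • lastA q j ∧
      torus q (wtK i) A' = qc q • A' ∧ torus q (wtK j) (lastA q j) = (qc q ^ 2) • lastA q j ∧
      torus q (wtK j) A' = qc q • A' ∧ A' * lastA q j = qc q • (lastA q j * A') := by
  have hi : i.val + 1 < n := by omega
  obtain ⟨w1, w2, w3, w4⟩ := wtK_val h hj
  have hij : i < j := by rw [Fin.lt_def]; omega
  have e : actE q i (lastA q j) = (-(rc q / (1 - qc q ^ 2)) * (rc q)⁻¹) • Z q i := by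
    rw [lastA, map_smul, actE_Z hi, if_pos h.symm, smul_smul]
  refine ⟨_, e, ?_, ?_, ?_, ?_, ?_, ?_⟩
  · rw [map_smul, actE_Z hi, if_neg (by omega), smul_zero]
  · rw [torus_lastA, w1, zpow_neg_one]
  · rw [map_smul, torus_Z, w2, zpow_one, smul_comm]
  · rw [torus_lastA, w3]; rfl
  · rw [map_smul, torus_Z, w4, zpow_one, smul_comm]
  · rw [lastA, smul_mul_smul_comm, smul_mul_smul_comm, Z_Z hij]
    match_scalars; ring

theorem serreE_last1 {i j : Fin n} (h : i.val + 1 = j.val) (hj : ¬ j.val + 1 < n)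
    (x : FunAlg n q) :
    actE q i (actE q i (actE q j x)) - (qc q + (qc q)⁻¹) • actE q i (actE q j (actE q i x)) +
      actE q j (actE q i (actE q i x)) = 0 := by
  have hq := qc_ne q
  have a1 := A_adj (.inl h)
  have a2 := A_adj (i := j) (j := i) (by omega)
  obtain ⟨A', e1, e2, e3, e4, e5, e6, e7⟩ := lastA_facts (q := q) h hj
  simp only [actE_last hj, map_sub, actE_mul, map_add, map_mul, map_smul, torus_actE', e1, e2, e3,
    e4, a1, a2, A_self, torus_comm (wtK j) (wtK i), zpow_neg_one, zpow_two, mul_add, add_mul,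
    smul_mul_assoc, mul_smul_comm, smul_add, smul_sub, smul_smul, sub_mul, mul_sub, mul_zero, zero_mul]
  match_scalars <;> field_simp <;> ring

theorem serreE_last2 {i j : Fin n} (h : i.val + 1 = j.val) (hj : ¬ j.val + 1 < n)
    (x : FunAlg n q) :
    actE q j (actE q j (actE q i x)) - (qc q + (qc q)⁻¹) • actE q j (actE q i (actE q j x)) +
      actE q i (actE q j (actE q j x)) = 0 := by
  have hq := qc_ne q
  have a1 := A_adj (.inl h)
  have a2 := A_adj (i := j) (j := i) (by omega)
  obtain ⟨A', e1, e2, e3, e4, e5, e6, e7⟩ := lastA_facts (q := q) h hj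
  have e8 (y : FunAlg n q) : A' * (lastA q j * y) = qc q • (lastA q j * (A' * y)) := by
    rw [← mul_assoc, e7, smul_mul_assoc, mul_assoc]
  simp only [actE_last hj, map_sub, actE_mul, map_add, map_mul, map_smul, torus_actE', e1, e2, e3,
    e4, e5, e6, e7, e8, a1, a2, A_self, torus_comm (wtK j) (wtK i), zpow_neg_one, zpow_two, mul_add,
    add_mul, mul_assoc,
    smul_mul_assoc, mul_smul_comm, smul_add, smul_sub, smul_smul, sub_mul, mul_sub, mul_zero]
  match_scalars <;> field_simp <;> ring

theorem serreE {i j : Fin n} (h : i.val + 1 = j.val ∨ j.val + 1 = i.val) (x : FunAlg n q) :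
    actE q i (actE q i (actE q j x)) - (qc q + (qc q)⁻¹) • actE q i (actE q j (actE q i x)) +
      actE q j (actE q i (actE q i x)) = 0 := by
  by_cases hi : i.val + 1 < n <;> by_cases hj : j.val + 1 < n
  · exact serreE_lin h hi hj x
  · exact serreE_last1 (by omega) hj x
  · exact serreE_last2 (by omega) hi x
  · omega

theorem flip_actF (k : Fin n) (x : FunAlg n q) : actF q k (flip x) =
    (if k.val + 1 < n then -(rc q ^ 4) else rc q ^ 4) • flip (actE q k x) := by
  rw [actF_apply, flip_flip]

theorem FF_comm {i j : Fin n} (h : ¬(i.val + 1 = j.val ∨ j.val + 1 = i.val)) (x : FunAlg n q) :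
    actF q i (actF q j x) = actF q j (actF q i x) := by
  rw [← flip_flip x]
  simp only [flip_actF, map_smul]
  rw [EE_comm h, smul_comm]

theorem serreF {i j : Fin n} (h : i.val + 1 = j.val ∨ j.val + 1 = i.val) (x : FunAlg n q) :
    actF q i (actF q i (actF q j x)) - (qc q + (qc q)⁻¹) • actF q i (actF q j (actF q i x)) +
      actF q j (actF q i (actF q i x)) = 0 := by
  rw [← flip_flip x]
  have := congrArg flip (serreE h (flip x))
  simp only [flip_add, flip_sub, flip_smul, flip_zero] at this
  simp only [flip_actF, map_smul]
  set a := (if i.val + 1 < n then -(rc q ^ 4) else rc q ^ 4)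
  set b := (if j.val + 1 < n then -(rc q ^ 4) else rc q ^ 4)
  have h2 := congrArg (fun y => (a * a * b) • y) this
  simp only [smul_zero] at h2
  rw [← h2]
  module

/-- The element that implements the last `F`. -/
noncomputable def lastB (q : QParam) (k : Fin n) : FunAlg n q :=
  (rc q ^ 4) • flip (lastA q k)

theorem lastB_eq (k : Fin n) : lastB q k = (rc q ^ 4 * -(rc q / (1 - qc q ^ 2))) • Zs q k := by
  simp [lastB, lastA, smul_smul]

theorem actF_last {j : Fin n} (hj : ¬ j.val + 1 < n) (x : FunAlg n q) :
    actF q j x = x * lastB q j - lastB q j * torus q (-wtK j) x := by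
  rw [actF_apply, if_neg hj, actE_last hj, flip_sub, flip_mul, flip_mul, flip_flip, flip_torus,
    flip_flip, lastB]
  simp [smul_sub]

theorem torus_lastB (w : Fin n → ℤ) (j : Fin n) :
    torus q w (lastB q j) = qc q ^ (-w j) • lastB q j := by
  rw [lastB_eq, map_smul, torus_Zs, smul_comm]

theorem EF_last {j : Fin n} (hj : ¬ j.val + 1 < n) (x : FunAlg n q) :
    actE q j (actF q j x) - actF q j (actE q j x) =
      (qc q - (qc q)⁻¹)⁻¹ • (torus q (wtK j) x - torus q (-wtK j) x) := by
  have hq := qc_ne q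
  have hr := rc_ne q
  have h4 := one_sub_rc_ne q
  have w3 : wtK j j = 2 := by simp [wtK, hj]
  have hI : Finset.Ioi j = ∅ := by
    ext s; simp only [Finset.mem_Ioi, Fin.lt_def, Finset.notMem_empty, iff_false]; omega
  have hd : qc q - (qc q)⁻¹ ≠ 0 := by
    rw [qc_eq]
    intro e
    apply h4
    field_simp at e
    linear_combination -e
  have hBA : lastB q j * lastA q j = (qc q ^ 2) • (lastA q j * lastB q j) -
      (qc q ^ 2) • (qc q - (qc q)⁻¹)⁻¹ • (1 : FunAlg n q) := by
    rw [lastB_eq, lastA, smul_mul_smul_comm, smul_mul_smul_comm, Zs_Z_self, hI]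
    simp only [qc_eq] at hd ⊢
    have e : (rc q ^ 2 - (rc q ^ 2)⁻¹)⁻¹ = - (rc q ^ 2) / (1 - rc q ^ 4) := by
      have : rc q ^ 2 - (rc q ^ 2)⁻¹ = -(1 - rc q ^ 4) / rc q ^ 2 := by field_simp; ring
      rw [this]; field_simp
    rw [e]
    simp
    match_scalars <;> field_simp
  have e8 (y : FunAlg n q) : lastB q j * (lastA q j * y) =
      (qc q ^ 2) • (lastA q j * (lastB q j * y)) -
      (qc q ^ 2) • (qc q - (qc q)⁻¹)⁻¹ • y := by
    rw [← mul_assoc, hBA]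
    simp [sub_mul, mul_assoc]
  have t1 : torus q (wtK j) (torus q (-wtK j) x) = x := by
    rw [torus_torus, add_neg_cancel, torus_zero]
  have t2 : torus q (-wtK j) (torus q (wtK j) x) = x := by
    rw [torus_torus, neg_add_cancel, torus_zero]
  simp only [actE_last hj, actF_last hj, map_sub, map_mul, torus_lastA, torus_lastB, w3, t1, t2,
    Pi.neg_apply, neg_neg, sub_mul, mul_sub, smul_mul_assoc, mul_smul_comm, mul_assoc, e8, hBA,
    smul_sub, smul_smul, mul_one]
  simp only [zpow_neg, show (2 : ℤ) = ((2 : ℕ) : ℤ) from rfl, zpow_natCast]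
  match_scalars <;> field_simp <;> ring

theorem EF_mixed1 {i j : Fin n} (hi : i.val + 1 < n) (hj : ¬ j.val + 1 < n) (x : FunAlg n q) :
    actE q i (actF q j x) = actF q j (actE q i x) := by
  have hne : j ≠ i := by rintro rfl; exact hj hi
  have hB : actE q i (lastB q j) = 0 := by
    rw [lastB_eq, map_smul, actE_Zs hi, if_neg hne, smul_zero]
  have hw : wtK i j = CartanMatrix.A n j i := by
    simp only [wtK, CartanMatrix.A, Matrix.of_apply, Fin.ext_iff] at *
    split_ifs <;> omega
  rw [actF_last hj, actF_last hj, map_sub, actE_mul, actE_mul, hB, torus_lastB, torus_actE,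
    wtE_neg, wtE_wtK, hw]
  simp

theorem EF_mixed2 {i j : Fin n} (hi : ¬ i.val + 1 < n) (hj : j.val + 1 < n) (x : FunAlg n q) :
    actE q i (actF q j x) = actF q j (actE q i x) := by
  have h := EF_mixed1 (q := q) hj hi (flip x)
  rw [flip_actF, actF_apply i, if_neg hi, map_smul] at h
  have h' := congrArg flip (smul_right_injective _ (pow_ne_zero 4 (rc_ne q)) h)
  rw [flip_flip] at h'
  rw [actF_apply j, actF_apply j, map_smul, h']

theorem EF_skew (i j : Fin n) : IsSkew (torus q (wtK i)) (torus q (-wtK j))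
    (actE q i ∘ₗ actF q j - actF q j ∘ₗ actE q i) := by
  have hq := qc_ne q
  intro a b
  have h1 : torus q (wtK i) (actF q j a) * actE q i (torus q (-wtK j) b) =
      actF q j (torus q (wtK i) a) * torus q (-wtK j) (actE q i b) := by
    rw [torus_actF, torus_actE, wtE_neg, wtE_wtK, smul_mul_assoc, mul_smul_comm]
    congr 2
    simp only [CartanMatrix.A, Matrix.of_apply, Fin.ext_iff]
    split_ifs <;> omega
  simp only [LinearMap.sub_apply, LinearMap.comp_apply, actE_mul, actF_mul, map_add, h1]
  noncomm_ring

theorem torus_skew (i : Fin n) : IsSkew (torus q (wtK i)) (torus q (-wtK i))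
    ((qc q - (qc q)⁻¹)⁻¹ • ((torus q (wtK i)).toLinearMap - (torus q (-wtK i)).toLinearMap)) := by
  intro a b
  simp only [LinearMap.smul_apply, LinearMap.sub_apply, AlgHom.toLinearMap_apply, map_mul,
    smul_mul_assoc, mul_smul_comm, ← smul_add]
  congr 1
  noncomm_ring

theorem EF_lin_self {i : Fin n} (hi : i.val + 1 < n) (x : FunAlg n q) :
    actE q i (actF q i x) - actF q i (actE q i x) =
      (qc q - (qc q)⁻¹)⁻¹ • (torus q (wtK i) x - torus q (-wtK i) x) := by
  have hq := qc_ne q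
  have hr := rc_ne q
  have hd : qc q - (qc q)⁻¹ ≠ 0 := by
    have h4 := one_sub_pow_ne q (k := 2) (by norm_num)
    intro e
    apply h4
    field_simp at e
    linear_combination -e
  have key := (EF_skew (q := q) i i).ext' (torus_skew i) ?_ ?_ ?_
  · exact LinearMap.congr_fun key x
  · intro s
    change actE q i (actF q i (Z q s)) - actF q i (actE q i (Z q s)) =
      (qc q - (qc q)⁻¹)⁻¹ • (torus q (wtK i) (Z q s) - torus q (-wtK i) (Z q s))
    rw [actE_Z hi, actF_Z hi, torus_Z, torus_Z]
    simp only [wtK, hi, if_true, Pi.neg_apply]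
    by_cases h1 : s = i
    · subst h1
      simp [actE_Z hi, smul_smul, ← sub_smul, hr, hd]
    · by_cases h2 : s.val = i.val + 1
      · have : s = ⟨i.val + 1, hi⟩ := Fin.ext h2
        subst this
        simp [actF_Z hi, smul_smul, ← sub_smul, hr, h1]
        match_scalars
        rw [show (qc q)⁻¹ - qc q = -(qc q - (qc q)⁻¹) by ring, mul_neg, inv_mul_cancel₀ hd, mul_one]
      · simp [h1, h2]
  · intro s
    change actE q i (actF q i (Zs q s)) - actF q i (actE q i (Zs q s)) =
      (qc q - (qc q)⁻¹)⁻¹ • (torus q (wtK i) (Zs q s) - torus q (-wtK i) (Zs q s))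
    rw [actE_Zs hi, actF_Zs hi, torus_Zs, torus_Zs]
    simp only [wtK, hi, if_true, Pi.neg_apply]
    by_cases h1 : s = i
    · subst h1
      simp [actF_Zs hi, smul_smul, ← sub_smul, hr]
      match_scalars
      rw [show (qc q)⁻¹ - qc q = -(qc q - (qc q)⁻¹) by ring, mul_neg, inv_mul_cancel₀ hd, mul_one]
    · by_cases h2 : s.val = i.val + 1
      · have : s = ⟨i.val + 1, hi⟩ := Fin.ext h2
        subst this
        simp [actE_Zs hi, smul_smul, ← sub_smul, hr, h1, hd]
      · simp [h1, h2]
  · change actE q i (actF q i (P0 n q)) - actF q i (actE q i (P0 n q)) =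
      (qc q - (qc q)⁻¹)⁻¹ • (torus q (wtK i) (P0 n q) - torus q (-wtK i) (P0 n q))
    simp [actE_P0 hi, actF_P0 hi]

theorem EF_lin_ne {i j : Fin n} (hne : i ≠ j) (hi : i.val + 1 < n) (hj : j.val + 1 < n)
    (x : FunAlg n q) : actE q i (actF q j x) = actF q j (actE q i x) := by
  have hv : i.val ≠ j.val := fun e => hne (Fin.ext e)
  have key := (EF_skew (q := q) i j).ext' (D' := 0) (fun a b => by simp) ?_ ?_ ?_
  · exact sub_eq_zero.1 (LinearMap.congr_fun key x)
  · intro s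
    change actE q i (actF q j (Z q s)) - actF q j (actE q i (Z q s)) = 0
    rw [actE_Z hi, actF_Z hj]
    split_ifs <;> simp [actE_Z hi, actF_Z hj, Fin.ext_iff, hv, hv.symm]
  · intro s
    change actE q i (actF q j (Zs q s)) - actF q j (actE q i (Zs q s)) = 0
    rw [actE_Zs hi, actF_Zs hj]
    split_ifs <;> simp [actE_Zs hi, actF_Zs hj, Fin.ext_iff, hv, hv.symm]
  · change actE q i (actF q j (P0 n q)) - actF q j (actE q i (P0 n q)) = 0
    simp [actE_P0 hi, actF_P0 hj]

theorem EF_rel (i j : Fin n) (x : FunAlg n q) :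
    actE q i (actF q j x) - actF q j (actE q i x) =
      if i = j then (qc q - (qc q)⁻¹)⁻¹ • (torus q (wtK i) x - torus q (-wtK i) x) else 0 := by
  split_ifs with h
  · subst h
    by_cases hi : i.val + 1 < n
    · exact EF_lin_self hi x
    · exact EF_last hi x
  · rw [sub_eq_zero]
    by_cases hi : i.val + 1 < n <;> by_cases hj : j.val + 1 < n
    · exact EF_lin_ne h hi hj x
    · exact EF_mixed1 hi hj x
    · exact EF_mixed2 hi hj x
    · exact absurd (Fin.ext (by omega)) h

end relations

/-! ### The quantum universal enveloping algebra -/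

/-- Generators of `U_q sl_{n+1}`. -/
inductive UGen (n : ℕ) : Type
  | E (i : Fin n) : UGen n
  | F (i : Fin n) : UGen n
  | K (i : Fin n) : UGen n
  | Kinv (i : Fin n) : UGen n

open FreeAlgebra in
/-- The Drinfeld-Jimbo relations of type `A_n`. -/
inductive URel (n : ℕ) (q : QParam) :
    FreeAlgebra ℂ (UGen n) → FreeAlgebra ℂ (UGen n) → Prop
  | KK (i j : Fin n) : URel n q (ι ℂ (.K i) * ι ℂ (.K j)) (ι ℂ (.K j) * ι ℂ (.K i))
  | K_Kinv (i : Fin n) : URel n q (ι ℂ (.K i) * ι ℂ (.Kinv i)) 1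
  | Kinv_K (i : Fin n) : URel n q (ι ℂ (.Kinv i) * ι ℂ (.K i)) 1
  | KE (i j : Fin n) : URel n q (ι ℂ (.K i) * ι ℂ (.E j))
      (qc q ^ CartanMatrix.A n i j • (ι ℂ (.E j) * ι ℂ (.K i)))
  | KF (i j : Fin n) : URel n q (ι ℂ (.K i) * ι ℂ (.F j))
      (qc q ^ (-CartanMatrix.A n i j) • (ι ℂ (.F j) * ι ℂ (.K i)))
  | EF (i j : Fin n) : URel n q (ι ℂ (.E i) * ι ℂ (.F j) - ι ℂ (.F j) * ι ℂ (.E i))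
      (if i = j then (qc q - (qc q)⁻¹)⁻¹ • (ι ℂ (.K i) - ι ℂ (.Kinv i)) else 0)
  | EEE (i j : Fin n) (h : i.val + 1 = j.val ∨ j.val + 1 = i.val) :
      URel n q (ι ℂ (.E i) * ι ℂ (.E i) * ι ℂ (.E j) -
        (qc q + (qc q)⁻¹) • (ι ℂ (.E i) * ι ℂ (.E j) * ι ℂ (.E i)) +
        ι ℂ (.E j) * ι ℂ (.E i) * ι ℂ (.E i)) 0
  | FFF (i j : Fin n) (h : i.val + 1 = j.val ∨ j.val + 1 = i.val) :
      URel n q (ι ℂ (.F i) * ι ℂ (.F i) * ι ℂ (.F j) -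
        (qc q + (qc q)⁻¹) • (ι ℂ (.F i) * ι ℂ (.F j) * ι ℂ (.F i)) +
        ι ℂ (.F j) * ι ℂ (.F i) * ι ℂ (.F i)) 0
  | EE (i j : Fin n) (h : ¬(i.val + 1 = j.val ∨ j.val + 1 = i.val)) :
      URel n q (ι ℂ (.E i) * ι ℂ (.E j)) (ι ℂ (.E j) * ι ℂ (.E i))
  | FF (i j : Fin n) (h : ¬(i.val + 1 = j.val ∨ j.val + 1 = i.val)) :
      URel n q (ι ℂ (.F i) * ι ℂ (.F j)) (ι ℂ (.F j) * ι ℂ (.F i))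

/-- The algebra `U_q sl_{n+1}`, which underlies the `*`-Hopf algebra `U_q su_{n,1}`. -/
def Uq (n : ℕ) (q : QParam) : Type := RingQuot (URel n q)

noncomputable instance instRingUq (n : ℕ) (q : QParam) : Ring (Uq n q) :=
  inferInstanceAs (Ring (RingQuot (URel n q)))

noncomputable instance instAlgebraUq (n : ℕ) (q : QParam) : Algebra ℂ (Uq n q) :=
  inferInstanceAs (Algebra ℂ (RingQuot (URel n q)))

/-- The quotient map from the free algebra onto `U_q sl_{n+1}`. -/
noncomputable def Uq.mk (n : ℕ) (q : QParam) : FreeAlgebra ℂ (UGen n) →ₐ[ℂ] Uq n q :=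
  RingQuot.mkAlgHom ℂ (URel n q)

theorem Uq.mk_surjective {n : ℕ} {q : QParam} : Function.Surjective (Uq.mk n q) :=
  RingQuot.mkAlgHom_surjective ℂ _

/-- The operators on `F(U_n)_q` by which the generators of `U_q sl_{n+1}` act. -/
noncomputable def uGenAct {n : ℕ} (q : QParam) : UGen n → Module.End ℂ (FunAlg n q)
  | .E i => actE q i
  | .F i => actF q i
  | .K i => actK q i
  | .Kinv i => actKinv q i

/-- The action of `U_q su_{n,1}` on `F(U_n)_q`. -/
noncomputable def uqAct (n : ℕ) (q : QParam) : Uq n q →ₐ[ℂ] Module.End ℂ (FunAlg n q) :=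
  RingQuot.liftAlgHom ℂ ⟨FreeAlgebra.lift ℂ (uGenAct q), by
    intro x y h
    ext v
    cases h with
    | KK i j => simp [uGenAct, actK, torus_comm (wtK i) (wtK j)]
    | K_Kinv i => simp [uGenAct, actK, actKinv, torus_torus, torus_zero]
    | Kinv_K i => simp [uGenAct, actK, actKinv, torus_torus, torus_zero]
    | KE i j => simp [uGenAct, actK, torus_actE']
    | KF i j => simp [uGenAct, actK, torus_actF]
    | EF i j =>
      have := EF_rel i j v
      split_ifs with hij
      · simpa [uGenAct, actK, actKinv, hij] using this
      · simpa [uGenAct, actK, actKinv, hij] using this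
    | EEE i j h => simpa [uGenAct] using serreE h v
    | FFF i j h => simpa [uGenAct] using serreF h v
    | EE i j h => simpa [uGenAct] using EE_comm h v
    | FF i j h => simpa [uGenAct] using FF_comm h v⟩

theorem uqAct_mk {n : ℕ} {q : QParam} (x : FreeAlgebra ℂ (UGen n)) :
    uqAct n q (Uq.mk n q x) = FreeAlgebra.lift ℂ (uGenAct q) x :=
  RingQuot.liftAlgHom_mkAlgHom_apply ℂ (FreeAlgebra.lift ℂ (uGenAct q)) _ x

/-! ### Finite functions -/

/-- The two-sided ideal `D(U_n)_q = F f_0 F` of finite functions. -/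
noncomputable def finiteFun (n : ℕ) (q : QParam) : Submodule ℂ (FunAlg n q) :=
  Submodule.span ℂ {x | ∃ a b : FunAlg n q, x = a * P0 n q * b}

section finite
variable {n : ℕ} {q : QParam}

theorem mem_finiteFun (a b : FunAlg n q) : a * P0 n q * b ∈ finiteFun n q :=
  Submodule.subset_span ⟨a, b, rfl⟩

theorem finiteFun_mul_left (a : FunAlg n q) {x : FunAlg n q} (hx : x ∈ finiteFun n q) :
    a * x ∈ finiteFun n q := by
  induction hx using Submodule.span_induction with
  | mem x h =>
    obtain ⟨b, c, rfl⟩ := h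
    rw [← mul_assoc, ← mul_assoc]
    exact mem_finiteFun _ _
  | zero => simp
  | add x y _ _ hx hy => rw [mul_add]; exact add_mem hx hy
  | smul c x _ hx => rw [mul_smul_comm]; exact Submodule.smul_mem _ _ hx

theorem finiteFun_mul_right {x : FunAlg n q} (hx : x ∈ finiteFun n q) (a : FunAlg n q) :
    x * a ∈ finiteFun n q := by
  induction hx using Submodule.span_induction with
  | mem x h =>
    obtain ⟨b, c, rfl⟩ := h
    rw [mul_assoc]
    exact mem_finiteFun _ _
  | zero => simp
  | add x y _ _ hx hy => rw [add_mul]; exact add_mem hx hy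
  | smul c x _ hx => rw [smul_mul_assoc]; exact Submodule.smul_mem _ _ hx

theorem P0_mem : P0 n q ∈ finiteFun n q := by simpa using mem_finiteFun (1 : FunAlg n q) 1

theorem torus_mem (w : Fin n → ℤ) {x : FunAlg n q} (hx : x ∈ finiteFun n q) :
    torus q w x ∈ finiteFun n q := by
  induction hx using Submodule.span_induction with
  | mem x h =>
    obtain ⟨b, c, rfl⟩ := h
    simp only [map_mul, torus_P0]
    exact mem_finiteFun _ _
  | zero => simp
  | add x y _ _ hx hy => rw [map_add]; exact add_mem hx hy
  | smul c x _ hx => rw [map_smul]; exact Submodule.smul_mem _ _ hx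

theorem actE_mem (k : Fin n) {x : FunAlg n q} (hx : x ∈ finiteFun n q) :
    actE q k x ∈ finiteFun n q := by
  have h0 : actE q k (P0 n q) ∈ finiteFun n q := by
    rw [P0, actE_gen]
    simp only [actEGen]
    split_ifs
    · simp
    · exact Submodule.smul_mem _ _ (finiteFun_mul_left _ P0_mem)
  induction hx using Submodule.span_induction with
  | mem x h =>
    obtain ⟨b, c, rfl⟩ := h
    simp only [map_mul, torus_P0, actE_mul, add_mul]
    exact add_mem (add_mem (mem_finiteFun _ _)
      (finiteFun_mul_right (finiteFun_mul_left _ h0) _)) (mem_finiteFun _ _)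
  | zero => simp
  | add x y _ _ hx hy => rw [map_add]; exact add_mem hx hy
  | smul c x _ hx => rw [map_smul]; exact Submodule.smul_mem _ _ hx

theorem actF_mem (k : Fin n) {x : FunAlg n q} (hx : x ∈ finiteFun n q) :
    actF q k x ∈ finiteFun n q := by
  have h0 : actF q k (P0 n q) ∈ finiteFun n q := by
    rw [P0, actF_gen]
    simp only [actFGen]
    split_ifs
    · simp
    · exact Submodule.smul_mem _ _ (finiteFun_mul_right P0_mem _)
  induction hx using Submodule.span_induction with
  | mem x h =>
    obtain ⟨b, c, rfl⟩ := h
    simp only [map_mul, torus_P0, actF_mul, add_mul]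
    exact add_mem (add_mem (mem_finiteFun _ _)
      (finiteFun_mul_right (finiteFun_mul_left _ h0) _)) (mem_finiteFun _ _)
  | zero => simp
  | add x y _ _ hx hy => rw [map_add]; exact add_mem hx hy
  | smul c x _ hx => rw [map_smul]; exact Submodule.smul_mem _ _ hx

theorem uqAct_mem (ξ : Uq n q) {x : FunAlg n q} (hx : x ∈ finiteFun n q) :
    uqAct n q ξ x ∈ finiteFun n q := by
  obtain ⟨y, rfl⟩ := Uq.mk_surjective ξ
  rw [uqAct_mk]
  induction y using FreeAlgebra.induction generalizing x with
  | grade0 c =>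
    rw [AlgHom.commutes, Module.algebraMap_end_apply]
    exact Submodule.smul_mem _ _ hx
  | grade1 g =>
    rw [FreeAlgebra.lift_ι_apply]
    cases g with
    | E i => exact actE_mem i hx
    | F i => exact actF_mem i hx
    | K i => exact torus_mem _ hx
    | Kinv i => exact torus_mem _ hx
  | mul a b ha hb => rw [map_mul]; exact ha (hb hx)
  | add a b ha hb => rw [map_add]; exact add_mem (ha hx) (hb hx)

/-- The action of `ξ ∈ U_q su_{n,1}` on the finite functions. -/
noncomputable def uqActFin (ξ : Uq n q) : finiteFun n q →ₗ[ℂ] finiteFun n q :=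
  (uqAct n q ξ).restrict fun _ hx => uqAct_mem ξ hx

end finite

/-! ### The Fock representation -/

/-- The polynomials in `z_1, …, z_n` in the basis of monomials
`z^m = z_n^{m_n} ⋯ z_1^{m_1}`; also the space `H` with its basis `z^m e_0`. -/
abbrev Hol (n : ℕ) : Type := (Fin n → ℕ) →₀ ℂ

section fock
variable {n : ℕ} (q : QParam)

/-- `m_{i+1} + ⋯ + m_n`. -/
def tail (i : Fin n) (m : Fin n → ℕ) : ℕ := ∑ j ∈ Finset.Ioi i, m j

/-- The operator by which `z_i` acts on `H`. -/
noncomputable def zOp (i : Fin n) : Module.End ℂ (Hol n) :=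
  Finsupp.linearCombination ℂ fun m : Fin n → ℕ =>
    Finsupp.single (m + Pi.single i 1) (qc q ^ tail i m)

/-- The operator by which `z_i^*` acts on `H`; it annihilates `z^m e_0` if `m_i = 0`. -/
noncomputable def zsOp (i : Fin n) : Module.End ℂ (Hol n) :=
  Finsupp.linearCombination ℂ fun m : Fin n → ℕ =>
    Finsupp.single (m - Pi.single i 1) (qc q ^ tail i m * (1 - qc q ^ (2 * m i)))

/-- The projection onto `ℂ e_0` along the other basis vectors. -/
noncomputable def f0Op (n : ℕ) : Module.End ℂ (Hol n) :=
  Finsupp.linearCombination ℂ fun m : Fin n → ℕ => if m = 0 then Finsupp.single 0 1 else 0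

variable {q}

/-- The basis vector. -/
noncomputable def bv (m : Fin n → ℕ) : Hol n := Finsupp.single m 1

theorem single_eq (m : Fin n → ℕ) (c : ℂ) : (Finsupp.single m c : Hol n) = c • bv m := by
  simp [bv]

theorem hol_ext {f g : Module.End ℂ (Hol n)} (h : ∀ m, f (bv m) = g (bv m)) : f = g := by
  ext m : 2
  simpa [bv] using h m

theorem zOp_bv (i : Fin n) (m : Fin n → ℕ) :
    zOp q i (bv m) = qc q ^ tail i m • bv (m + Pi.single i 1) := by
  rw [zOp, bv, Finsupp.linearCombination_single, one_smul, single_eq]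

theorem zsOp_bv (i : Fin n) (m : Fin n → ℕ) : zsOp q i (bv m) =
    (qc q ^ tail i m * (1 - qc q ^ (2 * m i))) • bv (m - Pi.single i 1) := by
  rw [zsOp, bv, Finsupp.linearCombination_single, one_smul, single_eq]

theorem f0Op_bv (m : Fin n → ℕ) : f0Op n (bv m) = if m = 0 then bv 0 else 0 := by
  simp [f0Op, bv]

theorem tail_add (i j : Fin n) (m : Fin n → ℕ) :
    tail i (m + Pi.single j 1) = tail i m + if i < j then 1 else 0 := by
  simp [tail, Finset.sum_add_distrib, Finset.sum_pi_single]

theorem zsOp_bv_zero {i : Fin n} {m : Fin n → ℕ} (h : m i = 0) : zsOp q i (bv m) = 0 := by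
  simp [zsOp_bv, h]

theorem zsOp_bv_add (i : Fin n) (m : Fin n → ℕ) : zsOp q i (bv (m + Pi.single i 1)) =
    (qc q ^ tail i m * (1 - qc q ^ (2 * m i + 2))) • bv m := by
  rw [zsOp_bv, tail_add]
  simp [mul_add]

theorem exists_add {i : Fin n} {m : Fin n → ℕ} (h : m i ≠ 0) :
    ∃ m' : Fin n → ℕ, m = m' + Pi.single i 1 := by
  refine ⟨m - Pi.single i 1, ?_⟩
  funext j
  by_cases hj : j = i
  · subst hj; simp; omega
  · simp [hj]

theorem next_induction {P : Fin n → Prop} (hlast : ∀ j, ¬ j.val + 1 < n → P j)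
    (hstep : ∀ j (h : j.val + 1 < n), P ⟨j.val + 1, h⟩ → P j) (j : Fin n) : P j := by
  by_cases h : j.val + 1 < n
  · exact hstep j h (next_induction hlast hstep ⟨j.val + 1, h⟩)
  · exact hlast j h
termination_by n - j.val

theorem Ioi_last {j : Fin n} (h : ¬ j.val + 1 < n) : Finset.Ioi j = ∅ := by
  ext s; simp only [Finset.mem_Ioi, Fin.lt_def, Finset.notMem_empty, iff_false]; omega

theorem sum_Ioi_next {M : Type*} [AddCommMonoid M] (f : Fin n → M) {j : Fin n}
    (h : j.val + 1 < n) : ∑ s ∈ Finset.Ioi j, f s =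
      f ⟨j.val + 1, h⟩ + ∑ s ∈ Finset.Ioi ⟨j.val + 1, h⟩, f s := by
  have : Finset.Ioi j = insert ⟨j.val + 1, h⟩ (Finset.Ioi ⟨j.val + 1, h⟩) := by
    ext s
    simp only [Finset.mem_Ioi, Finset.mem_insert, Fin.lt_def, Fin.ext_iff]
    omega
  rw [this, Finset.sum_insert (by simp)]

theorem z_zs_bv (k : Fin n) (m : Fin n → ℕ) : zOp q k (zsOp q k (bv m)) =
    (qc q ^ (2 * tail k m) * (1 - qc q ^ (2 * m k))) • bv m := by
  by_cases h : m k = 0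
  · simp [zsOp_bv_zero h, h]
  · obtain ⟨m', rfl⟩ := exists_add h
    rw [zsOp_bv_add, map_smul, zOp_bv, smul_smul, tail_add]
    congr 1
    simp
    ring

theorem sum_z_zs_bv (j : Fin n) (m : Fin n → ℕ) :
    ∑ k ∈ Finset.Ioi j, zOp q k (zsOp q k (bv m)) = (1 - qc q ^ (2 * tail j m)) • bv m := by
  induction j using next_induction with
  | hlast j h => simp [Ioi_last h, tail]
  | hstep j h ih =>
    rw [sum_Ioi_next _ h, ih, z_zs_bv, ← add_smul]
    congr 1
    rw [tail, tail, sum_Ioi_next _ h, mul_add, pow_add]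
    ring

variable (n q)

/-- The Fock representation of `F(U_n)_q` in `H`. -/
noncomputable def fock : FunAlg n q →ₐ[ℂ] Module.End ℂ (Hol n) :=
  liftF (fun g => match g with
    | .z i => zOp q i
    | .zs i => zsOp q i
    | .f0 => f0Op n) (by
    intro x y h
    apply hol_ext
    intro m
    cases h with
    | zz i j h =>
      simp [zOp_bv, tail_add, smul_smul, h, h.not_gt]
      rw [add_right_comm]
      congr 1; ring
    | zszs i j h =>
      by_cases hi : m i = 0
      · simp [zsOp_bv_zero hi]
        rw [zsOp_bv, map_smul, zsOp_bv_zero]; simp; simp [hi]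
      · obtain ⟨m', rfl⟩ := exists_add hi
        by_cases hj : m' j = 0
        · have : (m' + Pi.single i 1 : Fin n → ℕ) j = 0 := by simp [hj, h.ne']
          simp [zsOp_bv_zero this, zsOp_bv_add, zsOp_bv_zero hj]
        · obtain ⟨m'', rfl⟩ := exists_add hj
          simp [zsOp_bv_add, smul_smul]
          rw [add_right_comm]
          simp [zsOp_bv_add, smul_smul, tail_add, h, h.not_gt, h.ne, h.ne']
          congr 1; ring
    | zsz i j h =>
      by_cases hi : m i = 0
      · have : (m + Pi.single j 1 : Fin n → ℕ) i = 0 := by simp [hi, h]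
        simp [zsOp_bv_zero hi, zOp_bv, zsOp_bv_zero this]
      · obtain ⟨m', rfl⟩ := exists_add hi
        simp [zsOp_bv_add, zOp_bv, smul_smul]
        rw [add_right_comm]
        simp [zsOp_bv_add, smul_smul, tail_add, h, h.symm]
        congr 1
        rcases lt_or_gt_of_ne h with h | h <;> simp [h, h.le, not_lt_of_gt h] <;> ring
    | zsz_self j =>
      have := sum_z_zs_bv (q := q) j m
      simp [this, zOp_bv, zsOp_bv_add, smul_smul, LinearMap.sum_apply]
      rw [z_zs_bv]
      match_scalars; ring
    | f0_sq =>
      by_cases hm : m = 0 <;> simp [f0Op_bv, hm]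
    | zs_f0 i =>
      by_cases hm : m = 0 <;> simp [f0Op_bv, hm, zsOp_bv]
    | f0_z i =>
      have : m + Pi.single i 1 ≠ 0 := fun h => by simpa using congrFun h i
      simp [zOp_bv, f0Op_bv, this])

variable {n q}

theorem fock_Z (i : Fin n) : fock n q (Z q i) = zOp q i := by
  rw [fock, Z, liftF_gen]

theorem fock_Zs (i : Fin n) : fock n q (Zs q i) = zsOp q i := by
  rw [fock, Zs, liftF_gen]

theorem fock_P0 : fock n q (P0 n q) = f0Op n := by
  rw [fock, P0, liftF_gen]

end fock

/-! ### Monomials and matrix units -/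

section monomials
variable {n : ℕ}

/-- The monomial `z^m = z_n^{m_n} ⋯ z_1^{m_1}`. -/
noncomputable def mono (q : QParam) (m : Fin n → ℕ) : FunAlg n q :=
  ((List.finRange n).reverse.map fun i => Z q i ^ m i).prod

/-- The monomial `z^{*m} = z_1^{*m_1} ⋯ z_n^{*m_n}`, which is `(z^m)^*`. -/
noncomputable def antimono (q : QParam) (m : Fin n → ℕ) : FunAlg n q :=
  ((List.finRange n).map fun i => Zs q i ^ m i).prod

variable {q : QParam}

theorem flip_pow (x : FunAlg n q) (p : ℕ) : flip (x ^ p) = flip x ^ p := by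
  induction p with
  | zero => simp
  | succ p ih => rw [pow_succ, flip_mul, ih, pow_succ']

theorem flip_list (L : List (Fin n)) (m : Fin n → ℕ) :
    flip (L.map fun i => Z q i ^ m i).prod = (L.reverse.map fun i => Zs q i ^ m i).prod := by
  induction L with
  | nil => simp
  | cons a L ih => simp [ih, flip_pow]

theorem flip_mono (m : Fin n → ℕ) : flip (mono q m) = antimono q m := by
  rw [mono, flip_list, List.reverse_reverse, antimono]

theorem mono_zero : mono q (0 : Fin n → ℕ) = 1 := by simp [mono]

theorem antimono_zero : antimono q (0 : Fin n → ℕ) = 1 := by simp [antimono]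

theorem Z_mul_pow {i a : Fin n} (h : i < a) (p : ℕ) :
    Z q i * Z q a ^ p = qc q ^ p • (Z q a ^ p * Z q i) := by
  induction p with
  | zero => simp
  | succ p ih =>
    rw [pow_succ, ← mul_assoc, ih, smul_mul_assoc, mul_assoc, Z_Z h, mul_smul_comm, smul_smul,
      mul_assoc, pow_succ]

theorem Z_mul_list (i : Fin n) (L : List (Fin n)) (hL : L.Pairwise (· > ·)) (hi : i ∈ L)
    (m : Fin n → ℕ) : ∃ c : ℂ, Z q i * (L.map fun j => Z q j ^ m j).prod =
      c • (L.map fun j => Z q j ^ (m + Pi.single i 1 : Fin n → ℕ) j).prod := by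
  induction L with
  | nil => simp at hi
  | cons a L ih =>
    rw [List.pairwise_cons] at hL
    by_cases ha : a = i
    · subst ha
      refine ⟨1, ?_⟩
      have : (L.map fun j => Z q j ^ (m + Pi.single a 1 : Fin n → ℕ) j) =
          L.map fun j => Z q j ^ m j := by
        apply List.map_congr_left
        intro j hj
        have : j ≠ a := (hL.1 j hj).ne
        simp [this]
      rw [List.map_cons, List.map_cons, this]
      simp [pow_succ', mul_assoc]
    · have hi' : i ∈ L := by
        rcases List.mem_cons.1 hi with h | h
        · exact absurd h.symm ha
        · exact h
      obtain ⟨c, hc⟩ := ih hL.2 hi'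
      refine ⟨qc q ^ m a * c, ?_⟩
      rw [List.map_cons, List.map_cons, List.prod_cons, List.prod_cons, ← mul_assoc,
        Z_mul_pow (hL.1 i hi'), smul_mul_assoc, mul_assoc, hc]
      simp [ha, smul_smul]

theorem Z_mul_mono (i : Fin n) (m : Fin n → ℕ) :
    ∃ c : ℂ, Z q i * mono q m = c • mono q (m + Pi.single i 1) := by
  apply Z_mul_list
  · rw [List.pairwise_reverse]
    exact List.pairwise_lt_finRange n
  · simp

/-- The span of the elements `z^m f_0`. -/
noncomputable def leftSpan (n : ℕ) (q : QParam) : Submodule ℂ (FunAlg n q) :=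
  Submodule.span ℂ (Set.range fun m : Fin n → ℕ => mono q m * P0 n q)

theorem Z_mul_leftSpan (i : Fin n) {x : FunAlg n q} (hx : x ∈ leftSpan n q) :
    Z q i * x ∈ leftSpan n q := by
  induction hx using Submodule.span_induction with
  | mem x h =>
    obtain ⟨m, rfl⟩ := h
    obtain ⟨c, hc⟩ := Z_mul_mono (q := q) i m
    change Z q i * (mono q m * P0 n q) ∈ _
    rw [← mul_assoc, hc, smul_mul_assoc]
    exact Submodule.smul_mem _ _ (Submodule.subset_span ⟨_, rfl⟩)
  | zero => simp
  | add x y _ _ hx hy => rw [mul_add]; exact add_mem hx hy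
  | smul c x _ hx => rw [mul_smul_comm]; exact Submodule.smul_mem _ _ hx

theorem P0_mem_leftSpan : P0 n q ∈ leftSpan n q :=
  Submodule.subset_span ⟨0, by simp [mono_zero]⟩

theorem word_mem_leftSpan (w : List (Fin n)) : (w.map (Z q)).prod * P0 n q ∈ leftSpan n q := by
  induction w with
  | nil => simpa using P0_mem_leftSpan
  | cons a w ih => rw [List.map_cons, List.prod_cons, mul_assoc]; exact Z_mul_leftSpan a ih

theorem Zs_word_mem (w : List (Fin n)) (i : Fin n) :
    Zs q i * ((w.map (Z q)).prod * P0 n q) ∈ leftSpan n q := by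
  induction w generalizing i with
  | nil => simp [Zs_P0]
  | cons a w ih =>
    rw [List.map_cons, List.prod_cons, mul_assoc, ← mul_assoc (Zs q i)]
    by_cases h : i = a
    · subst h
      rw [Zs_Z_self, add_mul, smul_mul_assoc, smul_mul_assoc, sub_mul, one_mul, Finset.sum_mul,
        mul_assoc]
      refine add_mem (Submodule.smul_mem _ _ (Z_mul_leftSpan i (ih i)))
        (Submodule.smul_mem _ _ (sub_mem (word_mem_leftSpan w) (sum_mem fun k _ => ?_)))
      rw [mul_assoc]
      exact Z_mul_leftSpan k (ih k)
    · rw [Zs_Z h, smul_mul_assoc, mul_assoc]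
      exact Submodule.smul_mem _ _ (Z_mul_leftSpan a (ih i))

theorem mono_word (m : Fin n → ℕ) : ∃ w : List (Fin n), mono q m = (w.map (Z q)).prod := by
  have (L : List (Fin n)) : ∃ w : List (Fin n),
      (L.map fun i => Z q i ^ m i).prod = (w.map (Z q)).prod := by
    induction L with
    | nil => exact ⟨[], rfl⟩
    | cons a L ih =>
      obtain ⟨w, hw⟩ := ih
      exact ⟨List.replicate (m a) a ++ w, by simp [hw]⟩
  exact this _

theorem P0_word (w : List (Fin n)) : P0 n q * ((w.map (Z q)).prod * P0 n q) ∈ leftSpan n q := by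
  cases w with
  | nil => simpa [P0_sq] using P0_mem_leftSpan
  | cons a w => simp [← mul_assoc, P0_Z]

theorem mul_leftSpan (a : FunAlg n q) {x : FunAlg n q} (hx : x ∈ leftSpan n q) :
    a * x ∈ leftSpan n q := by
  have key (b : FunAlg n q)
      (h : ∀ w : List (Fin n), b * ((w.map (Z q)).prod * P0 n q) ∈ leftSpan n q)
      {x : FunAlg n q} (hx : x ∈ leftSpan n q) : b * x ∈ leftSpan n q := by
    induction hx using Submodule.span_induction with
    | mem x h' =>
      obtain ⟨m, rfl⟩ := h'
      obtain ⟨w, hw⟩ := mono_word (q := q) m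
      change b * (mono q m * P0 n q) ∈ _
      rw [hw]; exact h w
    | zero => simp
    | add x y _ _ hx hy => rw [mul_add]; exact add_mem hx hy
    | smul c x _ hx => rw [mul_smul_comm]; exact Submodule.smul_mem _ _ hx
  induction a using FunAlg.induction generalizing x with
  | hs c => rw [smul_mul_assoc, one_mul]; exact Submodule.smul_mem _ _ hx
  | hz i => exact Z_mul_leftSpan i hx
  | hzs i => exact key _ (fun w => Zs_word_mem w i) hx
  | h0 => exact key _ P0_word hx
  | hm a b ha hb => rw [mul_assoc]; exact ha (hb hx)
  | ha a b ha hb => rw [add_mul]; exact add_mem (ha hx) (hb hx)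

/-- The finite function `z^l f_0 z^{*m}`. -/
noncomputable def unitF (q : QParam) (l m : Fin n → ℕ) : FunAlg n q :=
  mono q l * P0 n q * antimono q m

theorem unitF_mem (l m : Fin n → ℕ) : unitF q l m ∈ finiteFun n q := mem_finiteFun _ _

theorem finiteFun_le_span : finiteFun n q ≤
    Submodule.span ℂ (Set.range fun p : (Fin n → ℕ) × (Fin n → ℕ) => unitF q p.1 p.2) := by
  rw [finiteFun, Submodule.span_le]
  rintro _ ⟨a, b, rfl⟩
  have h1 : a * P0 n q ∈ leftSpan n q := mul_leftSpan a P0_mem_leftSpan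
  have h2 : flip b * P0 n q ∈ leftSpan n q := mul_leftSpan _ P0_mem_leftSpan
  have h3 (l : Fin n → ℕ) (y : FunAlg n q) (hy : y ∈ leftSpan n q) : mono q l * P0 n q * flip y ∈
      Submodule.span ℂ (Set.range fun p : (Fin n → ℕ) × (Fin n → ℕ) => unitF q p.1 p.2) := by
    induction hy using Submodule.span_induction with
    | mem x h =>
      obtain ⟨m, rfl⟩ := h
      refine Submodule.subset_span ⟨(l, m), ?_⟩
      simp only [flip_mul, flip_P0, flip_mono, unitF]
      rw [← mul_assoc (mono q l * P0 n q), mul_assoc (mono q l) (P0 n q) (P0 n q), P0_sq]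
    | zero => simp
    | add x y _ _ hx hy => rw [flip_add, mul_add]; exact add_mem hx hy
    | smul c x _ hx => rw [flip_smul, mul_smul_comm]; exact Submodule.smul_mem _ _ hx
  have h4 (x y : FunAlg n q) (hx : x ∈ leftSpan n q) (hy : y ∈ leftSpan n q) : x * flip y ∈
      Submodule.span ℂ (Set.range fun p : (Fin n → ℕ) × (Fin n → ℕ) => unitF q p.1 p.2) := by
    induction hx using Submodule.span_induction with
    | mem x h =>
      obtain ⟨l, rfl⟩ := h
      exact h3 l y hy
    | zero => simp
    | add x y _ _ hx hy => rw [add_mul]; exact add_mem hx hy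
    | smul c x _ hx => rw [smul_mul_assoc]; exact Submodule.smul_mem _ _ hx
  have h5 := h4 _ _ h1 h2
  rw [flip_mul, flip_flip, flip_P0, ← mul_assoc, mul_assoc a, P0_sq] at h5
  exact h5

/-! The Fock representation on monomials. -/

theorem zOp_pow_bv (i : Fin n) (p : ℕ) (k : Fin n → ℕ) :
    ∃ c : ℂ, c ≠ 0 ∧ (zOp q i ^ p) (bv k) = c • bv (k + Pi.single i p) := by
  induction p with
  | zero => exact ⟨1, one_ne_zero, by simp⟩
  | succ p ih =>
    obtain ⟨c, hc, h⟩ := ih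
    refine ⟨c * qc q ^ tail i (k + Pi.single i p), mul_ne_zero hc (pow_ne_zero _ (qc_ne q)), ?_⟩
    rw [pow_succ', Module.End.mul_apply, h, map_smul, zOp_bv, smul_smul, add_assoc,
      ← Pi.single_add]

theorem zsOp_pow_bv (i : Fin n) (p : ℕ) (k : Fin n → ℕ) :
    (p ≤ k i → ∃ c : ℂ, c ≠ 0 ∧ (zsOp q i ^ p) (bv k) = c • bv (k - Pi.single i p)) ∧
    (k i < p → (zsOp q i ^ p) (bv k) = 0) := by
  induction p with
  | zero => exact ⟨fun _ => ⟨1, one_ne_zero, by simp⟩, by simp⟩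
  | succ p ih =>
    constructor
    · intro hp
      obtain ⟨c, hc, h⟩ := ih.1 (by omega)
      refine ⟨c * (qc q ^ tail i (k - Pi.single i p) *
        (1 - qc q ^ (2 * (k - Pi.single i p : Fin n → ℕ) i))),
        mul_ne_zero hc (mul_ne_zero (pow_ne_zero _ (qc_ne q)) (one_sub_pow_ne q ?_)), ?_⟩
      · simp; omega
      · rw [pow_succ', Module.End.mul_apply, h, map_smul, zsOp_bv, smul_smul, tsub_tsub,
          ← Pi.single_add]
    · intro hp
      rw [pow_succ', Module.End.mul_apply]
      rcases Nat.lt_or_ge (k i) p with h | h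
      · rw [ih.2 h, map_zero]
      · obtain ⟨c, hc, h'⟩ := ih.1 h
        rw [h', map_smul, zsOp_bv_zero, smul_zero]
        simp; omega

/-- The restriction of a multi-index to the entries of a list. -/
def restr (L : List (Fin n)) (a : Fin n → ℕ) : Fin n → ℕ := fun i => if i ∈ L then a i else 0

theorem restr_cons {i : Fin n} {L : List (Fin n)} (h : i ∉ L) (a : Fin n → ℕ) :
    restr (i :: L) a = restr L a + Pi.single i (a i) := by
  funext j
  by_cases hj : j = i
  · subst hj; simp [restr, h]
  · simp [restr, hj]

theorem fock_mono (a k : Fin n → ℕ) :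
    ∃ c : ℂ, c ≠ 0 ∧ fock n q (mono q a) (bv k) = c • bv (k + a) := by
  have (L : List (Fin n)) (hL : L.Nodup) : ∃ c : ℂ, c ≠ 0 ∧
      fock n q (L.map fun i => Z q i ^ a i).prod (bv k) = c • bv (k + restr L a) := by
    induction L with
    | nil =>
      refine ⟨1, one_ne_zero, ?_⟩
      have : restr [] a = 0 := by funext i; simp [restr]
      simp [this]
    | cons i L ih =>
      rw [List.nodup_cons] at hL
      obtain ⟨c, hc, h⟩ := ih hL.2
      obtain ⟨d, hd, h'⟩ := zOp_pow_bv (q := q) i (a i) (k + restr L a)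
      refine ⟨c * d, mul_ne_zero hc hd, ?_⟩
      rw [List.map_cons, List.prod_cons, map_mul, Module.End.mul_apply, h, map_smul, map_pow,
        fock_Z, h', smul_smul, restr_cons hL.1, add_assoc]
  obtain ⟨c, hc, h⟩ := this (List.finRange n).reverse (by
    rw [List.nodup_reverse]; exact List.nodup_finRange n)
  refine ⟨c, hc, ?_⟩
  have e : restr (List.finRange n).reverse a = a := by funext i; simp [restr]
  rw [e] at h
  exact h

theorem fock_antimono (a k : Fin n → ℕ) :
    (a ≤ k → ∃ c : ℂ, c ≠ 0 ∧ fock n q (antimono q a) (bv k) = c • bv (k - a)) ∧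
    (¬ a ≤ k → fock n q (antimono q a) (bv k) = 0) := by
  have (L : List (Fin n)) (hL : L.Nodup) :
      ((∀ i ∈ L, a i ≤ k i) → ∃ c : ℂ, c ≠ 0 ∧
        fock n q (L.map fun i => Zs q i ^ a i).prod (bv k) = c • bv (k - restr L a)) ∧
      ((∃ i ∈ L, k i < a i) → fock n q (L.map fun i => Zs q i ^ a i).prod (bv k) = 0) := by
    induction L with
    | nil =>
      refine ⟨fun _ => ⟨1, one_ne_zero, ?_⟩, by simp⟩
      have : restr [] a = 0 := by funext i; simp [restr]
      simp [this]
    | cons i L ih =>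
      rw [List.nodup_cons] at hL
      have hi : (k - restr L a) i = k i := by simp [restr, hL.1]
      have ih := ih hL.2
      rw [List.map_cons, List.prod_cons, map_mul, Module.End.mul_apply, map_pow, fock_Zs]
      constructor
      · intro hk
        obtain ⟨c, hc, h⟩ := ih.1 fun j hj => hk j (List.mem_cons_of_mem _ hj)
        obtain ⟨d, hd, h'⟩ := (zsOp_pow_bv (q := q) i (a i) (k - restr L a)).1
          (by rw [hi]; exact hk i List.mem_cons_self)
        refine ⟨c * d, mul_ne_zero hc hd, ?_⟩
        rw [h, map_smul, h', smul_smul, restr_cons hL.1, tsub_tsub]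
      · intro hk
        by_cases hL' : ∃ j ∈ L, k j < a j
        · rw [ih.2 hL', map_zero]
        · have hki : k i < a i := by
            obtain ⟨j, hj, h⟩ := hk
            rcases List.mem_cons.1 hj with rfl | hj
            · exact h
            · exact absurd ⟨j, hj, h⟩ hL'
          push Not at hL'
          obtain ⟨c, hc, h⟩ := ih.1 hL'
          rw [h, map_smul, (zsOp_pow_bv (q := q) i (a i) (k - restr L a)).2 (by rw [hi]; exact hki),
            smul_zero]
  have h := this (List.finRange n) (List.nodup_finRange n)
  have e : restr (List.finRange n) a = a := by funext i; simp [restr]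
  rw [e] at h
  constructor
  · intro hk
    exact h.1 fun i _ => hk i
  · intro hk
    apply h.2
    rw [Pi.le_def] at hk
    push Not at hk
    obtain ⟨i, hi⟩ := hk
    exact ⟨i, by simp, hi⟩

/-- The matrix of an element of `F(U_n)_q` in the basis `z^m e_0` of the Fock representation. -/
noncomputable def mat (x : FunAlg n q) (m l : Fin n → ℕ) : ℂ := fock n q x (bv l) m

theorem mat_unitF (l m : Fin n → ℕ) : ∃ c : ℂ, c ≠ 0 ∧
    ∀ a b, mat (unitF q l m) a b = if a = l ∧ b = m then c else 0 := by
  obtain ⟨c, hc, h⟩ := (fock_antimono (q := q) m m).1 le_rfl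
  obtain ⟨d, hd, h'⟩ := fock_mono (q := q) l 0
  refine ⟨c * d, mul_ne_zero hc hd, fun a b => ?_⟩
  rw [tsub_self] at h
  rw [zero_add] at h'
  rw [mat, unitF, map_mul, map_mul, fock_P0, Module.End.mul_apply, Module.End.mul_apply]
  by_cases hb : b = m
  · subst hb
    rw [h, map_smul, f0Op_bv, if_pos rfl, map_smul, h', smul_smul]
    simp only [Finsupp.smul_apply, bv, Finsupp.single_apply, smul_eq_mul, and_true, eq_comm (a := a)]
    split_ifs <;> simp
  · rw [if_neg fun e => hb e.2]
    by_cases hmb : m ≤ b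
    · obtain ⟨c', hc', h''⟩ := (fock_antimono (q := q) m b).1 hmb
      have : b - m ≠ 0 := fun e => hb (le_antisymm (tsub_eq_zero_iff_le.1 e) hmb)
      rw [h'', map_smul, f0Op_bv, if_neg this]
      simp
    · rw [(fock_antimono (q := q) m b).2 hmb]
      simp

end monomials

/-! ### Distributions and integrals -/

/-- The space of distributions `D(U_n)'_q`.  A family `ψ` stands for the formal infinite series
of finite functions whose formal matrix in the basis `z^m e_0` of the Fock space is `ψ`.  A
series `∑ z^i f_{i,j}(y) z^{*j}` (`i × j = 0`) with arbitrary coefficients on the `q`-simplex has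
such a matrix, each entry being a fixed nonzero multiple of exactly one value
`f_{i,j}(q^{2k})`.  The topology is that of entrywise convergence. -/
abbrev Distr (n : ℕ) : Type := (Fin n → ℕ) → (Fin n → ℕ) → ℂ

section integrals
variable {n : ℕ}

/-- The embedding of finite functions into distributions. -/
noncomputable def toDistr {q : QParam} (f : finiteFun n q) : Distr n := mat (f : FunAlg n q)

/-- `(a; q²)_N`. -/
noncomputable def qPoch (q : QParam) (a : ℂ) (N : ℕ) : ℂ :=
  ∏ k ∈ Finset.range N, (1 - a * qc q ^ (2 * k))

/-- `q ^ (-2 n k_1 + 2 k_2 + ⋯ + 2 k_n)` with `k_i = m_i + ⋯ + m_n`; this is also the eigenvalue of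
`∏ K_j ^ (- j (n + 1 - j))` on `z^m`. -/
noncomputable def invWeight (q : QParam) (m : Fin n → ℕ) : ℂ :=
  qc q ^ (-2 * (n : ℤ) * ∑ i, (m i : ℤ) + 2 * ∑ i : Fin n, (i.val : ℤ) * (m i : ℤ))

/-- The invariant integral `∫ ψ dν_q`.  The diagonal entry of `ψ` at `m` is
`ψ_{0,0}(q^{2 k_1}, …, q^{2 k_n})` with `k_i = m_i + ⋯ + m_n`. -/
noncomputable def invInt (q : QParam) (ψ : Distr n) : ℂ :=
  qPoch q (qc q ^ 2) n * ∑ᶠ m, ψ m m * invWeight q m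

/-- The product `ψ f` of a distribution and a finite function. -/
noncomputable def mulFin {q : QParam} (ψ : Distr n) (f : finiteFun n q) : Distr n :=
  fun m l => ∑ᶠ k, ψ m k * mat (f : FunAlg n q) k l

/-- The pairing `∫ ψ f dν_q`. -/
noncomputable def pairing {q : QParam} (ψ : Distr n) (f : finiteFun n q) : ℂ :=
  invInt q (mulFin ψ f)

/-- The parameter `t = q ^ (2 α)`. -/
noncomputable def tPar (q : QParam) (α : ℝ) : ℂ := (((q : ℝ) ^ (2 * α) : ℝ) : ℂ)

/-- `q ^ (2 (α + 1) k_1 + 2 k_2 + ⋯ + 2 k_n)` with `k_i = m_i + ⋯ + m_n`. -/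
noncomputable def wWeight (q : QParam) (α : ℝ) (m : Fin n → ℕ) : ℂ :=
  (((q : ℝ) ^ (2 * (α + 1) * ∑ i, (m i : ℝ)) : ℝ) : ℂ) * qc q ^ (2 * ∑ i : Fin n, i.val * m i)

/-- The weighted integral `∫ x dm_{α,q}`. -/
noncomputable def wInt {q : QParam} (α : ℝ) (x : FunAlg n q) : ℂ :=
  qPoch q (tPar q α * qc q ^ 2) n * ∑' m, mat x m m * wWeight q α m

/-- The scalar product `(x, z^b)_{α,q} = ∫ (z^b)^* x dm_{α,q}`. -/
noncomputable def wInner {q : QParam} (α : ℝ) (x : FunAlg n q) (b : Fin n → ℕ) : ℂ :=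
  wInt α (antimono q b * x)

variable {q : QParam}

theorem mat_add (x y : FunAlg n q) : mat (x + y) = mat x + mat y := by
  funext m l; simp [mat]

theorem mat_smul (c : ℂ) (x : FunAlg n q) : mat (c • x) = c • mat x := by
  funext m l; simp [mat]

theorem mat_zero : mat (0 : FunAlg n q) = 0 := by
  funext m l; simp [mat]

theorem mat_finite {x : FunAlg n q} (hx : x ∈ finiteFun n q) :
    ∃ S : Set (Fin n → ℕ), S.Finite ∧ ∀ m l, mat x m l ≠ 0 → m ∈ S ∧ l ∈ S := by
  replace hx := finiteFun_le_span hx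
  induction hx using Submodule.span_induction with
  | mem x h =>
    obtain ⟨p, rfl⟩ := h
    obtain ⟨c, hc, h⟩ := mat_unitF (q := q) p.1 p.2
    refine ⟨{p.1, p.2}, by simp, fun m l hml => ?_⟩
    change mat (unitF q p.1 p.2) m l ≠ 0 at hml
    rw [h] at hml
    split_ifs at hml with h'
    · simp [h'.1, h'.2]
    · exact absurd rfl hml
  | zero => exact ⟨∅, Set.finite_empty, fun m l h => absurd (by rw [mat_zero]; rfl) h⟩
  | add x y _ _ ih1 ih2 =>
    obtain ⟨S, hS, h⟩ := ih1
    obtain ⟨S', hS', h'⟩ := ih2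
    refine ⟨S ∪ S', hS.union hS', fun m l hml => ?_⟩
    rw [mat_add] at hml
    by_cases h0 : mat x m l = 0
    · have : mat y m l ≠ 0 := fun h1 => hml (by simp [h0, h1])
      exact ⟨.inr (h' m l this).1, .inr (h' m l this).2⟩
    · exact ⟨.inl (h m l h0).1, .inl (h m l h0).2⟩
  | smul c x _ ih1 =>
    obtain ⟨S, hS, h⟩ := ih1
    refine ⟨S, hS, fun m l hml => h m l fun h0 => hml ?_⟩
    rw [mat_smul]; simp [h0]

theorem mat_eq_zero_of_fock {x : FunAlg n q} (h : ∀ k, fock n q x (bv k) = 0) : mat x = 0 := by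
  funext m l; simp [mat, h]

theorem wInt_zero {x : FunAlg n q} (α : ℝ) (h : mat x = 0) : wInt α x = 0 := by
  simp [wInt, h]

theorem fock_eq_sum {x : FunAlg n q} (k : Fin n → ℕ) :
    fock n q x (bv k) = (fock n q x (bv k)).sum fun m c => c • bv m := by
  simp [bv, Finsupp.sum_single]

/-- Only finitely many monomials have a nonzero scalar product with a finite function. -/
theorem wInner_finite (α : ℝ) {x : FunAlg n q} (hx : x ∈ finiteFun n q) :
    {b | wInner α x b / wInner α (mono q b) b ≠ 0}.Finite := by
  obtain ⟨S, hS, h⟩ := mat_finite hx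
  refine (hS.biUnion fun s _ => Set.finite_Iic s).subset fun b hb => ?_
  by_contra hb'
  apply hb
  have h0 : wInner α x b = 0 := by
    apply wInt_zero
    apply mat_eq_zero_of_fock
    intro k
    rw [map_mul, Module.End.mul_apply, fock_eq_sum k, Finsupp.sum, map_sum]
    refine Finset.sum_eq_zero fun m hm => ?_
    have hmS : m ∈ S := (h m k (Finsupp.mem_support_iff.1 hm)).1
    rw [map_smul, (fock_antimono b m).2, smul_zero]
    intro hbm
    apply hb'
    simp only [Set.mem_iUnion]
    exact ⟨m, hmS, hbm⟩
  rw [h0, zero_div]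

/-- Different monomials are orthogonal. -/
theorem wInner_mono_ne (α : ℝ) {a b : Fin n → ℕ} (hab : a ≠ b) :
    wInner α (mono q a) b = 0 := by
  have h0 (m : Fin n → ℕ) : mat (antimono q b * mono q a) m m = 0 := by
    obtain ⟨c, -, h⟩ := fock_mono (q := q) a m
    rw [mat, map_mul, Module.End.mul_apply, h, map_smul]
    by_cases hb : b ≤ m + a
    · obtain ⟨d, -, h'⟩ := (fock_antimono (q := q) b (m + a)).1 hb
      rw [h', bv, Finsupp.smul_apply, Finsupp.smul_apply, Finsupp.single_apply, if_neg]
      · simp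
      · intro he
        apply hab
        funext i
        have h1 := congrFun he i
        have h2 := hb i
        simp only [Pi.sub_apply, Pi.add_apply] at h1 h2
        omega
    · rw [(fock_antimono (q := q) b (m + a)).2 hb, smul_zero, Finsupp.zero_apply]
  simp [wInner, wInt, h0]

/-- The orthogonal projection `P_{α,q} x` of a finite function onto the weighted Bergman space, whose
orthogonal basis is formed by the monomials. -/
noncomputable def bergmanProj (α : ℝ) (x : finiteFun n q) : Hol n :=
  Finsupp.ofSupportFinite (fun b => wInner α (x : FunAlg n q) b / wInner α (mono q b) b)
    (wInner_finite α x.2)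

/-- The Toeplitz operator `T_f ψ = P_{α,q} (f ψ)`. -/
noncomputable def toeplitz (α : ℝ) (f : finiteFun n q) : Module.End ℂ (Hol n) :=
  Finsupp.linearCombination ℂ fun a =>
    bergmanProj α ⟨(f : FunAlg n q) * mono q a, finiteFun_mul_right f.2 _⟩

/-- The normalized `q`-trace on endomorphisms of the polynomials. -/
noncomputable def qTrace (q : QParam) (α : ℝ) (A : Module.End ℂ (Hol n)) : ℂ :=
  qPoch q (qc q ^ 2) n / qPoch q (tPar q α * qc q ^ 2) n *
    ∑ᶠ m, A (Finsupp.single m 1) m * invWeight q m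

/-- `σ` is the covariant symbol of `A`. -/
def IsCovariantSymbol (q : QParam) (α : ℝ) (A : Module.End ℂ (Hol n)) (σ : Distr n) : Prop :=
  ∀ f : finiteFun n q, pairing σ f = qTrace q α (A * toeplitz α f)

/-! Existence and uniqueness of covariant symbols. -/

theorem mulFin_support (ψ : Distr n) (f : finiteFun n q) {S : Set (Fin n → ℕ)} (m l : Fin n → ℕ)
    (h : ∀ m l, mat (f : FunAlg n q) m l ≠ 0 → m ∈ S ∧ l ∈ S) (hl : l ∉ S) :
    mulFin ψ f m l = 0 := by
  rw [mulFin]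
  apply finsum_eq_zero_of_forall_eq_zero
  intro k
  by_cases h0 : mat (f : FunAlg n q) k l = 0
  · rw [h0, mul_zero]
  · exact absurd (h k l h0).2 hl

theorem mulFin_add (ψ : Distr n) (f g : finiteFun n q) :
    mulFin ψ (f + g) = mulFin ψ f + mulFin ψ g := by
  funext m l
  obtain ⟨S, hS, h⟩ := mat_finite f.2
  obtain ⟨S', hS', h'⟩ := mat_finite g.2
  simp only [mulFin, Pi.add_apply, Submodule.coe_add, mat_add, mul_add]
  rw [finsum_add_distrib]
  · exact hS.subset fun k hk => (h k l fun h0 => hk (by simp [h0])).1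
  · exact hS'.subset fun k hk => (h' k l fun h0 => hk (by simp [h0])).1

theorem mulFin_smul (ψ : Distr n) (c : ℂ) (f : finiteFun n q) :
    mulFin ψ (c • f) = c • mulFin ψ f := by
  funext m l
  simp only [mulFin, Pi.smul_apply, Submodule.coe_smul, mat_smul, smul_eq_mul]
  rw [mul_finsum]
  exact finsum_congr fun k => by ring

theorem pairing_add (ψ : Distr n) (f g : finiteFun n q) :
    pairing ψ (f + g) = pairing ψ f + pairing ψ g := by
  obtain ⟨S, hS, h⟩ := mat_finite f.2
  obtain ⟨S', hS', h'⟩ := mat_finite g.2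
  simp only [pairing, invInt, mulFin_add, Pi.add_apply, add_mul]
  rw [finsum_add_distrib, mul_add]
  · refine hS.subset fun m hm => ?_
    by_contra hmS
    exact hm (by simp [mulFin_support ψ f m m h hmS])
  · refine hS'.subset fun m hm => ?_
    by_contra hmS
    exact hm (by simp [mulFin_support ψ g m m h' hmS])

theorem pairing_smul (ψ : Distr n) (c : ℂ) (f : finiteFun n q) :
    pairing ψ (c • f) = c * pairing ψ f := by
  simp only [pairing, invInt, mulFin_smul, Pi.smul_apply, smul_eq_mul, mul_assoc]
  rw [← mul_finsum]
  ring

/-- The pairing as a linear functional on finite functions. -/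
noncomputable def pairingL (q : QParam) (ψ : Distr n) : finiteFun n q →ₗ[ℂ] ℂ where
  toFun := pairing ψ
  map_add' := pairing_add ψ
  map_smul' := pairing_smul ψ

theorem qPoch_ne (q : QParam) (N : ℕ) : qPoch q (qc q ^ 2) N ≠ 0 := by
  rw [qPoch, Finset.prod_ne_zero_iff]
  intro k _
  rw [← pow_add]
  exact one_sub_pow_ne q (by omega)

theorem pairing_unitF (l m : Fin n → ℕ) : ∃ c : ℂ, c ≠ 0 ∧
    ∀ ψ : Distr n, pairing ψ ⟨unitF q l m, unitF_mem l m⟩ = c * ψ m l := by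
  obtain ⟨c, hc, h⟩ := mat_unitF (q := q) l m
  refine ⟨qPoch q (qc q ^ 2) n * (c * invWeight q m), ?_, fun ψ => ?_⟩
  · exact mul_ne_zero (qPoch_ne q n) (mul_ne_zero hc (zpow_ne_zero _ (qc_ne q)))
  · have h1 (k : Fin n → ℕ) : mulFin ψ ⟨unitF q l m, unitF_mem l m⟩ k k =
        if k = m then ψ k l * c else 0 := by
      simp only [mulFin, h]
      rw [finsum_eq_single _ l]
      · simp
      · intro j hj; simp [hj]
    rw [pairing, invInt, finsum_eq_single _ m]
    · rw [h1, if_pos rfl]; ring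
    · intro k hk; rw [h1, if_neg hk, zero_mul]

theorem finiteFun_hom_ext {φ φ' : finiteFun n q →ₗ[ℂ] ℂ}
    (h : ∀ l m, φ ⟨unitF q l m, unitF_mem l m⟩ = φ' ⟨unitF q l m, unitF_mem l m⟩) : φ = φ' := by
  ext ⟨x, hx⟩
  have hx' := finiteFun_le_span hx
  induction hx' using Submodule.span_induction with
  | mem x h' =>
    obtain ⟨p, rfl⟩ := h'
    exact h p.1 p.2
  | zero =>
    have : (⟨0, hx⟩ : finiteFun n q) = 0 := rfl
    rw [this, map_zero, map_zero]
  | add x y h1 h2 hx1 hy1 =>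
    have m (z : FunAlg n q) (hz : z ∈ Submodule.span ℂ (Set.range
        fun p : (Fin n → ℕ) × (Fin n → ℕ) => unitF q p.1 p.2)) : z ∈ finiteFun n q :=
      Submodule.span_le.2 (by rintro _ ⟨p, rfl⟩; exact unitF_mem _ _) hz
    have : (⟨x + y, hx⟩ : finiteFun n q) = ⟨x, m x h1⟩ + ⟨y, m y h2⟩ := rfl
    rw [this, map_add, map_add, hx1, hy1]
  | smul c x h1 hx1 =>
    have m (z : FunAlg n q) (hz : z ∈ Submodule.span ℂ (Set.range
        fun p : (Fin n → ℕ) × (Fin n → ℕ) => unitF q p.1 p.2)) : z ∈ finiteFun n q :=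
      Submodule.span_le.2 (by rintro _ ⟨p, rfl⟩; exact unitF_mem _ _) hz
    have : (⟨c • x, hx⟩ : finiteFun n q) = c • ⟨x, m x h1⟩ := rfl
    rw [this, map_smul, map_smul, hx1]

/-- Distributions are the same as linear functionals on finite functions. -/
theorem existsUnique_distr (φ : finiteFun n q →ₗ[ℂ] ℂ) : ∃! σ : Distr n, ∀ f, pairing σ f = φ f := by
  choose c hc h using fun l m : Fin n → ℕ => pairing_unitF (q := q) l m
  refine ⟨fun m l => (c l m)⁻¹ * φ ⟨unitF q l m, unitF_mem l m⟩, ?_, ?_⟩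
  · intro f
    have : pairingL q (fun m l => (c l m)⁻¹ * φ ⟨unitF q l m, unitF_mem l m⟩) = φ := by
      apply finiteFun_hom_ext
      intro l m
      change pairing _ _ = _
      rw [h, mul_inv_cancel_left₀ (hc l m)]
    exact LinearMap.congr_fun this f
  · intro σ hσ
    funext m l
    rw [← hσ, h, inv_mul_cancel_left₀ (hc l m)]

theorem wInt_summable (α : ℝ) {x : FunAlg n q} (hx : x ∈ finiteFun n q) :
    Summable fun m => mat x m m * wWeight q α m := by
  obtain ⟨S, hS, h⟩ := mat_finite hx
  refine summable_of_hasFiniteSupport (hS.subset fun m hm => ?_)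
  exact (h m m fun h0 => hm (by simp [h0])).1

theorem wInner_add (α : ℝ) {x y : FunAlg n q} (hx : x ∈ finiteFun n q) (hy : y ∈ finiteFun n q)
    (b : Fin n → ℕ) : wInner α (x + y) b = wInner α x b + wInner α y b := by
  simp only [wInner, wInt, mul_add, mat_add, Pi.add_apply, add_mul]
  rw [Summable.tsum_add (wInt_summable α (finiteFun_mul_left _ hx))
    (wInt_summable α (finiteFun_mul_left _ hy)), mul_add]

theorem wInner_smul (α : ℝ) (c : ℂ) (x : FunAlg n q) (b : Fin n → ℕ) :
    wInner α (c • x) b = c * wInner α x b := by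
  simp only [wInner, wInt, mul_smul_comm, mat_smul, Pi.smul_apply, smul_eq_mul, mul_assoc]
  rw [tsum_mul_left]; ring

theorem toeplitz_bv (α : ℝ) (f : finiteFun n q) (a : Fin n → ℕ) : toeplitz α f (bv a) =
    bergmanProj α ⟨(f : FunAlg n q) * mono q a, finiteFun_mul_right f.2 _⟩ := by
  simp [toeplitz, bv]

theorem bergmanProj_apply (α : ℝ) (x : finiteFun n q) (b : Fin n → ℕ) :
    bergmanProj α x b = wInner α (x : FunAlg n q) b / wInner α (mono q b) b := rfl

theorem toeplitz_add (α : ℝ) (f g : finiteFun n q) :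
    toeplitz α (f + g) = toeplitz α f + toeplitz α g := by
  apply hol_ext
  intro a
  rw [LinearMap.add_apply, toeplitz_bv, toeplitz_bv, toeplitz_bv]
  ext b
  simp only [Finsupp.add_apply, bergmanProj_apply, Submodule.coe_add, add_mul]
  rw [wInner_add α (finiteFun_mul_right f.2 _) (finiteFun_mul_right g.2 _), add_div]

theorem toeplitz_smul (α : ℝ) (c : ℂ) (f : finiteFun n q) :
    toeplitz α (c • f) = c • toeplitz α f := by
  apply hol_ext
  intro a
  rw [LinearMap.smul_apply, toeplitz_bv, toeplitz_bv]
  ext b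
  simp only [Finsupp.smul_apply, bergmanProj_apply, Submodule.coe_smul, smul_mul_assoc, wInner_smul,
    smul_eq_mul, mul_div_assoc]

theorem toeplitz_finite (α : ℝ) (f : finiteFun n q) :
    ∃ S : Set (Fin n → ℕ), S.Finite ∧ ∀ a, a ∉ S → toeplitz α f (bv a) = 0 := by
  obtain ⟨S, hS, h⟩ := mat_finite f.2
  refine ⟨_, hS.biUnion fun s _ => Set.finite_Iic s, fun a ha => ?_⟩
  rw [toeplitz_bv]
  have h0 (k : Fin n → ℕ) : fock n q ((f : FunAlg n q) * mono q a) (bv k) = 0 := by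
    obtain ⟨c, hc, h'⟩ := fock_mono (q := q) a k
    rw [map_mul, Module.End.mul_apply, h', map_smul]
    have : fock n q (f : FunAlg n q) (bv (k + a)) = 0 := by
      ext m
      by_contra h0
      apply ha
      simp only [Set.mem_iUnion]
      exact ⟨k + a, (h m (k + a) h0).2, by simp⟩
    rw [this, smul_zero]
  ext b
  rw [bergmanProj_apply]
  have : wInner α ((f : FunAlg n q) * mono q a) b = 0 := by
    apply wInt_zero
    apply mat_eq_zero_of_fock
    intro k
    rw [map_mul, Module.End.mul_apply, h0, map_zero]
  change wInner α ((f : FunAlg n q) * mono q a) b / _ = 0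
  rw [this, zero_div]

/-- The right-hand side of the definition of covariant symbols, as a linear functional. -/
noncomputable def traceL (q : QParam) (α : ℝ) (A : Module.End ℂ (Hol n)) : finiteFun n q →ₗ[ℂ] ℂ where
  toFun f := qTrace q α (A * toeplitz α f)
  map_add' f g := by
    obtain ⟨S, hS, h⟩ := toeplitz_finite α f
    obtain ⟨S', hS', h'⟩ := toeplitz_finite α g
    simp only [qTrace, toeplitz_add, mul_add, LinearMap.add_apply, Finsupp.add_apply, add_mul]
    rw [finsum_add_distrib, mul_add]
    · refine hS.subset fun m hm => ?_
      by_contra hmS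
      apply hm
      have := h m hmS
      rw [bv] at this
      simp [this]
    · refine hS'.subset fun m hm => ?_
      by_contra hmS
      apply hm
      have := h' m hmS
      rw [bv] at this
      simp [this]
  map_smul' c f := by
    simp only [qTrace, toeplitz_smul, mul_smul_comm, LinearMap.smul_apply, Finsupp.smul_apply,
      smul_eq_mul, mul_assoc, RingHom.id_apply]
    rw [← mul_finsum]
    ring

theorem existsUnique_covariantSymbol (q : QParam) (α : ℝ) (A : Module.End ℂ (Hol n)) :
    ∃! σ : Distr n, IsCovariantSymbol q α A σ :=
  existsUnique_distr (traceL q α A)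

/-- The covariant symbol `σ(A)`: the unique distribution with
`∫ σ(A) f dν_q = Tr_q (A T_f)` for all finite functions `f`. -/
noncomputable def covariantSymbol (q : QParam) (α : ℝ) (A : Module.End ℂ (Hol n)) : Distr n :=
  (existsUnique_covariantSymbol q α A).choose

/-- The `q`-Berezin transform `B_{q,α} f = σ(T_f)`. -/
noncomputable def berezin {q : QParam} (α : ℝ) (f : finiteFun n q) : Distr n :=
  covariantSymbol q α (toeplitz α f)

end integrals
end QuantumBall

namespace QuantumBall

/-! ### The Fock space -/

section fockSpace
variable {n : ℕ} {q : QParam}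

/-! Everything is read off from the bilinear form `(f, g) ↦ ∫ B_{q,t}(f) g dν_q`. By
`pairing_berezin` it equals, up to a factor depending on `t`, the trace of `T_f T_g` against the
diagonal weight of the invariant integral. The same trace with the Fock operators of `f` and `g` in
place of the Toeplitz operators gives `∫ f g dν_q` (`pairing_toDistr`), which is nondegenerate.

Polynomiality. For a matrix unit `f = |p₁⟩⟨p₂|` an entry of `T_f` at `(a, b)` is nonzero only if `p₁
- a = p₂ - b = k ≥ 0`; it is then `(tq²;q²)_n t^{|k|}` times a polynomial in `t`
(`toeplitz_matUnit`, resting on the closed form `wInner_mono` of the Bergman norms). Two such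
entries bring `(tq²;q²)_n` squared, the normalization removes one factor, and a polynomial in `t`
remains. Its constant term comes from `k = 0` only, where `T_f` degenerates to the Fock operator of
`f`. The powers `t^{|k|}` also show that, for fixed `f` and `j`, the coefficient of `t^j` is nonzero
on finitely many matrix units `g` only. Hence it is the pairing of `g` with a finite function, which
is `B_j f` (`exists_coefficients`). Each matrix entry of the series is thus a finite sum, so
entrywise convergence is automatic.

Equivariance. Fock and Toeplitz quantization are two instances of `IsQuantization`: `ρ(E_k f) = Y
ρ(f) - ρ(K_k f) Y` for an operator `Y` with the weights of `E_k`. The weight of the invariant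
integral changes by `q⁻²` under every `E_k`, which cancels the twist by `K_k`, so the trace kills
such twisted commutators (`trW_skew`, `invTrace_skew`) and both trace forms are invariant.
Invariance for all `t = q^{2α}`, infinitely many values, is an identity of polynomials
(`isInvariantForm_of_eval`), hence holds for each coefficient. A map relating an invariant form to a
nondegenerate invariant one commutes with the action (`map_uqActFin`). The generators `F_k` need no
separate computation: they are multiples of `E_k` conjugated by the linear anti-automorphism `flip`,
which reverses the trace form, and the order is restored by the twisted cyclicity `traceForm_swap`.

The real work is the equivariance of `f ↦ T_f`. For `k < n` the weighted integral is itself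
`E_k`-invariant, and `E_k`, `F_k` are adjoint on polynomials (`toeplitz_actE_lin`). For `k = n`,
`E_n` is a twisted commutator with a multiple of `z_n`, and `Y` is a `t`-dependent deformation of
multiplication by `z_n` (`toeplitz_actE_last`). -/

theorem tail_add_single (i j : Fin n) (p : ℕ) (m : Fin n → ℕ) :
    tail i (m + Pi.single j p) = tail i m + if i < j then p else 0 := by
  simp [tail, Finset.sum_add_distrib, Finset.sum_pi_single]

theorem zOp_pow_bv_eq (i : Fin n) (p : ℕ) (k : Fin n → ℕ) :
    (zOp q i ^ p) (bv k) = qc q ^ (p * tail i k) • bv (k + Pi.single i p) := by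
  induction p with
  | zero => simp
  | succ p ih =>
    rw [pow_succ', Module.End.mul_apply, ih, map_smul, zOp_bv, smul_smul, add_assoc,
      ← Pi.single_add, tail_add_single]
    congr 1
    simp; ring

/-- In `z_n^{a_n} ⋯ z_1^{a_1}` the small indices act first, and the scalar produced by `z_i`
involves only exponents with index above `i`. These are still those of `k` when `z_i` acts, so the
scalars do not interact. -/
theorem fock_mono_eq (a k : Fin n → ℕ) :
    fock n q (mono q a) (bv k) = qc q ^ (∑ i, a i * tail i k) • bv (k + a) := by
  have (L : List (Fin n)) (hL : L.Pairwise (· > ·)) :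
      fock n q (L.map fun i => Z q i ^ a i).prod (bv k) =
        qc q ^ (L.map fun i => a i * tail i k).sum • bv (k + restr L a) := by
    induction L with
    | nil =>
      have : restr [] a = 0 := by funext i; simp [restr]
      simp [this]
    | cons i L ih =>
      rw [List.pairwise_cons] at hL
      have hi : i ∉ L := fun h => lt_irrefl _ (hL.1 i h)
      have ht : tail i (k + restr L a) = tail i k := by
        simp only [tail, Pi.add_apply, Finset.sum_add_distrib, add_eq_left]
        refine Finset.sum_eq_zero fun j hj => if_neg fun h => ?_
        exact lt_asymm (hL.1 j h) (Finset.mem_Ioi.1 hj)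
      rw [List.map_cons, List.prod_cons, map_mul, Module.End.mul_apply, ih hL.2, map_smul,
        map_pow, fock_Z, zOp_pow_bv_eq, smul_smul, restr_cons hi, add_assoc, ht, List.map_cons,
        List.sum_cons, pow_add, mul_comm]
  have h := this (List.finRange n).reverse (by
    rw [List.pairwise_reverse]; exact List.pairwise_lt_finRange n)
  have e : restr (List.finRange n).reverse a = a := by funext i; simp [restr]
  rw [e] at h
  rw [mono, h, List.map_reverse, List.sum_reverse, ← Fin.sum_univ_def]

theorem tail_zero (i : Fin n) : tail i 0 = 0 := by simp [tail]

theorem fock_mono_zero (a : Fin n → ℕ) : fock n q (mono q a) (bv 0) = bv a := by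
  simp [fock_mono_eq, tail_zero]

/-- The scalar that `Z_mul_mono` leaves unspecified is found by applying both sides to the vacuum
vector. -/
theorem Z_mul_mono_eq (i : Fin n) (m : Fin n → ℕ) :
    Z q i * mono q m = qc q ^ tail i m • mono q (m + Pi.single i 1) := by
  obtain ⟨c, hc⟩ := Z_mul_mono (q := q) i m
  have h := congrArg (fun x => fock n q x (bv 0) (m + Pi.single i 1)) hc
  simp only [map_mul, Module.End.mul_apply, fock_mono_zero, fock_Z, zOp_bv, map_smul,
    LinearMap.smul_apply, Finsupp.smul_apply] at h
  simp only [bv, Finsupp.single_eq_same, smul_eq_mul, mul_one] at h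
  rw [hc, h]

/-- The vacuum is cyclic for the operators `z_i`: every basis vector is reached from `bv 0`, up to a
nonzero scalar, by induction on the total degree. -/
theorem hol_induction {P : Hol n → Prop} (h0 : P (bv 0)) (hz : ∀ i v, P v → P (zOp q i v))
    (ha : ∀ u v, P u → P v → P (u + v)) (hs : ∀ (c : ℂ) v, P v → P (c • v)) (v : Hol n) : P v := by
  have hb (N : ℕ) : ∀ m : Fin n → ℕ, ∑ i, m i = N → P (bv m) := by
    induction N with
    | zero =>
      intro m hm
      have : m = 0 := by
        funext i
        exact Finset.sum_eq_zero_iff.1 hm i (Finset.mem_univ i)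
      rw [this]; exact h0
    | succ N ih =>
      intro m hm
      have : ∃ i, m i ≠ 0 := by
        by_contra! h
        simp [h] at hm
      obtain ⟨i, hi⟩ := this
      obtain ⟨m', rfl⟩ := exists_add hi
      have h1 := hs (qc q ^ tail i m')⁻¹ _ (hz i _ (ih m' (by
        simpa [Finset.sum_add_distrib] using hm)))
      rwa [zOp_bv, smul_smul, inv_mul_cancel₀ (pow_ne_zero _ (qc_ne q)), one_smul] at h1
  induction v using Finsupp.induction_linear with
  | zero => simpa using hs 0 _ h0
  | add u v hu hv => exact ha _ _ hu hv
  | single m c => rw [single_eq]; exact hs c _ (hb _ m rfl)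

theorem hol_lin_ext {M : Type*} [AddCommMonoid M] [Module ℂ M] {f g : Hol n →ₗ[ℂ] M}
    (h : ∀ m, f (bv m) = g (bv m)) : f = g := by
  ext m : 2
  simpa [bv] using h m

theorem hol_lin_ext_zOp {M : Type*} [AddCommMonoid M] [Module ℂ M] {f g : Hol n →ₗ[ℂ] M}
    (h0 : f (bv 0) = g (bv 0)) (h : ∀ i v, f v = g v → f (zOp q i v) = g (zOp q i v))
    (v : Hol n) : f v = g v := by
  induction v using hol_induction (q := q) with
  | h0 => exact h0
  | hz i v hv => exact h i v hv
  | ha u v hu hv => rw [map_add, map_add, hu, hv]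
  | hs c v hv => rw [map_smul, map_smul, hv]

/-- The squared norm of `z^a e_0` in the Fock space. -/
noncomputable def hnorm (q : QParam) (a : Fin n → ℕ) : ℂ := ∏ i, qPoch q (qc q ^ 2) (a i)

theorem hnorm_ne (a : Fin n → ℕ) : hnorm q a ≠ 0 :=
  Finset.prod_ne_zero_iff.2 fun _ _ => qPoch_ne q _

theorem hnorm_zero : hnorm q (0 : Fin n → ℕ) = 1 := by simp [hnorm, qPoch]

theorem hnorm_add (i : Fin n) (a : Fin n → ℕ) :
    hnorm q (a + Pi.single i 1) = (1 - qc q ^ (2 * a i + 2)) * hnorm q a := by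
  simp only [hnorm]
  rw [← Finset.mul_prod_erase _ _ (Finset.mem_univ i),
    ← Finset.mul_prod_erase Finset.univ (fun j => qPoch q (qc q ^ 2) (a j)) (Finset.mem_univ i),
    ← mul_assoc]
  congr 1
  · simp [qPoch, Finset.prod_range_succ]; ring
  · refine Finset.prod_congr rfl fun j hj => ?_
    simp [Finset.ne_of_mem_erase hj]

/-- The bilinear form on the Fock space with orthogonal basis `z^a e_0`. -/
noncomputable def hform (n : ℕ) (q : QParam) : Hol n →ₗ[ℂ] Hol n →ₗ[ℂ] ℂ :=
  Finsupp.linearCombination ℂ fun a => hnorm q a • Finsupp.lapply a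

theorem hform_bv_left (a : Fin n → ℕ) (v : Hol n) : hform n q (bv a) v = hnorm q a * v a := by
  simp [hform, bv]

theorem bv_apply (a b : Fin n → ℕ) : (bv a : Hol n) b = if a = b then 1 else 0 := by
  rw [bv, Finsupp.single_apply]

theorem hform_symm (u v : Hol n) : hform n q u v = hform n q v u := by
  have : hform n q = (hform n q).flip := by
    refine hol_lin_ext fun a => hol_lin_ext fun b => ?_
    rw [LinearMap.flip_apply, hform_bv_left, hform_bv_left, bv_apply, bv_apply]
    by_cases h : a = b
    · simp [h]
    · simp [h, Ne.symm h]
  exact LinearMap.congr_fun₂ this u v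

theorem hform_flip_ext {A B : Module.End ℂ (Hol n)}
    (h : ∀ a b, hform n q (A (bv a)) (bv b) = hform n q (bv a) (B (bv b))) (u v : Hol n) :
    hform n q (A u) v = hform n q u (B v) := by
  have : (hform n q).comp A = (hform n q).compl₂ B :=
    hol_lin_ext fun a => hol_lin_ext fun b => h a b
  exact LinearMap.congr_fun₂ this u v

theorem hform_zOp (i : Fin n) (u v : Hol n) :
    hform n q (zOp q i u) v = hform n q u (zsOp q i v) := by
  refine hform_flip_ext (fun a b => ?_) u v
  rw [zOp_bv, map_smul, LinearMap.smul_apply, hform_bv_left, hform_bv_left, bv_apply]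
  by_cases h : b i = 0
  · rw [zsOp_bv_zero h, if_neg]
    · simp
    · rintro rfl; simp at h
  · obtain ⟨b, rfl⟩ := exists_add h
    rw [zsOp_bv_add, hnorm_add, Finsupp.smul_apply, bv_apply]
    by_cases hab : a = b
    · subst hab; simp; ring
    · rw [if_neg (by simpa using Ne.symm hab), if_neg (Ne.symm hab)]; simp

theorem hform_f0Op (u v : Hol n) : hform n q (f0Op n u) v = hform n q u (f0Op n v) := by
  refine hform_flip_ext (fun a b => ?_) u v
  rw [f0Op_bv, f0Op_bv]
  split_ifs with ha hb hb
  · simp [ha, hb]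
  · simp only [map_zero, hform_bv_left, bv_apply, if_neg hb, mul_zero]
  · simp only [map_zero, LinearMap.zero_apply, hform_bv_left, bv_apply, if_neg (Ne.symm ha),
      mul_zero]
  · simp

/-- The Fock representation is a `*`-representation, stated bilinearly: `flip` is the linear
counterpart of `*`, so it suffices to check that `z_i` and `z_i^*` are adjoint and `f_0` is
symmetric. -/
theorem hform_flip (x : FunAlg n q) (u v : Hol n) :
    hform n q (fock n q (flip x) u) v = hform n q u (fock n q x v) := by
  induction x using FunAlg.induction generalizing u v with
  | hs c => simp
  | hz i =>
    rw [flip_Z, fock_Zs, fock_Z, hform_symm, ← hform_zOp, hform_symm]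
  | hzs i => rw [flip_Zs, fock_Zs, fock_Z, hform_zOp]
  | h0 => rw [flip_P0, fock_P0, hform_f0Op]
  | hm a b ha hb => simp [ha, hb]
  | ha a b ha hb => simp [ha, hb]

theorem mat_flip (x : FunAlg n q) (l m : Fin n → ℕ) :
    mat (flip x) l m * hnorm q l = mat x m l * hnorm q m := by
  have h := hform_flip x (bv m) (bv l)
  rw [hform_symm, hform_bv_left, hform_bv_left] at h
  rw [mat, mat]
  linear_combination h

/-- On the diagonal the two norms cancel. Consequently every weighted trace is `flip`-invariant. -/
theorem mat_flip_diag (x : FunAlg n q) (m : Fin n → ℕ) : mat (flip x) m m = mat x m m :=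
  mul_right_cancel₀ (hnorm_ne m) (mat_flip x m m)

/-- The diagonal operator with eigenvalues `q ^ (w · m)`. -/
noncomputable def dOp (q : QParam) (w : Fin n → ℤ) : Module.End ℂ (Hol n) :=
  Finsupp.linearCombination ℂ fun m : Fin n → ℕ => qc q ^ (∑ i, w i * m i) • bv m

theorem dOp_bv (w : Fin n → ℤ) (m : Fin n → ℕ) :
    dOp q w (bv m) = qc q ^ (∑ i, w i * m i) • bv m := by
  exact (Finsupp.linearCombination_single ℂ 1 m).trans (one_smul _ _)

theorem dOp_apply (w : Fin n → ℤ) (v : Hol n) (m : Fin n → ℕ) :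
    dOp q w v m = qc q ^ (∑ i, w i * m i) * v m := by
  have : Finsupp.lapply m ∘ₗ dOp q w = qc q ^ (∑ i, w i * m i) • Finsupp.lapply m := by
    refine hol_lin_ext fun a => ?_
    simp only [LinearMap.comp_apply, dOp_bv, map_smul, Finsupp.lapply_apply, LinearMap.smul_apply,
      bv_apply, smul_eq_mul]
    split_ifs with h
    · rw [h]
    · simp
  exact LinearMap.congr_fun this v

theorem dOp_dOp (w w' : Fin n → ℤ) (v : Hol n) : dOp q w (dOp q w' v) = dOp q (w + w') v := by
  ext m
  simp only [dOp_apply, Pi.add_apply, add_mul, Finset.sum_add_distrib, zpow_add₀ (qc_ne q)]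
  ring

theorem sum_mul_add_single (w : Fin n → ℤ) (m : Fin n → ℕ) (i : Fin n) :
    ∑ j, w j * ((m + Pi.single i 1 : Fin n → ℕ) j : ℤ) = (∑ j, w j * m j) + w i := by
  simp only [Pi.add_apply, Nat.cast_add, mul_add, Finset.sum_add_distrib]
  congr 1
  rw [Finset.sum_eq_single i]
  · simp
  · intro j _ hj; simp [hj]
  · simp

theorem dOp_zOp (w : Fin n → ℤ) (i : Fin n) (v : Hol n) :
    dOp q w (zOp q i v) = qc q ^ w i • zOp q i (dOp q w v) := by
  have : dOp q w ∘ₗ zOp q i = qc q ^ w i • (zOp q i ∘ₗ dOp q w) := by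
    refine hol_lin_ext fun m => ?_
    simp only [LinearMap.comp_apply, LinearMap.smul_apply, zOp_bv, dOp_bv, map_smul, smul_smul,
      sum_mul_add_single, zpow_add₀ (qc_ne q)]
    congr 1; ring
  exact LinearMap.congr_fun this v

theorem dOp_zsOp (w : Fin n → ℤ) (i : Fin n) (v : Hol n) :
    dOp q w (zsOp q i v) = qc q ^ (-w i) • zsOp q i (dOp q w v) := by
  have : dOp q w ∘ₗ zsOp q i = qc q ^ (-w i) • (zsOp q i ∘ₗ dOp q w) := by
    refine hol_lin_ext fun m => ?_
    by_cases hm : m i = 0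
    · simp [zsOp_bv_zero hm, dOp_bv]
    · obtain ⟨m, rfl⟩ := exists_add hm
      simp only [LinearMap.comp_apply, LinearMap.smul_apply, zsOp_bv_add, dOp_bv, map_smul,
        smul_smul, sum_mul_add_single, zpow_add₀ (qc_ne q)]
      rw [zpow_neg]
      have := zpow_ne_zero (w i) (qc_ne q)
      congr 1
      field_simp
  exact LinearMap.congr_fun this v

theorem dOp_f0Op (w : Fin n → ℤ) (v : Hol n) : dOp q w (f0Op n v) = f0Op n (dOp q w v) := by
  have : dOp q w ∘ₗ f0Op n = f0Op n ∘ₗ dOp q w := by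
    refine hol_lin_ext fun m => ?_
    simp only [LinearMap.comp_apply, dOp_bv, map_smul, f0Op_bv]
    split_ifs with h
    · subst h; rw [dOp_bv]
    · simp
  exact LinearMap.congr_fun this v

/-- The torus automorphism is implemented by conjugation with the diagonal operator `dOp`; the form
with `dOp` on both sides avoids inverses. -/
theorem fock_torus (w : Fin n → ℤ) (x : FunAlg n q) (v : Hol n) :
    fock n q (torus q w x) (dOp q w v) = dOp q w (fock n q x v) := by
  induction x using FunAlg.induction generalizing v with
  | hs c => simp
  | hz i => rw [torus_Z, map_smul, fock_Z, LinearMap.smul_apply, dOp_zOp]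
  | hzs i => rw [torus_Zs, map_smul, fock_Zs, LinearMap.smul_apply, dOp_zsOp]
  | h0 => rw [torus_P0, fock_P0, dOp_f0Op]
  | hm a b ha hb => simp [ha, hb]
  | ha a b ha hb => simp [ha, hb]

/-- Polynomials as elements of `F(U_n)_q`. -/
noncomputable def phi (n : ℕ) (q : QParam) : Hol n →ₗ[ℂ] FunAlg n q :=
  Finsupp.linearCombination ℂ (mono q)

theorem phi_bv (m : Fin n → ℕ) : phi n q (bv m) = mono q m := by simp [phi, bv]

theorem phi_zOp (i : Fin n) (v : Hol n) : phi n q (zOp q i v) = Z q i * phi n q v := by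
  have : phi n q ∘ₗ zOp q i = LinearMap.mulLeft ℂ (Z q i) ∘ₗ phi n q := by
    refine hol_lin_ext fun m => ?_
    simp only [LinearMap.comp_apply, zOp_bv, map_smul, phi_bv, LinearMap.mulLeft_apply,
      Z_mul_mono_eq]
  exact LinearMap.congr_fun this v

theorem phi_dOp (w : Fin n → ℤ) (v : Hol n) : phi n q (dOp q w v) = torus q w (phi n q v) := by
  refine hol_lin_ext_zOp (q := q) (f := phi n q ∘ₗ dOp q w)
    (g := (torus q w).toLinearMap ∘ₗ phi n q) ?_ (fun i v h => ?_) v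
  · simp [dOp_bv, phi_bv, mono_zero]
  · simp only [LinearMap.comp_apply, AlgHom.toLinearMap_apply] at h ⊢
    rw [dOp_zOp, map_smul, phi_zOp, h, phi_zOp, map_mul, torus_Z, smul_mul_assoc]

/-- The Fock space as a left ideal of `F(U_n)_q`. -/
noncomputable def psi (n : ℕ) (q : QParam) : Hol n →ₗ[ℂ] FunAlg n q :=
  LinearMap.mulRight ℂ (P0 n q) ∘ₗ phi n q

theorem psi_apply (v : Hol n) : psi n q v = phi n q v * P0 n q := rfl

theorem fock_phi_bv_zero (v : Hol n) : fock n q (phi n q v) (bv 0) = v := by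
  refine hol_lin_ext_zOp (q := q) (g := LinearMap.id)
    (f := (LinearMap.applyₗ (bv 0)) ∘ₗ (fock n q).toLinearMap ∘ₗ phi n q) ?_ (fun i v h => ?_) v
  · simp [phi_bv, mono_zero]
  · simp only [LinearMap.comp_apply, AlgHom.toLinearMap_apply, LinearMap.applyₗ_apply_apply,
      LinearMap.id_apply] at h ⊢
    rw [phi_zOp, map_mul, Module.End.mul_apply, h, fock_Z]

theorem fock_psi_bv_zero (v : Hol n) : fock n q (psi n q v) (bv 0) = v := by
  rw [psi_apply, map_mul, Module.End.mul_apply, fock_P0, f0Op_bv, if_pos rfl, fock_phi_bv_zero]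

/-- `psi` identifies the Fock space with the left ideal spanned by the `z^m f_0`, and evaluation on
the vacuum is its inverse. -/
theorem psi_of_mem {x : FunAlg n q} (hx : x ∈ leftSpan n q) :
    psi n q (fock n q x (bv 0)) = x := by
  have : leftSpan n q ≤ LinearMap.range (psi n q) := by
    rw [leftSpan, Submodule.span_le]
    rintro _ ⟨m, rfl⟩
    exact ⟨bv m, by rw [psi_apply, phi_bv]⟩
  obtain ⟨v, rfl⟩ := this hx
  rw [fock_psi_bv_zero]

theorem psi_mem (v : Hol n) : psi n q v ∈ leftSpan n q := by
  have : LinearMap.range (psi n q) ≤ leftSpan n q := by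
    rintro _ ⟨v, rfl⟩
    induction v using hol_induction (q := q) with
    | h0 => rw [psi_apply, phi_bv]; exact Submodule.subset_span ⟨0, rfl⟩
    | hz i v h => rw [psi_apply, phi_zOp, mul_assoc]; exact Z_mul_leftSpan i h
    | ha u v hu hv => rw [map_add]; exact add_mem hu hv
    | hs c v h => rw [map_smul]; exact Submodule.smul_mem _ _ h
  exact this ⟨v, rfl⟩

/-- Left multiplication on the ideal generated by `f_0` is the Fock representation. Identities in
the algebra can thus be turned into identities of operators, and back. -/
theorem mul_psi (x : FunAlg n q) (v : Hol n) : x * psi n q v = psi n q (fock n q x v) := by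
  rw [← psi_of_mem (mul_leftSpan x (psi_mem v)), map_mul, Module.End.mul_apply, fock_psi_bv_zero]

theorem P0_ne_zero : P0 n q ≠ 0 := by
  intro h
  have h1 := congrArg (fun x => fock n q x (bv 0) 0) h
  simp [fock_P0, f0Op_bv, bv_apply] at h1

theorem psi_bv_zero : psi n q (bv 0) = P0 n q := by
  rw [psi_apply, phi_bv, mono_zero, one_mul]

/-- The element lies in `f_0 F f_0 = ℂ f_0`, and its coefficient is the scalar product of `z^a e_0`
with `v`. This encodes the Fock form inside the algebra, where the skew Leibniz rule applies. -/
theorem flip_psi_mul_psi (a : Fin n → ℕ) (v : Hol n) :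
    flip (psi n q (bv a)) * psi n q v = (v a * hnorm q a) • P0 n q := by
  rw [psi_apply, flip_mul, flip_P0, phi_bv, mul_assoc, mul_psi, mul_psi]
  have h : fock n q (P0 n q) (fock n q (flip (mono q a)) v) = (v a * hnorm q a) • bv 0 := by
    -- `f_0` is the rank one projection onto the vacuum, so only the vacuum coefficient of the
    -- vector matters.
    have hf (u : Hol n) : f0Op n u = u 0 • bv 0 := by
      have : f0Op n = (Finsupp.lapply 0 : Hol n →ₗ[ℂ] ℂ).smulRight (bv 0) := by
        refine hol_lin_ext fun m => ?_
        rw [f0Op_bv, LinearMap.smulRight_apply, Finsupp.lapply_apply, bv_apply]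
        split_ifs <;> simp
      rw [this]; rfl
    rw [fock_P0, hf]
    congr 1
    have h1 := hform_flip (q := q) (mono q a) v (bv 0)
    rw [hform_symm, hform_bv_left, fock_mono_zero, hform_symm, hform_bv_left, hnorm_zero,
      one_mul] at h1
    rw [h1, mul_comm]
  rw [h, map_smul, psi_bv_zero]

end fockSpace
/-! ### The generators of `U_q` as operators on the Fock space -/

section implement
variable {n : ℕ} {q : QParam}

theorem actE_psi {k : Fin n} (hk : k.val + 1 < n) (v : Hol n) :
    actE q k (psi n q v) = actE q k (phi n q v) * P0 n q := by
  rw [psi_apply, actE_mul, actE_P0 hk, mul_zero, add_zero]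

theorem actF_psi {k : Fin n} (hk : k.val + 1 < n) (v : Hol n) :
    actF q k (psi n q v) = actF q k (phi n q v) * P0 n q := by
  rw [psi_apply, actF_mul, actF_P0 hk, mul_zero, add_zero, torus_P0]

/-- The operator on the Fock space that corresponds to a linear map on `F(U_n)_q`. -/
noncomputable def hat (D : FunAlg n q →ₗ[ℂ] FunAlg n q) : Module.End ℂ (Hol n) :=
  LinearMap.applyₗ (bv 0) ∘ₗ (fock n q).toLinearMap ∘ₗ D ∘ₗ psi n q

theorem hat_apply (D : FunAlg n q →ₗ[ℂ] FunAlg n q) (v : Hol n) :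
    hat D v = fock n q (D (psi n q v)) (bv 0) := rfl

/-- The operator is defined through the ideal generated by `f_0`, but if `D` commutes with right
multiplication by `f_0` and preserves polynomials, it also describes `D` on the polynomials
themselves. -/
theorem hat_of_phi {D : FunAlg n q →ₗ[ℂ] FunAlg n q} {u v : Hol n}
    (h : D (psi n q v) = D (phi n q v) * P0 n q) (hu : D (phi n q v) = phi n q u) :
    D (phi n q v) = phi n q (hat D v) := by
  rw [hat_apply, h, hu, ← psi_apply, fock_psi_bv_zero]

theorem actE_one (k : Fin n) : actE q k 1 = 0 := by
  have := actE_mul (q := q) k 1 1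
  simpa using this

theorem actF_one (k : Fin n) : actF q k 1 = 0 := by
  have := actF_mul (q := q) k 1 1
  simpa using this

/-- For `k < n` the generator acts linearly on the `z_i`, hence preserves polynomials; the vanishing
of `E_k f_0` identifies this action with the one on the Fock space. -/
theorem actE_phi {k : Fin n} (hk : k.val + 1 < n) (v : Hol n) :
    actE q k (phi n q v) = phi n q (hat (actE q k) v) := by
  have : ∃ u, actE q k (phi n q v) = phi n q u := by
    induction v using hol_induction (q := q) with
    | h0 => exact ⟨0, by rw [phi_bv, mono_zero, actE_one, map_zero]⟩
    | hz i v h =>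
      obtain ⟨u, hu⟩ := h
      rw [phi_zOp, actE_mul, hu, torus_Z, actE_Z hk, smul_mul_assoc, ← phi_zOp, ← map_smul]
      split_ifs
      · exact ⟨_, by rw [smul_mul_assoc, ← phi_zOp, ← map_smul, ← map_add]⟩
      · exact ⟨_, by rw [zero_mul, zero_add]⟩
    | ha u v hu hv =>
      obtain ⟨u', hu⟩ := hu
      obtain ⟨v', hv⟩ := hv
      exact ⟨u' + v', by simp [hu, hv]⟩
    | hs c v h =>
      obtain ⟨u, hu⟩ := h
      exact ⟨c • u, by simp [hu]⟩
  obtain ⟨u, hu⟩ := this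
  exact hat_of_phi (actE_psi hk v) hu

theorem actF_phi {k : Fin n} (hk : k.val + 1 < n) (v : Hol n) :
    actF q k (phi n q v) = phi n q (hat (actF q k) v) := by
  have : ∃ u, actF q k (phi n q v) = phi n q u := by
    induction v using hol_induction (q := q) with
    | h0 => exact ⟨0, by rw [phi_bv, mono_zero, actF_one, map_zero]⟩
    | hz i v h =>
      obtain ⟨u, hu⟩ := h
      rw [phi_zOp, actF_mul, hu, ← phi_dOp, actF_Z hk, ← phi_zOp]
      split_ifs
      · exact ⟨_, by rw [smul_mul_assoc, ← phi_zOp, ← map_smul, ← map_add]⟩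
      · exact ⟨_, by rw [zero_mul, zero_add]⟩
    | ha u v hu hv =>
      obtain ⟨u', hu⟩ := hu
      obtain ⟨v', hv⟩ := hv
      exact ⟨u' + v', by simp [hu, hv]⟩
    | hs c v h =>
      obtain ⟨u, hu⟩ := h
      exact ⟨c • u, by simp [hu]⟩
  obtain ⟨u, hu⟩ := this
  exact hat_of_phi (actF_psi hk v) hu

theorem actE_psi_eq {k : Fin n} (hk : k.val + 1 < n) (v : Hol n) :
    actE q k (psi n q v) = psi n q (hat (actE q k) v) := by
  rw [actE_psi hk, actE_phi hk, psi_apply]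

theorem actF_psi_eq {k : Fin n} (hk : k.val + 1 < n) (v : Hol n) :
    actF q k (psi n q v) = psi n q (hat (actF q k) v) := by
  rw [actF_psi hk, actF_phi hk, psi_apply]

theorem psi_dOp (w : Fin n → ℤ) (v : Hol n) : psi n q (dOp q w v) = torus q w (psi n q v) := by
  rw [psi_apply, psi_apply, phi_dOp, map_mul, torus_P0]

theorem dOp_bv_zero (w : Fin n → ℤ) : dOp q w (bv 0) = bv (0 : Fin n → ℕ) := by
  simp [dOp_bv]

theorem fock_torus_bv_zero (w : Fin n → ℤ) (x : FunAlg n q) :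
    fock n q (torus q w x) (bv 0) = dOp q w (fock n q x (bv 0)) := by
  rw [← fock_torus, dOp_bv_zero]

theorem dOp_hat_actE (w : Fin n → ℤ) (k : Fin n) (v : Hol n) :
    dOp q w (hat (actE q k) v) = qc q ^ wtE w k • hat (actE q k) (dOp q w v) := by
  rw [hat_apply, hat_apply, ← fock_torus_bv_zero, torus_actE, psi_dOp, map_smul,
    LinearMap.smul_apply]

/-- The operator on the Fock space by which `E_k` acts. -/
noncomputable def eOp (q : QParam) (k : Fin n) : Module.End ℂ (Hol n) :=
  if k.val + 1 < n then hat (actE q k) else fock n q (lastA q k)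

/-- For `k < n` this is the skew Leibniz rule for `E_k` applied to the product of `x` with an
element of the ideal generated by `f_0`. For the last `k` it is the description of `E_k` as a
twisted inner derivation. -/
theorem fock_actE (k : Fin n) (x : FunAlg n q) (v : Hol n) :
    fock n q (actE q k x) v = eOp q k (fock n q x v) - fock n q (torus q (wtK k) x) (eOp q k v) := by
  rw [eOp]
  split_ifs with hk
  · rw [hat_apply, ← mul_psi, actE_mul, actE_psi_eq hk, mul_psi, mul_psi, map_add,
      LinearMap.add_apply, fock_psi_bv_zero, fock_psi_bv_zero, add_sub_cancel_right]
  · rw [actE_last hk, map_sub, map_mul, map_mul]; rfl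

theorem dOp_eOp (w : Fin n → ℤ) (k : Fin n) (v : Hol n) :
    dOp q w (eOp q k v) = qc q ^ wtE w k • eOp q k (dOp q w v) := by
  rw [eOp]
  split_ifs with hk
  · exact dOp_hat_actE w k v
  · rw [← fock_torus, torus_lastA, map_smul, LinearMap.smul_apply, wtE, dif_neg hk]

theorem actE_flip {k : Fin n} (hk : k.val + 1 < n) (x : FunAlg n q) :
    actE q k (flip x) = (-(rc q ^ 4)⁻¹) • flip (actF q k x) := by
  have h := pow_ne_zero 4 (rc_ne q)
  rw [actF_apply, if_pos hk, flip_smul, flip_flip, smul_smul, neg_mul_neg, inv_mul_cancel₀ h,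
    one_smul]

theorem torus_flip_mono (w : Fin n → ℤ) (a : Fin n → ℕ) :
    torus q w (flip (mono q a)) = (qc q ^ (∑ i, w i * a i))⁻¹ • flip (mono q a) := by
  have h := flip_torus (q := q) (-w) (mono q a)
  rw [neg_neg] at h
  rw [← h, ← phi_bv, ← phi_dOp, dOp_bv, map_smul, flip_smul]
  simp [Finset.sum_neg_distrib, zpow_neg]

theorem psi_bv_eq (a : Fin n → ℕ) : psi n q (bv a) = mono q a * P0 n q := by
  rw [psi_apply, phi_bv]

theorem torus_flip_psi (w : Fin n → ℤ) (a : Fin n → ℕ) :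
    torus q w (flip (psi n q (bv a))) =
      (qc q ^ (∑ i, w i * a i))⁻¹ • flip (psi n q (bv a)) := by
  rw [psi_bv_eq, flip_mul, map_mul, torus_flip_mono, flip_P0, torus_P0, mul_smul_comm]

theorem flip_psi_mul_psi_bv (u : Hol n) (c : Fin n → ℕ) :
    flip (psi n q u) * psi n q (bv c) = (u c * hnorm q c) • P0 n q := by
  have h := congrArg flip (flip_psi_mul_psi (q := q) c u)
  rwa [flip_mul, flip_flip, flip_smul, flip_P0] at h

/-- The product `(z^a f_0)^* (z^c f_0)` is a multiple of `f_0`, so `E_k` annihilates it. Expanding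
by the Leibniz rule, with `E_k` on the starred factor turned into `F_k` by `flip`, gives the
adjointness of `E_k` and `F_k` in the Fock norms. -/
theorem hat_adjoint {k : Fin n} (hk : k.val + 1 < n) (a c : Fin n → ℕ) :
    hat (actE q k) (bv c) a * hnorm q a =
      qc q ^ (∑ i, wtK k i * a i) * (rc q ^ 4)⁻¹ * (hat (actF q k) (bv a) c * hnorm q c) := by
  have h : actE q k (flip (psi n q (bv a)) * psi n q (bv c)) = 0 := by
    rw [flip_psi_mul_psi, map_smul, actE_P0 hk, smul_zero]
  rw [actE_mul, actE_flip hk, actF_psi_eq hk, actE_psi_eq hk, torus_flip_psi, smul_mul_assoc,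
    smul_mul_assoc, flip_psi_mul_psi, flip_psi_mul_psi_bv, smul_smul, smul_smul, ← add_smul] at h
  have h1 := (smul_eq_zero.1 h).resolve_right P0_ne_zero
  have h2 : qc q ^ (∑ i, wtK k i * (a i : ℤ)) ≠ 0 := zpow_ne_zero _ (qc_ne q)
  field_simp at h1
  have h3 := pow_ne_zero 4 (rc_ne q)
  field_simp
  linear_combination h1

end implement
/-! ### Weighted traces -/

section traces
variable {n : ℕ} {q : QParam}

/-- Only finitely many basis vectors are not annihilated. -/
def FinCol (A : Module.End ℂ (Hol n)) : Prop :=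
  ∃ S : Set (Fin n → ℕ), S.Finite ∧ ∀ a, a ∉ S → A (bv a) = 0

theorem FinCol.mul_left (Y : Module.End ℂ (Hol n)) {X : Module.End ℂ (Hol n)} (hX : FinCol X) :
    FinCol (Y * X) := by
  obtain ⟨S, hS, h⟩ := hX
  exact ⟨S, hS, fun a ha => by rw [Module.End.mul_apply, h a ha, map_zero]⟩

theorem finCol_fock {x : FunAlg n q} (hx : x ∈ finiteFun n q) : FinCol (fock n q x) := by
  obtain ⟨S, hS, h⟩ := mat_finite hx
  refine ⟨S, hS, fun a ha => ?_⟩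
  ext m
  by_contra h0
  exact ha (h m a h0).2

/-- The trace of `A` times the diagonal matrix with entries `u`. -/
noncomputable def trW (u : (Fin n → ℕ) → ℂ) (A : Module.End ℂ (Hol n)) : ℂ :=
  ∑ᶠ m, A (bv m) m * u m

theorem FinCol.support_finite {A : Module.End ℂ (Hol n)} (hA : FinCol A)
    (u : (Fin n → ℕ) → ℂ) : (Function.support fun m => A (bv m) m * u m).Finite := by
  obtain ⟨S, hS, h⟩ := hA
  refine hS.subset fun m hm => ?_
  by_contra h0
  exact hm (by simp [h m h0])

theorem trW_add (u : (Fin n → ℕ) → ℂ) {A B : Module.End ℂ (Hol n)} (hA : FinCol A)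
    (hB : FinCol B) : trW u (A + B) = trW u A + trW u B := by
  simp only [trW, LinearMap.add_apply, Finsupp.add_apply, add_mul]
  exact finsum_add_distrib (hA.support_finite u) (hB.support_finite u)

theorem trW_smul (u : (Fin n → ℕ) → ℂ) (c : ℂ) (A : Module.End ℂ (Hol n)) :
    trW u (c • A) = c * trW u A := by
  simp only [trW, LinearMap.smul_apply, Finsupp.smul_apply, smul_eq_mul, mul_assoc]
  rw [mul_finsum]

/-- The index set need not contain the support of `v`: it only has to contain the indices where the
product is nonzero. This lets sums be cut down by the support of either factor. -/
theorem lin_apply_eq_sum (L : Hol n →ₗ[ℂ] ℂ) (v : Hol n) {S : Finset (Fin n → ℕ)}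
    (hS : ∀ l, v l * L (bv l) ≠ 0 → l ∈ S) : L v = ∑ l ∈ S, v l * L (bv l) := by
  classical
  have h : L v = v.sum fun l c => c * L (bv l) := by
    conv_lhs => rw [← Finsupp.sum_single v]
    simp only [Finsupp.sum, map_sum]
    refine Finset.sum_congr rfl fun l _ => ?_
    rw [single_eq, map_smul, smul_eq_mul]
  rw [h, Finsupp.sum]
  refine (Finset.sum_subset Finset.subset_union_left (s₂ := v.support ∪ S) ?_).trans
    (Finset.sum_subset (Finset.subset_union_right (s₁ := v.support) (s₂ := S)) ?_).symm
  · intro l _ hl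
    rw [Finsupp.notMem_support_iff.1 hl, zero_mul]
  · intro l _ hl
    by_contra h0
    exact hl (hS l h0)

theorem end_apply_eq_sum (A : Module.End ℂ (Hol n)) (v : Hol n) (m : Fin n → ℕ)
    {S : Finset (Fin n → ℕ)} (hS : ∀ l, v l * A (bv l) m ≠ 0 → l ∈ S) :
    A v m = ∑ l ∈ S, v l * A (bv l) m :=
  lin_apply_eq_sum (Finsupp.lapply m ∘ₗ A) v hS

theorem FinCol.exists_finset {X : Module.End ℂ (Hol n)} (hX : FinCol X) :
    ∃ S : Finset (Fin n → ℕ), ∀ m l, X (bv l) m ≠ 0 → m ∈ S ∧ l ∈ S := by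
  classical
  obtain ⟨S, hS, h⟩ := hX
  refine ⟨hS.toFinset ∪ hS.toFinset.biUnion fun l => (X (bv l)).support, fun m l hml => ?_⟩
  have hl : l ∈ S := by
    by_contra h0
    exact hml (by simp [h l h0])
  refine ⟨?_, by simp [hl]⟩
  simp only [Finset.mem_union, Finset.mem_biUnion, Set.Finite.mem_toFinset, Finsupp.mem_support_iff]
  exact .inr ⟨l, hl, hml⟩

theorem trW_mul_eq_sum (u : (Fin n → ℕ) → ℂ) {X : Module.End ℂ (Hol n)}
    (Y : Module.End ℂ (Hol n)) {S : Finset (Fin n → ℕ)}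
    (hS : ∀ m l, X (bv l) m ≠ 0 → m ∈ S ∧ l ∈ S) :
    trW u (Y * X) = ∑ m ∈ S, ∑ l ∈ S, X (bv m) l * Y (bv l) m * u m := by
  have h1 (m) : (Y * X) (bv m) m = ∑ l ∈ S, X (bv m) l * Y (bv l) m :=
    end_apply_eq_sum _ _ _ fun l hl => (hS l m (left_ne_zero_of_mul hl)).1
  rw [trW, finsum_eq_sum_of_support_subset (s := S)]
  · simp only [h1, Finset.sum_mul]
  · intro m hm
    rw [Function.mem_support, h1] at hm
    obtain ⟨l, -, hl⟩ := Finset.exists_ne_zero_of_sum_ne_zero (left_ne_zero_of_mul hm)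
    exact (hS l m (left_ne_zero_of_mul hl)).2

theorem trW_mul_eq_sum' (u : (Fin n → ℕ) → ℂ) {X : Module.End ℂ (Hol n)}
    (Y : Module.End ℂ (Hol n)) {S : Finset (Fin n → ℕ)}
    (hS : ∀ m l, X (bv l) m ≠ 0 → m ∈ S ∧ l ∈ S) :
    trW u (X * Y) = ∑ l ∈ S, ∑ m ∈ S, Y (bv l) m * X (bv m) l * u l := by
  have h1 (m) : (X * Y) (bv m) m = ∑ l ∈ S, Y (bv m) l * X (bv l) m :=
    end_apply_eq_sum _ _ _ fun l hl => (hS m l (right_ne_zero_of_mul hl)).2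
  rw [trW, finsum_eq_sum_of_support_subset (s := S)]
  · simp only [h1, Finset.sum_mul]
  · intro m hm
    rw [Function.mem_support, h1] at hm
    obtain ⟨l, -, hl⟩ := Finset.exists_ne_zero_of_sum_ne_zero (left_ne_zero_of_mul hm)
    exact (hS m l (right_ne_zero_of_mul hl)).1

/-- Both traces are the same finite double sum, except that the weight is taken at the two different
ends of an entry of `Y`; for nonzero entries these weights differ by the factor `c`. Finiteness is
needed for `X` only. -/
theorem trW_mul_comm {u : (Fin n → ℕ) → ℂ} {X Y : Module.End ℂ (Hol n)} (hX : FinCol X) {c : ℂ}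
    (hY : ∀ m l, Y (bv l) m ≠ 0 → u m = c * u l) : trW u (Y * X) = c * trW u (X * Y) := by
  obtain ⟨S, hS⟩ := hX.exists_finset
  rw [trW_mul_eq_sum u Y hS, trW_mul_eq_sum' u Y hS, Finset.sum_comm, Finset.mul_sum]
  refine Finset.sum_congr rfl fun l _ => ?_
  rw [Finset.mul_sum]
  refine Finset.sum_congr rfl fun m _ => ?_
  by_cases h : Y (bv l) m = 0
  · simp [h]
  · rw [hY m l h]; ring

/-- Conjugation by an invertible diagonal operator leaves the diagonal entries unchanged. -/
theorem trW_conj (u : (Fin n → ℕ) → ℂ) {w : Fin n → ℤ} {X X' : Module.End ℂ (Hol n)}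
    (h : ∀ v, X' (dOp q w v) = dOp q w (X v)) : trW u X' = trW u X := by
  rw [trW, trW]
  refine finsum_congr fun m => ?_
  have h1 := congrArg (fun v : Hol n => v m) (h (bv m))
  simp only [dOp_bv, map_smul, Finsupp.smul_apply, dOp_apply, smul_eq_mul] at h1
  rw [mul_left_cancel₀ (zpow_ne_zero _ (qc_ne q)) h1]

/-- A nonzero entry of an operator of pure weight connects two basis vectors whose eigenvalues
differ by exactly that weight. -/
theorem dOp_homogeneous {w : Fin n → ℤ} {c : ℂ} {Y : Module.End ℂ (Hol n)}
    (h : ∀ v, dOp q w (Y v) = c • Y (dOp q w v)) {m l : Fin n → ℕ} (hml : Y (bv l) m ≠ 0) :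
    qc q ^ (∑ i, w i * m i) = c * qc q ^ (∑ i, w i * l i) := by
  have h1 := congrArg (fun v : Hol n => v m) (h (bv l))
  simp only [dOp_bv, map_smul, Finsupp.smul_apply, dOp_apply, smul_eq_mul, ← mul_assoc] at h1
  exact mul_right_cancel₀ hml h1

theorem FinCol.conj {w : Fin n → ℤ} {X X' : Module.End ℂ (Hol n)}
    (h : ∀ v, X' (dOp q w v) = dOp q w (X v)) (hX : FinCol X) : FinCol X' := by
  obtain ⟨S, hS, h0⟩ := hX
  refine ⟨S, hS, fun a ha => ?_⟩
  have h1 := h (bv a)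
  rw [h0 a ha, map_zero, dOp_bv, map_smul] at h1
  exact (smul_eq_zero.1 h1).resolve_left (zpow_ne_zero _ (qc_ne q))

/-- Conjugating `Y X` by `dOp` turns it into `c Y X'` without changing the trace, and commuting `Y`
past `X'` costs `c⁻¹` because of the weight `u`. The two factors cancel, so the trace vanishes on
the twisted commutator `Y X - X' Y`. -/
theorem trW_skew {u : (Fin n → ℕ) → ℂ} {w : Fin n → ℤ} {X X' Y : Module.End ℂ (Hol n)} {c : ℂ}
    (hc : c ≠ 0) (hX : FinCol X) (h : ∀ v, X' (dOp q w v) = dOp q w (X v))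
    (hY : ∀ v, dOp q w (Y v) = c • Y (dOp q w v))
    (hu : ∀ m l, Y (bv l) m ≠ 0 → u m = c⁻¹ * u l) : trW u (Y * X) = trW u (X' * Y) := by
  have h1 := trW_mul_comm (hX.conj h) hu
  have h2 : trW u (c • (Y * X')) = trW u (Y * X) := by
    refine trW_conj u (q := q) (w := w) fun v => ?_
    rw [LinearMap.smul_apply, Module.End.mul_apply, Module.End.mul_apply, h, hY]
  rw [← h2, trW_smul, h1, mul_inv_cancel_left₀ hc]

/-- The weight of the invariant integral. -/
def invW (n : ℕ) (i : Fin n) : ℤ := -2 * n + 2 * i.val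

theorem invWeight_eq (m : Fin n → ℕ) : invWeight q m = qc q ^ (∑ i, invW n i * m i) := by
  rw [invWeight]
  congr 1
  simp only [invW, add_mul, Finset.sum_add_distrib, Finset.mul_sum, mul_assoc]

/-- The weight of the invariant integral is that of `K_{-2ρ}`, so it pairs to `-2` with every simple
root. It therefore compensates the value `2` of `K_k` on `E_k`, uniformly in `k`. -/
theorem wtE_invW (k : Fin n) : wtE (invW n) k = -2 := by
  simp only [wtE, invW]
  split_ifs <;> push_cast <;> omega

theorem wtE_wtK_self (k : Fin n) : wtE (wtK k) k = 2 := by rw [wtE_wtK, A_self]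

theorem zpow_two_inv : qc q ^ (-2 : ℤ) = (qc q ^ (2 : ℤ))⁻¹ := zpow_neg _ _

/-- An operator with the commutation relations of `E_k` with the torus. -/
def IsEOp (q : QParam) (k : Fin n) (Y : Module.End ℂ (Hol n)) : Prop :=
  ∀ w v, dOp q w (Y v) = qc q ^ wtE w k • Y (dOp q w v)

theorem isEOp_eOp (k : Fin n) : IsEOp q k (eOp q k) := fun w v => dOp_eOp w k v

/-- This is the source of all invariance under `E_k`: it holds for every operator with the weights
of `E_k`, whichever quantization it comes from. -/
theorem invTrace_skew {k : Fin n} {X X' Y : Module.End ℂ (Hol n)} (hY : IsEOp q k Y)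
    (hX : FinCol X) (h : ∀ v, X' (dOp q (wtK k) v) = dOp q (wtK k) (X v)) :
    trW (invWeight q) (Y * X) = trW (invWeight q) (X' * Y) := by
  refine trW_skew (zpow_ne_zero 2 (qc_ne q)) hX h (fun v => ?_) fun m l hml => ?_
  · rw [hY, wtE_wtK_self]
  · rw [invWeight_eq, invWeight_eq, dOp_homogeneous (hY (invW n)) hml, wtE_invW, zpow_two_inv]

theorem tPar_pos (q : QParam) (α : ℝ) : 0 < (q : ℝ) ^ (2 * α) := Real.rpow_pos_of_pos q.2.1 _

/-- Isolating the power of `t` leaves an integral torus weight that pairs to `-2` with the roots `k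
< n`. The factor in `t` depends only on the total degree. -/
theorem wWeight_eq (α : ℝ) (m : Fin n → ℕ) :
    wWeight q α m = (tPar q α) ^ (∑ i, m i) * qc q ^ (∑ i, (2 + 2 * (i.val : ℤ)) * m i) := by
  have h1 : (q : ℝ) ^ (2 * (α + 1) * ∑ i, (m i : ℝ)) =
      ((q : ℝ) ^ (2 * α)) ^ (∑ i, m i) * (q : ℝ) ^ (2 * ∑ i, m i) := by
    rw [← Real.rpow_natCast, ← Real.rpow_mul q.2.1.le, ← Real.rpow_natCast (q : ℝ),
      ← Real.rpow_add q.2.1]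
    congr 1; push_cast; ring
  have h2 : (∑ i : Fin n, (2 + 2 * (i.val : ℤ)) * m i) =
      ((2 * ∑ i, m i + 2 * ∑ i : Fin n, i.val * m i : ℕ) : ℤ) := by
    push_cast
    simp only [add_mul, Finset.sum_add_distrib, Finset.mul_sum, mul_assoc]
  rw [wWeight, h1, h2, zpow_natCast, pow_add, tPar]
  push_cast
  rw [qc]; ring

theorem wInt_eq_trW (α : ℝ) {x : FunAlg n q} (hx : x ∈ finiteFun n q) :
    wInt α x = qPoch q (tPar q α * qc q ^ 2) n * trW (wWeight q α) (fock n q x) := by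
  rw [wInt, tsum_eq_finsum]
  · rfl
  · exact (finCol_fock hx).support_finite _

theorem wInt_add (α : ℝ) {x y : FunAlg n q} (hx : x ∈ finiteFun n q) (hy : y ∈ finiteFun n q) :
    wInt α (x + y) = wInt α x + wInt α y := by
  rw [wInt_eq_trW α hx, wInt_eq_trW α hy, wInt_eq_trW α (add_mem hx hy), map_add,
    trW_add _ (finCol_fock hx) (finCol_fock hy), mul_add]

theorem wInt_smul (α : ℝ) (c : ℂ) (x : FunAlg n q) : wInt α (c • x) = c * wInt α x := by
  simp only [wInt, mat_smul, Pi.smul_apply, smul_eq_mul, mul_assoc]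
  rw [tsum_mul_left]; ring

theorem wInt_sub (α : ℝ) {x y : FunAlg n q} (hx : x ∈ finiteFun n q) (hy : y ∈ finiteFun n q) :
    wInt α (x - y) = wInt α x - wInt α y := by
  have h : x - y = x + (-1 : ℂ) • y := by rw [neg_one_smul, sub_eq_add_neg]
  rw [h, wInt_add α hx (Submodule.smul_mem _ _ hy), wInt_smul]
  ring

theorem wInt_torus (α : ℝ) (w : Fin n → ℤ) (x : FunAlg n q) :
    wInt α (torus q w x) = wInt α x := by
  have h (m) : mat (torus q w x) m m = mat x m m := by
    have h1 := congrArg (fun v : Hol n => v m) (fock_torus w x (bv m))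
    simp only [dOp_bv, map_smul, Finsupp.smul_apply, dOp_apply, smul_eq_mul] at h1
    exact mul_left_cancel₀ (zpow_ne_zero _ (qc_ne q)) h1
  simp only [wInt, h]

theorem wInt_flip (α : ℝ) (x : FunAlg n q) : wInt α (flip x) = wInt α x := by
  simp only [wInt, mat_flip_diag]

/-- The grading by total degree is the torus weight `(1, …, 1)`, on which the roots `k < n` vanish;
since `0 < q < 1`, the degree is recovered from the eigenvalue. -/
theorem IsEOp.sum_eq {k : Fin n} {Y : Module.End ℂ (Hol n)} (hY : IsEOp q k Y)
    (hk : k.val + 1 < n) {m l : Fin n → ℕ} (hml : Y (bv l) m ≠ 0) : ∑ i, m i = ∑ i, l i := by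
  have h := dOp_homogeneous (hY 1) hml
  have h1 : wtE (1 : Fin n → ℤ) k = 0 := by simp [wtE, hk]
  simp only [h1, Pi.one_apply, one_mul, zpow_zero, ← Nat.cast_sum, zpow_natCast] at h
  rw [qc] at h
  norm_cast at h
  exact pow_right_injective₀ q.2.1 q.2.2.ne h

/-- For `k < n` the operator of `E_k` preserves the total degree, so the power of `t` in the weight
is inert and the remaining weight cancels the twist, as for the invariant integral. -/
theorem wInt_actE (α : ℝ) {k : Fin n} (hk : k.val + 1 < n) {x : FunAlg n q}
    (hx : x ∈ finiteFun n q) : wInt α (actE q k x) = 0 := by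
  have h1 : fock n q (actE q k x) = eOp q k * fock n q x + (-1 : ℂ) •
      (fock n q (torus q (wtK k) x) * eOp q k) := by
    ext1 v
    ext1
    simp [fock_actE, sub_eq_add_neg]
  have hY := isEOp_eOp (q := q) k
  have h2 : trW (wWeight q α) (eOp q k * fock n q x) =
      trW (wWeight q α) (fock n q (torus q (wtK k) x) * eOp q k) := by
    refine trW_skew (zpow_ne_zero 2 (qc_ne q)) (finCol_fock hx) (fock_torus (wtK k) x)
      (fun v => ?_) fun m l hml => ?_
    · rw [hY, wtE_wtK_self]
    · rw [wWeight_eq, wWeight_eq, hY.sum_eq hk hml, ← zpow_two_inv,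
        dOp_homogeneous (hY fun i => 2 + 2 * (i.val : ℤ)) hml]
      have : wtE (fun i : Fin n => 2 + 2 * (i.val : ℤ)) k = -2 := by
        simp only [wtE, hk, dif_pos]; push_cast; ring
      rw [this]; ring
  have h3 := (finCol_fock hx).mul_left (eOp q k)
  -- Finiteness of columns survives left but not right multiplication, so for `X' Y` it is deduced
  -- from the two other terms of the identity.
  have h4 : FinCol ((-1 : ℂ) • (fock n q (torus q (wtK k) x) * eOp q k)) := by
    have h5 : (-1 : ℂ) • (fock n q (torus q (wtK k) x) * eOp q k) =
        fock n q (actE q k x) + (-1 : ℂ) • (eOp q k * fock n q x) := by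
      rw [h1]; module
    obtain ⟨S, hS, h⟩ := finCol_fock (actE_mem k hx)
    obtain ⟨S', hS', h'⟩ := h3
    rw [h5]
    refine ⟨S ∪ S', hS.union hS', fun a ha => ?_⟩
    rw [Set.mem_union, not_or] at ha
    rw [LinearMap.add_apply, LinearMap.smul_apply, h a ha.1, h' a ha.2]
    simp
  rw [wInt_eq_trW α (actE_mem k hx), h1, trW_add _ h3 h4, trW_smul, h2]
  ring

/-- Twisted cyclicity: multiplication by `z_n` raises `m_n` by one, which multiplies the weight by
`t q^{2n}`. -/
theorem wInt_Z_mul (α : ℝ) {k : Fin n} (hk : ¬ k.val + 1 < n) {x : FunAlg n q}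
    (hx : x ∈ finiteFun n q) :
    wInt α (Z q k * x) = tPar q α * qc q ^ (2 * n) * wInt α (x * Z q k) := by
  rw [wInt_eq_trW α (finiteFun_mul_left _ hx), wInt_eq_trW α (finiteFun_mul_right hx _), map_mul,
    map_mul, fock_Z, trW_mul_comm (finCol_fock hx) (c := tPar q α * qc q ^ (2 * n))]
  · ring
  · intro m l hml
    rw [zOp_bv, Finsupp.smul_apply, bv_apply] at hml
    have h : l + Pi.single k 1 = m := by
      by_contra h; simp [h] at hml
    subst h
    rw [wWeight_eq, wWeight_eq, sum_mul_add_single, zpow_add₀ (qc_ne q)]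
    have h1 : 2 + 2 * (k.val : ℤ) = ((2 * n : ℕ) : ℤ) := by
      have := k.2; push_cast; omega
    rw [h1, zpow_natCast]
    simp [Finset.sum_add_distrib, pow_succ]
    ring

end traces
/-! ### The norms of the monomials -/

theorem hasSum_mul_of_norm {R ι κ : Type*} [NormedCommRing R] [CompleteSpace R] {f : ι → R}
    {g : κ → R} {s t : R} (hf : HasSum f s) (hg : HasSum g t) (hf' : Summable fun k => ‖f k‖)
    (hg' : Summable fun k => ‖g k‖) :
    HasSum (fun x : ι × κ => f x.1 * g x.2) (s * t) ∧
      Summable fun x : ι × κ => ‖f x.1 * g x.2‖ :=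
  ⟨hf.mul hg (summable_mul_of_summable_norm hf' hg'), hf'.mul_norm hg'⟩

/-- Absolute summability is carried along in the induction, because multiplying the next series by
the product already formed requires it for both. -/
theorem hasSum_pi_prod_of_norm {R : Type*} [NormedCommRing R] [CompleteSpace R] {n : ℕ}
    {f : Fin n → ℕ → R} {s : Fin n → R} (h : ∀ i, HasSum (f i) (s i))
    (h' : ∀ i, Summable fun k => ‖f i k‖) :
    HasSum (fun k : Fin n → ℕ => ∏ i, f i (k i)) (∏ i, s i) ∧
      Summable fun k : Fin n → ℕ => ‖∏ i, f i (k i)‖ := by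
  induction n with
  | zero => exact ⟨by simp, Summable.of_finite⟩
  | succ n ih =>
    obtain ⟨h1, h2⟩ := ih (fun i => h i.succ) fun i => h' i.succ
    rw [← (Fin.consEquiv fun _ : Fin (n + 1) => ℕ).hasSum_iff,
      ← (Fin.consEquiv fun _ : Fin (n + 1) => ℕ).summable_iff]
    obtain ⟨h3, h4⟩ := hasSum_mul_of_norm (h 0) h1 (h' 0) h2
    constructor
    · simpa [Fin.prod_univ_succ, Function.comp_def, Fin.consEquiv] using h3
    · simpa [Fin.prod_univ_succ, Function.comp_def, Fin.consEquiv] using h4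

theorem hasSum_pi_prod {n : ℕ} {f : Fin n → ℕ → ℂ} {s : Fin n → ℂ} (h : ∀ i, HasSum (f i) (s i)) :
    HasSum (fun k : Fin n → ℕ => ∏ i, f i (k i)) (∏ i, s i) :=
  (hasSum_pi_prod_of_norm h fun i => (h i).summable.norm).1

section norms
variable {n : ℕ} {q : QParam}

theorem norm_qc_pow (q : QParam) (k : ℕ) : ‖qc q ^ k‖ = (q : ℝ) ^ k := by
  rw [norm_pow, qc, Complex.norm_real, Real.norm_of_nonneg q.2.1.le]

theorem norm_mul_qc_pow_lt {x : ℂ} (hx : ‖x‖ < 1) (k : ℕ) : ‖x * qc q ^ k‖ < 1 := by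
  rw [norm_mul, norm_qc_pow]
  calc ‖x‖ * (q : ℝ) ^ k ≤ ‖x‖ * 1 := by
        gcongr
        exact pow_le_one₀ q.2.1.le q.2.2.le
    _ < 1 := by rwa [mul_one]

theorem one_sub_ne_of_norm_lt {x : ℂ} (hx : ‖x‖ < 1) : 1 - x ≠ 0 := by
  intro h
  rw [← sub_eq_zero.1 h] at hx
  simp at hx

theorem qPoch_ne_of_norm_lt {x : ℂ} (hx : ‖x‖ < 1) (N : ℕ) : qPoch q x N ≠ 0 :=
  Finset.prod_ne_zero_iff.2 fun _ _ => one_sub_ne_of_norm_lt (norm_mul_qc_pow_lt hx _)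

theorem qPoch_add (q : QParam) (x : ℂ) (M N : ℕ) :
    qPoch q x (M + N) = qPoch q x M * qPoch q (x * qc q ^ (2 * M)) N := by
  simp only [qPoch, Finset.prod_range_add]
  congr 1
  refine Finset.prod_congr rfl fun k _ => ?_
  ring

theorem qPoch_succ_left (q : QParam) (x : ℂ) (N : ℕ) :
    qPoch q x (N + 1) = (1 - x) * qPoch q (x * qc q ^ 2) N := by
  rw [add_comm, qPoch_add]
  simp [qPoch]

theorem qPoch_succ (q : QParam) (x : ℂ) (N : ℕ) :
    qPoch q x (N + 1) = qPoch q x N * (1 - x * qc q ^ (2 * N)) := by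
  rw [qPoch, Finset.prod_range_succ]; rfl

/-- A case of the `q`-binomial theorem. -/
theorem hasSum_qBinomial (q : QParam) (a : ℕ) {x : ℂ} (hx : ‖x‖ < 1) :
    HasSum (fun k : ℕ => x ^ k * qPoch q (qc q ^ (2 * k + 2)) a)
      (qPoch q (qc q ^ 2) a / qPoch q x (a + 1)) := by
  induction a generalizing x with
  | zero => simpa [qPoch] using hasSum_geometric_of_norm_lt_one hx
  | succ a ih =>
    -- Splitting off the last factor `1 - q^{2k+2+2a}` expresses the series for `a + 1` at `x`
    -- through the series for `a` at `x` and at `x q²`.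
    have hx' := norm_mul_qc_pow_lt (q := q) hx 2
    have h := (ih hx).sub ((ih hx').mul_left (qc q ^ (2 * a + 2)))
    have e : qPoch q (qc q ^ 2) (a + 1) / qPoch q x (a + 1 + 1) =
        qPoch q (qc q ^ 2) a / qPoch q x (a + 1) -
          qc q ^ (2 * a + 2) * (qPoch q (qc q ^ 2) a / qPoch q (x * qc q ^ 2) (a + 1)) := by
      rw [qPoch_succ q (qc q ^ 2), qPoch_succ_left q x (a + 1), qPoch_succ_left q x a,
        qPoch_succ q (x * qc q ^ 2) a]
      have h1 := one_sub_ne_of_norm_lt hx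
      have h2 := qPoch_ne_of_norm_lt (q := q) hx' a
      have h3 := one_sub_ne_of_norm_lt (norm_mul_qc_pow_lt (q := q) hx' (2 * a))
      rw [pow_add]
      generalize qc q ^ (2 * a) = Q at *
      generalize qPoch q (x * qc q ^ 2) a = y at *
      obtain ⟨d, hd⟩ : ∃ d, d = 1 - x * qc q ^ 2 * Q := ⟨_, rfl⟩
      rw [← hd] at h3 ⊢
      field_simp
      rw [hd]
      ring
    rw [e]
    refine h.congr_fun fun k => ?_
    rw [qPoch_succ]
    ring

/-- The intervals of length `b_j` starting at `∑_{i<j} b_i` are consecutive and fill the range up to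
`∑ b_i`. -/
theorem prod_prod_range (b : Fin n → ℕ) (f : ℕ → ℂ) :
    ∏ j, ∏ k ∈ Finset.range (b j), f ((∑ i, if i < j then b i else 0) + k) =
      ∏ k ∈ Finset.range (∑ i, b i), f k := by
  induction n with
  | zero => simp
  | succ n ih =>
    rw [Fin.prod_univ_castSucc, Fin.sum_univ_castSucc b, Finset.prod_range_add]
    have h := ih fun i => b i.castSucc
    have h1 (j : Fin n) : (∑ i, if i < j.castSucc then b i else 0) =
        ∑ i, if i < j then b i.castSucc else 0 := by
      rw [Fin.sum_univ_castSucc, if_neg (not_lt.2 (Fin.le_last _)), add_zero]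
      simp
    have h2 : (∑ i, if i < Fin.last n then b i else 0) = ∑ i : Fin n, b i.castSucc := by
      rw [Fin.sum_univ_castSucc]
      simp [Fin.castSucc_lt_last]
    simp only [h1, h2, h]

theorem prod_qPoch (x : ℂ) (b : Fin n → ℕ) :
    ∏ j, qPoch q (x * qc q ^ (2 * ∑ i, if i < j then b i else 0)) (b j) =
      qPoch q x (∑ i, b i) := by
  have h := prod_prod_range b fun k => 1 - x * qc q ^ (2 * k)
  rw [qPoch, ← h]
  refine Finset.prod_congr rfl fun j _ => ?_
  rw [qPoch]
  refine Finset.prod_congr rfl fun k _ => ?_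
  ring

theorem sum_mul_tail (a k : Fin n → ℕ) :
    ∑ i, a i * tail i k = ∑ j, (∑ i, if i < j then a i else 0) * k j := by
  have h (i : Fin n) : tail i k = ∑ j, if i < j then k j else 0 := by
    rw [tail, ← Finset.sum_filter]
    congr 1
    ext j; simp
  simp only [h, Finset.mul_sum, Finset.sum_mul]
  rw [Finset.sum_comm]
  refine Finset.sum_congr rfl fun j _ => Finset.sum_congr rfl fun i _ => ?_
  split_ifs <;> simp

/-- The diagonal entry is the squared Fock norm of `z^a z^k e_0` divided by that of `z^k e_0`. It
factorizes over the coordinates of `k`, apart from a power of `q` linear in `k`. -/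
theorem mat_antimono_mul_mono (a k : Fin n → ℕ) : mat (antimono q a * mono q a) k k =
    (qc q ^ ∑ i, a i * tail i k) ^ 2 * ∏ j, qPoch q (qc q ^ (2 * k j + 2)) (a j) := by
  have h := hform_flip (mono q a) (fock n q (mono q a) (bv k)) (bv k)
  rw [flip_mono, hform_symm, hform_bv_left, fock_mono_eq, map_smul, map_smul, map_smul,
    LinearMap.smul_apply, hform_bv_left, Finsupp.smul_apply, bv_apply, if_pos rfl] at h
  have hh : hnorm q (k + a) = hnorm q k * ∏ j, qPoch q (qc q ^ (2 * k j + 2)) (a j) := by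
    simp only [hnorm, Pi.add_apply, qPoch_add, Finset.prod_mul_distrib]
    congr 1
    refine Finset.prod_congr rfl fun j _ => ?_
    rw [← pow_add, add_comm]
  rw [mat, map_mul, Module.End.mul_apply, fock_mono_eq, map_smul, Finsupp.smul_apply]
  apply mul_left_cancel₀ (hnorm_ne (q := q) k)
  simp only [smul_eq_mul, mul_one] at h ⊢
  rw [h, hh]
  ring

theorem norm_tPar_lt (q : QParam) {α : ℝ} (hα : 0 < α) : ‖tPar q α‖ < 1 := by
  rw [tPar, Complex.norm_real, Real.norm_of_nonneg (tPar_pos q α).le]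
  exact Real.rpow_lt_one q.2.1.le q.2.2 (by positivity)

theorem qPoch_tPar_ne (q : QParam) {α : ℝ} (hα : 0 < α) (k N : ℕ) :
    qPoch q (tPar q α * qc q ^ k) N ≠ 0 :=
  qPoch_ne_of_norm_lt (norm_mul_qc_pow_lt (norm_tPar_lt q hα) _) _

/-- The squared norm of the monomial `z^a` in the weighted Bergman space. -/
theorem wInner_mono (q : QParam) {α : ℝ} (hα : 0 < α) (a : Fin n → ℕ) :
    wInner α (mono q a) a = hnorm q a / qPoch q (tPar q α * qc q ^ (2 * n + 2)) (∑ i, a i) := by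
  obtain ⟨t, ht⟩ : ∃ t, t = tPar q α := ⟨_, rfl⟩
  -- The integral factorizes into one series per coordinate, with ratio `x j`. Each `i < j`
  -- contributes `a i` through `tail` and one more through the weight `q^{2j}`, whence `a i + 1`.
  obtain ⟨x, hx⟩ : ∃ x : Fin n → ℂ,
      x = fun j => t * qc q ^ 2 * qc q ^ (2 * ∑ i, if i < j then a i + 1 else 0) := ⟨_, rfl⟩
  have hxj (j : Fin n) : ‖x j‖ < 1 := by
    rw [hx, ht]
    exact norm_mul_qc_pow_lt (norm_mul_qc_pow_lt (norm_tPar_lt q hα) _) _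
  have h := hasSum_pi_prod fun j => hasSum_qBinomial q (a j) (hxj j)
  have h1 (k : Fin n → ℕ) : mat (antimono q a * mono q a) k k * wWeight q α k =
      ∏ j, x j ^ k j * qPoch q (qc q ^ (2 * k j + 2)) (a j) := by
    rw [mat_antimono_mul_mono, Finset.prod_mul_distrib, wWeight_eq, ← ht]
    have h2 : ∏ j, x j ^ k j = t ^ (∑ i, k i) * qc q ^ (∑ i : Fin n, (2 + 2 * i.val) * k i) *
        (qc q ^ ∑ i, a i * tail i k) ^ 2 := by
      rw [sum_mul_tail, ← pow_mul, ← Finset.prod_pow_eq_pow_sum, Finset.sum_mul,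
        ← Finset.prod_pow_eq_pow_sum, ← Finset.prod_pow_eq_pow_sum, ← Finset.prod_mul_distrib,
        ← Finset.prod_mul_distrib]
      refine Finset.prod_congr rfl fun j _ => ?_
      have h3 : (∑ i, if i < j then a i + 1 else 0) = (∑ i, if i < j then a i else 0) + j.val := by
        have h4 : (∑ i : Fin n, if i < j then 1 else 0) = j.val := by
          have h5 : Finset.univ.filter (· < j) = Finset.Iio j := by ext; simp
          rw [← Finset.sum_filter, Finset.sum_const, smul_eq_mul, mul_one, h5, Fin.card_Iio]
        rw [← h4, ← Finset.sum_add_distrib]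
        refine Finset.sum_congr rfl fun i _ => ?_
        split_ifs <;> simp
      simp only [hx, h3]
      ring
    have h4 : (∑ i : Fin n, (2 + 2 * (i.val : ℤ)) * k i) =
        ((∑ i : Fin n, (2 + 2 * i.val) * k i : ℕ) : ℤ) := by push_cast; rfl
    rw [h2, h4, zpow_natCast]
    ring
  rw [wInner, wInt, tsum_congr h1, h.tsum_eq, Finset.prod_div_distrib, ← ht]
  -- The denominators `(x_j;q²)_{a_j+1}` are consecutive blocks of a single shifted factorial of
  -- length `n + |a|`. Its first `n` factors cancel the normalization of the integral.
  have h5 : ∏ j, qPoch q (x j) (a j + 1) = qPoch q (t * qc q ^ 2) (n + ∑ i, a i) := by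
    rw [hx]
    have := prod_qPoch (q := q) (t * qc q ^ 2) fun j => a j + 1
    rw [Finset.sum_add_distrib, add_comm] at this
    simpa using this
  rw [h5, qPoch_add, show t * qc q ^ 2 * qc q ^ (2 * n) = t * qc q ^ (2 * n + 2) by ring, ← hnorm]
  have h6 := qPoch_tPar_ne q hα 2 n
  have h7 := qPoch_tPar_ne q hα (2 * n + 2) (∑ i, a i)
  rw [← ht] at h6 h7
  field_simp

theorem wInner_mono_self_ne (q : QParam) {α : ℝ} (hα : 0 < α) (a : Fin n → ℕ) :
    wInner α (mono q a) a ≠ 0 := by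
  rw [wInner_mono q hα]
  exact div_ne_zero (hnorm_ne a) (qPoch_tPar_ne q hα _ _)

/-- In a fixed degree the Bergman norms are proportional to the Fock norms. Adjointness of
degree-preserving operators therefore carries over from one space to the other. -/
theorem wInner_mono_ratio (q : QParam) {α : ℝ} (hα : 0 < α) {a c : Fin n → ℕ}
    (h : ∑ i, a i = ∑ i, c i) :
    wInner α (mono q a) a * hnorm q c = wInner α (mono q c) c * hnorm q a := by
  rw [wInner_mono q hα, wInner_mono q hα, h]
  ring

theorem wInner_mono_add (q : QParam) {α : ℝ} (hα : 0 < α) (i : Fin n) (a : Fin n → ℕ) :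
    wInner α (mono q (a + Pi.single i 1)) (a + Pi.single i 1) *
        (1 - tPar q α * qc q ^ (2 * n + 2) * qc q ^ (2 * ∑ i, a i)) =
      (1 - qc q ^ (2 * a i + 2)) * wInner α (mono q a) a := by
  rw [wInner_mono q hα, wInner_mono q hα, hnorm_add]
  have h : ∑ j, (a + Pi.single i 1 : Fin n → ℕ) j = (∑ j, a j) + 1 := by
    simp [Finset.sum_add_distrib]
  have h1 := qPoch_tPar_ne q hα (2 * n + 2) (∑ i, a i + 1)
  rw [h]
  rw [qPoch_succ] at h1 ⊢
  have h2 := left_ne_zero_of_mul h1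
  have h3 := right_ne_zero_of_mul h1
  field_simp

end norms
/-! ### Equivariance of the Toeplitz quantization -/

section toeplitz
variable {n : ℕ} {q : QParam}

/-- The torus action on finite functions. -/
noncomputable def torusFin (w : Fin n → ℤ) : finiteFun n q →ₗ[ℂ] finiteFun n q :=
  (torus q w).toLinearMap.restrict fun _ hx => torus_mem w hx

/-- The action of `E_k` on finite functions. -/
noncomputable def eFin (k : Fin n) : finiteFun n q →ₗ[ℂ] finiteFun n q :=
  (actE q k).restrict fun _ hx => actE_mem k hx

/-- The action of `F_k` on finite functions. -/
noncomputable def fFin (k : Fin n) : finiteFun n q →ₗ[ℂ] finiteFun n q :=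
  (actF q k).restrict fun _ hx => actF_mem k hx

theorem coe_torusFin (w : Fin n → ℤ) (f : finiteFun n q) :
    (torusFin w f : FunAlg n q) = torus q w f := rfl

theorem coe_eFin (k : Fin n) (f : finiteFun n q) : (eFin k f : FunAlg n q) = actE q k f := rfl

theorem flip_mem {x : FunAlg n q} (hx : x ∈ finiteFun n q) : flip x ∈ finiteFun n q := by
  induction hx using Submodule.span_induction with
  | mem x h =>
    obtain ⟨a, b, rfl⟩ := h
    rw [flip_mul, flip_mul, flip_P0, ← mul_assoc]
    exact mem_finiteFun _ _
  | zero => simp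
  | add x y _ _ hx hy => rw [flip_add]; exact add_mem hx hy
  | smul c x _ hx => rw [flip_smul]; exact Submodule.smul_mem _ _ hx

/-- The linear anti-automorphism `flip` on finite functions. -/
noncomputable def flipFin : finiteFun n q →ₗ[ℂ] finiteFun n q where
  toFun f := ⟨flip (f : FunAlg n q), flip_mem f.2⟩
  map_add' _ _ := Subtype.ext (flip_add _ _)
  map_smul' _ _ := Subtype.ext (flip_smul _ _)

theorem coe_flipFin (f : finiteFun n q) : (flipFin f : FunAlg n q) = flip (f : FunAlg n q) := rfl

/-- The functional `u ↦ ∫ u^* x dm` (with `*` replaced by its linear version). -/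
noncomputable def leftIntL (α : ℝ) (x : finiteFun n q) : Hol n →ₗ[ℂ] ℂ where
  toFun u := wInt α (flip (phi n q u) * (x : FunAlg n q))
  map_add' u v := by
    rw [map_add, flip_add, add_mul]
    exact wInt_add α (finiteFun_mul_left _ x.2) (finiteFun_mul_left _ x.2)
  map_smul' c u := by
    rw [map_smul, flip_smul, smul_mul_assoc, wInt_smul]; rfl

/-- The functional `v ↦ ∫ x v dm`. -/
noncomputable def rightIntL (α : ℝ) (x : finiteFun n q) : Hol n →ₗ[ℂ] ℂ where
  toFun u := wInt α ((x : FunAlg n q) * phi n q u)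
  map_add' u v := by
    rw [map_add, mul_add]
    exact wInt_add α (finiteFun_mul_right x.2 _) (finiteFun_mul_right x.2 _)
  map_smul' c u := by
    rw [map_smul, mul_smul_comm, wInt_smul]; rfl

/-- The formula for the coefficients of a projection, extended linearly from monomials to all
polynomials `v`. With the nonvanishing of the norms it is the only description of Toeplitz operators
used afterwards. -/
theorem toeplitz_apply {α : ℝ} (hα : 0 < α) (f : finiteFun n q) (v : Hol n) (a : Fin n → ℕ) :
    toeplitz α f v a * wInner α (mono q a) a =
      wInt α (antimono q a * ((f : FunAlg n q) * phi n q v)) := by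
  have h0 := wInner_mono_self_ne q hα a
  have : wInner α (mono q a) a • (Finsupp.lapply a ∘ₗ toeplitz α f) =
      rightIntL α ⟨antimono q a * (f : FunAlg n q), finiteFun_mul_left _ f.2⟩ := by
    refine hol_lin_ext fun b => ?_
    rw [LinearMap.smul_apply, LinearMap.comp_apply, toeplitz_bv, Finsupp.lapply_apply,
      bergmanProj_apply, smul_eq_mul, mul_div_cancel₀ _ h0]
    change _ = wInt α (antimono q a * (f : FunAlg n q) * phi n q (bv b))
    rw [phi_bv, mul_assoc]; rfl
  rw [← mul_assoc, mul_comm]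
  exact LinearMap.congr_fun this v

theorem toeplitz_ext {α : ℝ} (hα : 0 < α) {u v : Hol n}
    (h : ∀ a, u a * wInner α (mono q a) a = v a * wInner α (mono q a) a) : u = v := by
  ext a
  exact mul_right_cancel₀ (wInner_mono_self_ne q hα a) (h a)

theorem torus_antimono (w : Fin n → ℤ) (a : Fin n → ℕ) :
    torus q w (antimono q a) = (qc q ^ (∑ i, w i * a i))⁻¹ • antimono q a := by
  rw [← flip_mono, torus_flip_mono]

theorem toeplitz_torus {α : ℝ} (hα : 0 < α) (w : Fin n → ℤ) (f : finiteFun n q) (v : Hol n) :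
    toeplitz α (torusFin w f) (dOp q w v) = dOp q w (toeplitz α f v) := by
  refine toeplitz_ext (q := q) hα fun a => ?_
  have h := zpow_ne_zero (∑ i, w i * (a i : ℤ)) (qc_ne q)
  rw [toeplitz_apply hα, dOp_apply, mul_assoc, toeplitz_apply hα, coe_torusFin, phi_dOp, ← map_mul,
    ← wInt_torus α w (antimono q a * ((f : FunAlg n q) * phi n q v)), map_mul (torus q w) (antimono q a), torus_antimono,
    smul_mul_assoc, wInt_smul, mul_inv_cancel_left₀ h]

/-- Integration by parts: the integral of `E_k` of a product vanishes, and on the starred factor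
`E_k` becomes `F_k`. -/
theorem wInt_antimono_actE (α : ℝ) {k : Fin n} (hk : k.val + 1 < n) (a : Fin n → ℕ)
    (x : finiteFun n q) : wInt α (antimono q a * actE q k x) =
      qc q ^ (∑ i, wtK k i * a i) * (rc q ^ 4)⁻¹ *
        wInt α (flip (phi n q (hat (actF q k) (bv a))) * (x : FunAlg n q)) := by
  have h := wInt_actE α hk (finiteFun_mul_left (antimono q a) x.2)
  rw [actE_mul, wInt_add α (finiteFun_mul_left _ x.2) (finiteFun_mul_left _ (actE_mem k x.2)),
    torus_antimono, ← flip_mono, actE_flip hk, ← phi_bv, actF_phi hk, smul_mul_assoc,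
    smul_mul_assoc, wInt_smul, wInt_smul, phi_bv, flip_mono] at h
  have h2 := zpow_ne_zero (∑ i, wtK k i * (a i : ℤ)) (qc_ne q)
  field_simp at h
  field_simp
  linear_combination h

/-- The adjointness in the Fock norms transfers because a nonzero entry of `E_k` connects monomials
of equal degree, where the two families of norms are proportional. -/
theorem hat_adjoint_wInner {α : ℝ} (hα : 0 < α) {k : Fin n} (hk : k.val + 1 < n)
    (a c : Fin n → ℕ) : hat (actE q k) (bv c) a * wInner α (mono q a) a =
      qc q ^ (∑ i, wtK k i * a i) * (rc q ^ 4)⁻¹ *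
        (hat (actF q k) (bv a) c * wInner α (mono q c) c) := by
  have h := hat_adjoint (q := q) hk a c
  have ha := hnorm_ne (q := q) a
  have hc := hnorm_ne (q := q) c
  -- If the entry of `E_k` vanishes, so does the transposed entry of `F_k`, and the degrees need not
  -- be compared.
  by_cases h0 : hat (actE q k) (bv c) a = 0
  · rw [h0, zero_mul] at h
    have h1 := zpow_ne_zero (∑ i, wtK k i * (a i : ℤ)) (qc_ne q)
    have h2 := inv_ne_zero (pow_ne_zero 4 (rc_ne q))
    have h3 : hat (actF q k) (bv a) c = 0 := by simpa [h1, h2, hc, rc_ne q] using h.symm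
    rw [h0, h3]; simp
  · have hE : IsEOp q k (hat (actE q k)) := fun w v => dOp_hat_actE w k v
    have h1 := wInner_mono_ratio q hα (hE.sum_eq hk h0)
    apply mul_right_cancel₀ (mul_ne_zero ha hc)
    linear_combination (hnorm q c * wInner α (mono q a) a) * h +
      (qc q ^ (∑ i, wtK k i * a i) * (rc q ^ 4)⁻¹ * hat (actF q k) (bv a) c * hnorm q c) * h1

/-- The Leibniz rule gives `(E_k f) v = E_k (f v) - (K_k f)(E_k v)`. In the projection of the first
term, `E_k` is moved by parts to `F_k` on the test monomial, and adjointness moves it back to `E_k`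
acting on `T_f v`. -/
theorem toeplitz_actE_lin {α : ℝ} (hα : 0 < α) {k : Fin n} (hk : k.val + 1 < n)
    (f : finiteFun n q) (v : Hol n) : toeplitz α (eFin k f) v =
      hat (actE q k) (toeplitz α f v) - toeplitz α (torusFin (wtK k) f) (hat (actE q k) v) := by
  classical
  refine toeplitz_ext (q := q) hα fun a => ?_
  rw [Finsupp.sub_apply, sub_mul, toeplitz_apply hα, toeplitz_apply hα, coe_eFin, coe_torusFin]
  set x : finiteFun n q := ⟨(f : FunAlg n q) * phi n q v, finiteFun_mul_right f.2 _⟩ with hx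
  have h1 : actE q k f * phi n q v =
      actE q k x - torus q (wtK k) f * phi n q (hat (actE q k) v) := by
    rw [hx, actE_mul, actE_phi hk, add_sub_cancel_right]
  rw [h1, mul_sub, wInt_sub α (finiteFun_mul_left _ (actE_mem k x.2))
    (finiteFun_mul_left _ (finiteFun_mul_right (torus_mem _ f.2) _)), wInt_antimono_actE α hk]
  congr 1
  have h2 : wInt α (flip (phi n q (hat (actF q k) (bv a))) * (x : FunAlg n q)) =
      ∑ c ∈ (hat (actF q k) (bv a)).support, hat (actF q k) (bv a) c * leftIntL α x (bv c) :=
    lin_apply_eq_sum (leftIntL α x) _ fun l hl =>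
      Finsupp.mem_support_iff.2 (left_ne_zero_of_mul hl)
  have h3 (c) : leftIntL α x (bv c) = toeplitz α f v c * wInner α (mono q c) c := by
    rw [toeplitz_apply hα]
    change wInt α (flip (phi n q (bv c)) * (x : FunAlg n q)) = _
    rw [phi_bv, flip_mono]
  rw [h2, end_apply_eq_sum (S := (hat (actF q k) (bv a)).support), Finset.sum_mul, Finset.mul_sum]
  · refine Finset.sum_congr rfl fun c _ => ?_
    rw [h3, mul_assoc (toeplitz α f v c), hat_adjoint_wInner hα hk]
    ring
  -- The sum may run over the support of `F_k z^a` because, by adjointness, the entries of `E_k`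
  -- vanish outside it.
  · intro l hl
    rw [Finsupp.mem_support_iff]
    intro h0
    have h4 := hat_adjoint_wInner (q := q) hα hk a l
    rw [h0] at h4
    have h5 := wInner_mono_self_ne q hα a
    have h6 : hat (actE q k) (bv l) a = 0 := by simpa [h5] using h4
    exact hl (by rw [h6, mul_zero])

theorem zsOp_zOp_last {k : Fin n} (hk : ¬ k.val + 1 < n) (v : Hol n) :
    zsOp q k (zOp q k v) = qc q ^ 2 • zOp q k (zsOp q k v) + (1 - qc q ^ 2) • v := by
  have h := congrArg (fun x => fock n q x v) (Zs_Z_self (q := q) k)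
  simpa [Ioi_last hk, fock_Z, fock_Zs] using h

theorem zsOp_zOp_ne {i j : Fin n} (h : i ≠ j) (v : Hol n) :
    zsOp q i (zOp q j v) = qc q • zOp q j (zsOp q i v) := by
  have h := congrArg (fun x => fock n q x v) (Zs_Z (q := q) h)
  simpa [fock_Z, fock_Zs] using h

theorem wtK_last_self {k : Fin n} (hk : ¬ k.val + 1 < n) : wtK k k = 2 := by simp [wtK, hk]

theorem wtK_last_ne {k i : Fin n} (hk : ¬ k.val + 1 < n) (h : i ≠ k) : wtK k i = 1 := by
  simp [wtK, hk, h]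

/-- Since no index exceeds the last one, the relation for `z_n^* z_n` has no quadratic correction.
So `z_n^*` passes polynomials as a skew derivation, twisted by `K_n`. -/
theorem Zs_last_mul_phi {k : Fin n} (hk : ¬ k.val + 1 < n) (v : Hol n) :
    Zs q k * phi n q v = phi n q (dOp q (wtK k) v) * Zs q k + phi n q (zsOp q k v) := by
  refine hol_lin_ext_zOp (q := q) (f := LinearMap.mulLeft ℂ (Zs q k) ∘ₗ phi n q)
    (g := LinearMap.mulRight ℂ (Zs q k) ∘ₗ phi n q ∘ₗ dOp q (wtK k) + phi n q ∘ₗ zsOp q k)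
    ?_ (fun i v h => ?_) v
  · simp [dOp_bv, phi_bv, mono_zero, zsOp_bv_zero]
  · simp only [LinearMap.comp_apply, LinearMap.add_apply, LinearMap.mulLeft_apply,
      LinearMap.mulRight_apply] at h ⊢
    rw [phi_zOp, ← mul_assoc, dOp_zOp, map_smul, phi_zOp]
    by_cases hi : i = k
    · subst hi
      rw [zsOp_zOp_last hk, map_add, map_smul, map_smul, phi_zOp, Zs_Z_self, Ioi_last hk,
        wtK_last_self hk, Finset.sum_empty, sub_zero, add_mul, smul_mul_assoc, smul_mul_assoc,
        one_mul, mul_assoc, h, mul_add, smul_add, smul_mul_assoc, mul_assoc, zpow_ofNat, add_assoc]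
    · rw [zsOp_zOp_ne (Ne.symm hi), Zs_Z (Ne.symm hi), map_smul, phi_zOp, smul_mul_assoc, mul_assoc,
        h, wtK_last_ne hk hi, zpow_one, mul_add, smul_add, smul_mul_assoc, mul_assoc]

theorem antimono_mul_Z_last {k : Fin n} (hk : ¬ k.val + 1 < n) (a : Fin n → ℕ) :
    antimono q a * Z q k = qc q ^ (∑ i, wtK k i * a i) • (Z q k * antimono q a) +
      (1 - qc q ^ (2 * a k)) • antimono q (a - Pi.single k 1) := by
  have h := congrArg flip (Zs_last_mul_phi (q := q) hk (bv a))
  have ht : tail k a = 0 := by simp [tail, Ioi_last hk]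
  rw [dOp_bv, zsOp_bv, ht, map_smul, map_smul, phi_bv, phi_bv] at h
  simpa [flip_mono] using h

/-- Right multiplication by `z_n` is left multiplication up to a power of `q`: each `z_i` with `i <
n` contributes a factor `q`, and `z_n` itself none. -/
theorem phi_mul_Z_last {k : Fin n} (hk : ¬ k.val + 1 < n) (v : Hol n) :
    phi n q v * Z q k =
      phi n q (zOp q k (dOp q (fun i => if i = k then 0 else 1) v)) := by
  refine hol_lin_ext_zOp (q := q) (f := LinearMap.mulRight ℂ (Z q k) ∘ₗ phi n q)
    (g := phi n q ∘ₗ zOp q k ∘ₗ dOp q (fun i => if i = k then 0 else 1)) ?_ (fun i v h => ?_) v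
  · simp [dOp_bv, phi_bv, mono_zero, phi_zOp]
  · simp only [LinearMap.comp_apply, LinearMap.mulRight_apply] at h ⊢
    rw [phi_zOp, mul_assoc, h, dOp_zOp, map_smul, map_smul, phi_zOp, phi_zOp, phi_zOp,
      ← mul_assoc, ← mul_assoc]
    rcases last_eq (i := i) hk with rfl | hi
    · simp
    · simp [hi.ne, Z_Z (q := q) hi]

/-- The operator on the weighted Bergman space by which the last `E_k` acts. -/
noncomputable def bergmanE (q : QParam) (α : ℝ) (k : Fin n) : Module.End ℂ (Hol n) :=
  -(rc q / (1 - qc q ^ 2)) • (zOp q k - (tPar q α * qc q ^ (2 * n + 2)) • zOp q k ∘ₗ dOp q 2)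

theorem isEOp_bergmanE (α : ℝ) {k : Fin n} (hk : ¬ k.val + 1 < n) :
    IsEOp q k (bergmanE q α k) := by
  intro w v
  simp only [bergmanE, LinearMap.smul_apply, LinearMap.sub_apply, LinearMap.comp_apply, map_smul,
    map_sub, dOp_zOp, dOp_dOp, wtE, dif_neg hk, add_comm w]
  module

theorem zOp_last_apply_add {k : Fin n} (hk : ¬ k.val + 1 < n) (u : Hol n) (a : Fin n → ℕ) :
    zOp q k u (a + Pi.single k 1) = u a := by
  have : Finsupp.lapply (a + Pi.single k 1) ∘ₗ zOp q k = Finsupp.lapply (R := ℂ) a := by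
    refine hol_lin_ext fun b => ?_
    have ht : tail k b = 0 := by simp [tail, Ioi_last hk]
    simp [zOp_bv, ht, bv_apply]
  exact LinearMap.congr_fun this u

theorem zOp_apply_zero (k : Fin n) (u : Hol n) {a : Fin n → ℕ} (ha : a k = 0) :
    zOp q k u a = 0 := by
  have : Finsupp.lapply a ∘ₗ zOp q k = (0 : Hol n →ₗ[ℂ] ℂ) := by
    refine hol_lin_ext fun b => ?_
    have : b + Pi.single k 1 ≠ a := by rintro rfl; simp at ha
    simp [zOp_bv, bv_apply, this]
  exact LinearMap.congr_fun this u

/-- As `E_n f` is a twisted commutator of `f` with a multiple of `z_n`, the task is to compute `∫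
(z^a)^* z_n f v dm`. Multiplication by `z_n` does not commute with the projection in the required
way; moving `z_n` cyclically around the integral yields the correction term `τ z_n q^{2 deg}`, with
`τ = t q^{2n+2}`, on both sides. -/
theorem toeplitz_actE_last {α : ℝ} (hα : 0 < α) {k : Fin n} (hk : ¬ k.val + 1 < n)
    (f : finiteFun n q) (v : Hol n) : toeplitz α (eFin k f) v =
      bergmanE q α k (toeplitz α f v) - toeplitz α (torusFin (wtK k) f) (bergmanE q α k v) := by
  refine toeplitz_ext (q := q) hα fun a => ?_
  set c := -(rc q / (1 - qc q ^ 2)) with hc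
  set τ := tPar q α * qc q ^ (2 * n + 2) with hτ
  set x : finiteFun n q := ⟨(f : FunAlg n q) * phi n q v, finiteFun_mul_right f.2 _⟩ with hx
  have hA : lastA q k = c • Z q k := rfl
  have hB (u : Hol n) : bergmanE q α k u = c • (zOp q k u - τ • zOp q k (dOp q 2 u)) := rfl
  have h1 : actE q k f * phi n q v =
      c • (Z q k * (x : FunAlg n q)) - c • (torus q (wtK k) f * phi n q (zOp q k v)) := by
    rw [actE_last hk, hA, sub_mul, phi_zOp]
    simp only [smul_mul_assoc, mul_smul_comm, mul_assoc, hx]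
  -- Commuting `z_n` to the left of `(z^a)^*` produces the second term as its derivative part; in
  -- the first, `z_n` then goes around the integral to the right of `v`.
  have h2 : wInt α (antimono q a * (Z q k * (x : FunAlg n q))) =
      τ * toeplitz α (torusFin (wtK k) f) (zOp q k (dOp q 2 v)) a * wInner α (mono q a) a +
      (1 - qc q ^ (2 * a k)) * wInt α (antimono q (a - Pi.single k 1) * (x : FunAlg n q)) := by
    rw [← mul_assoc, antimono_mul_Z_last hk, add_mul, smul_mul_assoc, smul_mul_assoc,
      wInt_add α (Submodule.smul_mem _ _ (finiteFun_mul_left _ x.2))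
        (Submodule.smul_mem _ _ (finiteFun_mul_left _ x.2)), wInt_smul, wInt_smul, mul_assoc (Z q k),
      wInt_Z_mul α hk (finiteFun_mul_left _ x.2)]
    congr 1
    have h3 : (x : FunAlg n q) * Z q k =
        (f : FunAlg n q) * phi n q (zOp q k (dOp q (fun i => if i = k then 0 else 1) v)) := by
      rw [hx, mul_assoc, phi_mul_Z_last hk]
    -- The operator `q^{2 deg}` is `K_n` times the scaling from right multiplication by `z_n`.
    -- Moving `K_n` past `z_n` gives the extra `q²` by which `τ` exceeds the cyclicity factor `t
    -- q^{2n}`.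
    have h4 : zOp q k (dOp q 2 v) = (qc q ^ 2)⁻¹ • dOp q (wtK k)
        (zOp q k (dOp q (fun i => if i = k then 0 else 1) v)) := by
      rw [dOp_zOp, wtK_last_self hk, dOp_dOp, zpow_ofNat,
        inv_smul_smul₀ (pow_ne_zero 2 (qc_ne q))]
      congr 2
      have : (2 : Fin n → ℤ) = wtK k + fun i => if i = k then 0 else 1 := by
        funext i
        by_cases hi : i = k
        · simp [hi, wtK_last_self hk]
        · simp [hi, wtK_last_ne hk hi]
      rw [this]
    rw [mul_assoc (antimono q a), h3, ← toeplitz_apply hα, h4, map_smul, toeplitz_torus hα,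
      Finsupp.smul_apply, dOp_apply, hτ, smul_eq_mul]
    have := qc_ne q
    field_simp
    ring
  -- The derivative part is evaluated at `a - e_n`. The ratio of the norms of `z^{a-e_n}` and `z^a`
  -- replaces `1 - q^{2a_n}` by `1 - τ q^{2(|a|-1)}`, which is the deformation built into
  -- `bergmanE`.
  have h5 : (1 - qc q ^ (2 * a k)) * wInt α (antimono q (a - Pi.single k 1) * (x : FunAlg n q)) =
      (zOp q k (toeplitz α f v) a - τ * zOp q k (dOp q 2 (toeplitz α f v)) a) *
        wInner α (mono q a) a := by
    by_cases ha : a k = 0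
    · simp [ha, zOp_apply_zero]
    · obtain ⟨b, rfl⟩ := exists_add ha
      have h6 := wInner_mono_add q hα k b
      rw [zOp_last_apply_add hk, zOp_last_apply_add hk, add_tsub_cancel_right, ← toeplitz_apply hα,
        dOp_apply]
      have h7 : (∑ i, (2 : Fin n → ℤ) i * (b i : ℤ)) = ((2 * ∑ i, b i : ℕ) : ℤ) := by
        push_cast; rw [Finset.mul_sum]; rfl
      rw [h7, zpow_natCast]
      rw [← hτ] at h6
      have h8 : 2 * (b + Pi.single k 1 : Fin n → ℕ) k = 2 * b k + 2 := by simp; ring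
      rw [h8]
      linear_combination (-toeplitz α f v b) * h6
  rw [toeplitz_apply hα, coe_eFin, h1, mul_sub, mul_smul_comm, mul_smul_comm,
    wInt_sub α (Submodule.smul_mem _ _ (finiteFun_mul_left _ (finiteFun_mul_left _ x.2)))
      (Submodule.smul_mem _ _ (finiteFun_mul_left _ (finiteFun_mul_right (torus_mem _ f.2) _))),
    wInt_smul, wInt_smul, h2, h5, ← coe_torusFin, ← toeplitz_apply hα, hB, hB]
  simp only [map_smul, map_sub, Finsupp.sub_apply, Finsupp.smul_apply, smul_eq_mul]
  ring

theorem exists_toeplitz_actE {α : ℝ} (hα : 0 < α) (k : Fin n) : ∃ Y : Module.End ℂ (Hol n),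
    IsEOp q k Y ∧ ∀ (f : finiteFun n q) v, toeplitz α (eFin k f) v =
      Y (toeplitz α f v) - toeplitz α (torusFin (wtK k) f) (Y v) := by
  by_cases hk : k.val + 1 < n
  · exact ⟨_, fun w v => dOp_hat_actE w k v, toeplitz_actE_lin hα hk⟩
  · exact ⟨_, isEOp_bergmanE α hk, toeplitz_actE_last hα hk⟩

end toeplitz
/-! ### Invariant bilinear forms on finite functions -/

section forms
variable {n : ℕ} {q : QParam}

/-- An equivariant realization of finite functions by operators on the Fock space. -/
structure IsQuantization (ρ : finiteFun n q →ₗ[ℂ] Module.End ℂ (Hol n)) : Prop where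
  finCol : ∀ f, FinCol (ρ f)
  torus : ∀ w f v, ρ (torusFin w f) (dOp q w v) = dOp q w (ρ f v)
  actE : ∀ k, ∃ Y : Module.End ℂ (Hol n), IsEOp q k Y ∧
    ∀ f v, ρ (eFin k f) v = Y (ρ f v) - ρ (torusFin (wtK k) f) (Y v)
  flip : ∃ N : (Fin n → ℕ) → ℂ, (∀ a, N a ≠ 0) ∧
    ∀ f a b, ρ (flipFin f) (bv b) a * N a = ρ f (bv a) b * N b

/-- The Fock representation of finite functions. -/
noncomputable def fockL (n : ℕ) (q : QParam) : finiteFun n q →ₗ[ℂ] Module.End ℂ (Hol n) :=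
  (fock n q).toLinearMap ∘ₗ (finiteFun n q).subtype

theorem fockL_apply (f : finiteFun n q) : fockL n q f = fock n q (f : FunAlg n q) := rfl

/-- The Toeplitz quantization as a linear map. -/
noncomputable def toeplitzL (n : ℕ) (q : QParam) (α : ℝ) :
    finiteFun n q →ₗ[ℂ] Module.End ℂ (Hol n) where
  toFun := toeplitz α
  map_add' := toeplitz_add α
  map_smul' := toeplitz_smul α

theorem toeplitzL_apply (α : ℝ) (f : finiteFun n q) : toeplitzL n q α f = toeplitz α f := rfl

theorem isQuantization_fockL : IsQuantization (fockL n q) where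
  finCol f := finCol_fock f.2
  torus w f v := fock_torus w (f : FunAlg n q) v
  actE k := ⟨eOp q k, isEOp_eOp k, fun f v => fock_actE k (f : FunAlg n q) v⟩
  flip := ⟨hnorm q, hnorm_ne, fun f a b => mat_flip (f : FunAlg n q) a b⟩

theorem isQuantization_toeplitzL {α : ℝ} (hα : 0 < α) : IsQuantization (toeplitzL n q α) where
  finCol f := toeplitz_finite α f
  torus w f v := toeplitz_torus hα w f v
  actE k := exists_toeplitz_actE hα k
  flip := by
    refine ⟨fun a => wInner α (mono q a) a, wInner_mono_self_ne q hα, fun f a b => ?_⟩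
    rw [toeplitzL_apply, toeplitzL_apply, toeplitz_apply hα, toeplitz_apply hα, ← wInt_flip,
      coe_flipFin, flip_mul, flip_mul, flip_flip, phi_bv, phi_bv, flip_mono, ← flip_mono a,
      flip_flip, mul_assoc]

/-- The bilinear form `(f, g) ↦ tr (ρ(f) ρ(g) U)`. -/
noncomputable def traceForm (ρ : finiteFun n q →ₗ[ℂ] Module.End ℂ (Hol n))
    (hρ : IsQuantization ρ) : finiteFun n q →ₗ[ℂ] finiteFun n q →ₗ[ℂ] ℂ :=
  LinearMap.mk₂ ℂ (fun f g => trW (invWeight q) (ρ f * ρ g))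
    (fun f f' g => by
      rw [map_add, add_mul, trW_add _ ((hρ.finCol g).mul_left _) ((hρ.finCol g).mul_left _)])
    (fun c f g => by rw [map_smul, smul_mul_assoc, trW_smul, smul_eq_mul])
    (fun f g g' => by
      rw [map_add, mul_add, trW_add _ ((hρ.finCol g).mul_left _) ((hρ.finCol g').mul_left _)])
    (fun c f g => by rw [map_smul, mul_smul_comm, trW_smul, smul_eq_mul])

variable {ρ : finiteFun n q →ₗ[ℂ] Module.End ℂ (Hol n)} (hρ : IsQuantization ρ)

theorem traceForm_apply (f g : finiteFun n q) :
    traceForm ρ hρ f g = trW (invWeight q) (ρ f * ρ g) := rfl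

theorem traceForm_torus (w : Fin n → ℤ) (f g : finiteFun n q) :
    traceForm ρ hρ (torusFin w f) (torusFin w g) = traceForm ρ hρ f g := by
  refine trW_conj _ (q := q) (w := w) fun v => ?_
  simp only [Module.End.mul_apply, hρ.torus]

theorem torusFin_torusFin (w w' : Fin n → ℤ) (f : finiteFun n q) :
    torusFin w (torusFin w' f) = torusFin (w + w') f :=
  Subtype.ext (torus_torus w w' _)

theorem torusFin_zero (f : finiteFun n q) : torusFin 0 f = f := Subtype.ext (torus_zero _)

theorem flipFin_flipFin (f : finiteFun n q) : flipFin (flipFin f) = f :=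
  Subtype.ext (flip_flip _)

/-- Adding the two Leibniz terms telescopes: `ρ(K_k f) Y ρ(g)` cancels and `Y X - X' Y` is left,
with `X = ρ(f) ρ(g)`. Its invariant trace vanishes by `invTrace_skew`. -/
theorem traceForm_actE (k : Fin n) (f g : finiteFun n q) :
    traceForm ρ hρ (eFin k f) g + traceForm ρ hρ (torusFin (wtK k) f) (eFin k g) = 0 := by
  obtain ⟨Y, hY, h⟩ := hρ.actE k
  have hX := (hρ.finCol g).mul_left (ρ f)
  have h1 : ρ (eFin k f) * ρ g + ρ (torusFin (wtK k) f) * ρ (eFin k g) +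
      ρ (torusFin (wtK k) f) * ρ (torusFin (wtK k) g) * Y = Y * (ρ f * ρ g) := by
    refine LinearMap.ext fun v => ?_
    simp only [LinearMap.add_apply, Module.End.mul_apply, h, map_sub]
    abel
  have h2 := invTrace_skew (X' := ρ (torusFin (wtK k) f) * ρ (torusFin (wtK k) g)) hY hX
    fun v => by simp only [Module.End.mul_apply, hρ.torus]
  have h3 := (hρ.finCol g).mul_left (ρ (eFin k f))
  have h4 := (hρ.finCol (eFin k g)).mul_left (ρ (torusFin (wtK k) f))
  have h5 : trW (invWeight q) (ρ (eFin k f) * ρ g + ρ (torusFin (wtK k) f) * ρ (eFin k g)) = 0 := by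
    have h6 : ρ (eFin k f) * ρ g + ρ (torusFin (wtK k) f) * ρ (eFin k g) = Y * (ρ f * ρ g) +
        (-1 : ℂ) • (ρ (torusFin (wtK k) f) * ρ (torusFin (wtK k) g) * Y) := by
      rw [← h1]; module
    -- As for the weighted integral, finite columns of `X' Y` cannot be inherited from `X'` and are
    -- read off from the identity.
    have h7 : FinCol ((-1 : ℂ) • (ρ (torusFin (wtK k) f) * ρ (torusFin (wtK k) g) * Y)) := by
      obtain ⟨S, hS, hs⟩ := h3
      obtain ⟨S', hS', hs'⟩ := h4
      obtain ⟨S'', hS'', hs''⟩ := hX.mul_left Y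
      refine ⟨S ∪ S' ∪ S'', (hS.union hS').union hS'', fun a ha => ?_⟩
      simp only [Set.mem_union, not_or] at ha
      have := congrArg (fun A => A (bv a)) h6
      simp only [LinearMap.add_apply, hs a ha.1.1, hs' a ha.1.2, hs'' a ha.2, zero_add] at this
      exact this.symm
    rw [h6, trW_add _ (hX.mul_left Y) h7, trW_smul, h2]
    ring
  rw [traceForm_apply, traceForm_apply, ← trW_add _ h3 h4, h5]

/-- Under `flip` the operators are transposed with respect to a diagonal form; the trace sees this
only as a reversal of the order, since the norms cancel around the cycle. -/
theorem traceForm_flip (f g : finiteFun n q) :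
    traceForm ρ hρ (flipFin f) (flipFin g) = traceForm ρ hρ g f := by
  classical
  obtain ⟨N, hN, h⟩ := hρ.flip
  obtain ⟨S, hS⟩ := (hρ.finCol (flipFin g)).exists_finset
  obtain ⟨S', hS'⟩ := (hρ.finCol f).exists_finset
  rw [traceForm_apply, traceForm_apply,
    trW_mul_eq_sum _ _ (S := S ∪ S') fun m l hml =>
      ⟨Finset.mem_union_left _ (hS m l hml).1, Finset.mem_union_left _ (hS m l hml).2⟩,
    trW_mul_eq_sum _ _ (S := S ∪ S') fun m l hml =>
      ⟨Finset.mem_union_right _ (hS' m l hml).1, Finset.mem_union_right _ (hS' m l hml).2⟩]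
  refine Finset.sum_congr rfl fun m _ => Finset.sum_congr rfl fun l _ => ?_
  apply mul_right_cancel₀ (mul_ne_zero (hN m) (hN l))
  have h1 := h g l m
  have h2 := h f m l
  calc ρ (flipFin g) (bv m) l * ρ (flipFin f) (bv l) m * invWeight q m * (N m * N l) =
        (ρ (flipFin g) (bv m) l * N l) * (ρ (flipFin f) (bv l) m * N m) * invWeight q m := by ring
    _ = _ := by rw [h1, h2]; ring

/-- The trace is cyclic up to conjugation by its diagonal weight, and this conjugation is itself a
torus automorphism. -/
theorem traceForm_swap (f g : finiteFun n q) :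
    traceForm ρ hρ g f = traceForm ρ hρ f (torusFin (invW n) g) := by
  obtain ⟨S, hS⟩ := (hρ.finCol f).exists_finset
  rw [traceForm_apply, traceForm_apply, trW_mul_eq_sum _ _ hS, trW_mul_eq_sum' _ _ hS,
    Finset.sum_comm]
  refine Finset.sum_congr rfl fun l _ => Finset.sum_congr rfl fun m _ => ?_
  have h := congrArg (fun v : Hol n => v m) (hρ.torus (invW n) g (bv l))
  simp only [dOp_bv, map_smul, Finsupp.smul_apply, dOp_apply, smul_eq_mul, ← invWeight_eq] at h
  linear_combination (-ρ f (bv m) l) * h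

theorem pairing_berezin (q : QParam) (α : ℝ) (f g : finiteFun n q) : pairing (berezin α f) g =
    qPoch q (qc q ^ 2) n / qPoch q (tPar q α * qc q ^ 2) n *
      trW (invWeight q) (toeplitz α f * toeplitz α g) :=
  (existsUnique_covariantSymbol q α (toeplitz α f)).choose_spec.1 g

theorem pairing_toDistr (f g : finiteFun n q) : pairing (toDistr f) g =
    qPoch q (qc q ^ 2) n * traceForm (fockL n q) isQuantization_fockL f g := by
  rw [pairing, invInt, traceForm_apply, trW]
  congr 1
  refine finsum_congr fun m => ?_
  congr 1
  obtain ⟨S, hS⟩ := (finCol_fock g.2).exists_finset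
  rw [Module.End.mul_apply, fockL_apply, fockL_apply, end_apply_eq_sum (S := S), mulFin,
    finsum_eq_sum_of_support_subset (s := S)]
  · exact Finset.sum_congr rfl fun l _ => mul_comm _ _
  · intro l hl
    exact (hS l m (right_ne_zero_of_mul hl)).1
  · intro l hl
    exact (hS l m (left_ne_zero_of_mul hl)).1

theorem pairing_right_ext {ψ ψ' : Distr n} (h : ∀ g : finiteFun n q, pairing ψ g = pairing ψ' g) :
    ψ = ψ' := by
  funext m l
  obtain ⟨c, hc, h'⟩ := pairing_unitF (q := q) l m
  apply mul_left_cancel₀ hc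
  rw [← h', ← h', h]

/-- The spanning elements `z^l f_0 z^{*m}` act in the Fock space as nonzero multiples of distinct
matrix units, so the coefficients in any expansion can be recovered from the matrix. -/
theorem toDistr_injective : Function.Injective (toDistr : finiteFun n q → Distr n) := by
  intro f g hfg
  have h (x : FunAlg n q) (hx : x ∈ finiteFun n q) (h0 : mat x = 0) : x = 0 := by
    obtain ⟨c, hc⟩ := Finsupp.mem_span_range_iff_exists_finsupp.1 (finiteFun_le_span hx)
    suffices hc0 : c = 0 by rw [← hc, hc0, Finsupp.sum_zero_index]
    ext p
    obtain ⟨d, hd, h'⟩ := mat_unitF (q := q) p.1 p.2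
    have h1 : mat x p.1 p.2 = c p * d := by
      rw [← hc, mat, Finsupp.sum, map_sum, LinearMap.sum_apply, Finsupp.finsetSum_apply,
        Finset.sum_eq_single p]
      · rw [map_smul, LinearMap.smul_apply, Finsupp.smul_apply, ← mat, h', if_pos ⟨rfl, rfl⟩,
          smul_eq_mul]
      · intro p' _ hp'
        obtain ⟨d', hd', h''⟩ := mat_unitF (q := q) p'.1 p'.2
        rw [map_smul, LinearMap.smul_apply, Finsupp.smul_apply, ← mat, h'', if_neg, smul_zero]
        exact fun e => hp' (Prod.ext e.1.symm e.2.symm)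
      · intro hp
        rw [Finsupp.notMem_support_iff.1 hp]; simp
    rw [h0] at h1
    simpa [hd] using h1.symm
  have h2 := h (f - g : finiteFun n q) (f - g).2 (by
    have h3 : mat (f : FunAlg n q) = mat (g : FunAlg n q) := hfg
    funext m l
    have h4 := congrFun (congrFun h3 m) l
    rw [mat, mat] at h4
    simp [mat, h4])
  exact sub_eq_zero.1 (Subtype.ext h2)

/-- Nondegeneracy of the Fock form: pairing with all finite functions recovers every matrix entry.
-/
theorem traceForm_fock_ext {f f' : finiteFun n q}
    (h : ∀ g, traceForm (fockL n q) isQuantization_fockL f g =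
      traceForm (fockL n q) isQuantization_fockL f' g) : f = f' :=
  toDistr_injective (pairing_right_ext fun g => by rw [pairing_toDistr, pairing_toDistr, h])

end forms
/-! ### Expansion of the Berezin transform in powers of `t` -/

section expansion
variable {n : ℕ} {q : QParam}

open Polynomial

/-- The finite function whose matrix in the Fock representation is a matrix unit. -/
noncomputable def matUnit (q : QParam) (p : (Fin n → ℕ) × (Fin n → ℕ)) : finiteFun n q :=
  (mat (unitF q p.1 p.2) p.1 p.2)⁻¹ • ⟨unitF q p.1 p.2, unitF_mem p.1 p.2⟩

theorem mat_matUnit (p : (Fin n → ℕ) × (Fin n → ℕ)) (a b : Fin n → ℕ) :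
    mat (matUnit q p : FunAlg n q) a b = if a = p.1 ∧ b = p.2 then 1 else 0 := by
  obtain ⟨c, hc, h⟩ := mat_unitF (q := q) p.1 p.2
  have h1 : (matUnit q p : FunAlg n q) = (mat (unitF q p.1 p.2) p.1 p.2)⁻¹ • unitF q p.1 p.2 := rfl
  rw [h1, mat_smul, Pi.smul_apply, Pi.smul_apply, h, h, if_pos ⟨rfl, rfl⟩]
  split_ifs <;> simp [hc]

theorem fock_matUnit (p : (Fin n → ℕ) × (Fin n → ℕ)) (b : Fin n → ℕ) :
    fock n q (matUnit q p : FunAlg n q) (bv b) = if b = p.2 then bv p.1 else 0 := by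
  ext a
  change mat _ a b = _
  rw [mat_matUnit]
  by_cases hb : b = p.2
  · simp [hb, bv_apply, eq_comm (a := a)]
  · simp [hb]

/-- The matrix entries of a finite function. -/
noncomputable def coords (n : ℕ) (q : QParam) :
    finiteFun n q →ₗ[ℂ] ((Fin n → ℕ) × (Fin n → ℕ) →₀ ℂ) where
  toFun f := Finsupp.ofSupportFinite (fun p => mat (f : FunAlg n q) p.1 p.2) (by
    obtain ⟨S, hS, h⟩ := mat_finite f.2
    exact (hS.prod hS).subset fun p hp => h _ _ hp)
  map_add' f g := by ext p; exact congrFun (congrFun (mat_add (f : FunAlg n q) g) p.1) p.2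
  map_smul' c f := by ext p; exact congrFun (congrFun (mat_smul c (f : FunAlg n q)) p.1) p.2

theorem coords_apply (f : finiteFun n q) (p : (Fin n → ℕ) × (Fin n → ℕ)) :
    coords n q f p = mat (f : FunAlg n q) p.1 p.2 := rfl

theorem coords_matUnit (p : (Fin n → ℕ) × (Fin n → ℕ)) :
    coords n q (matUnit q p) = Finsupp.single p 1 := by
  ext p'
  rw [coords_apply, mat_matUnit, Finsupp.single_apply]
  exact if_congr ⟨fun h => Prod.ext h.1.symm h.2.symm, fun h => by simp [h]⟩ rfl rfl

theorem coords_injective : Function.Injective (coords n q) := fun _ _ h =>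
  toDistr_injective (funext fun a => funext fun b => DFunLike.congr_fun h (a, b))

theorem linearCombination_coords (f : finiteFun n q) :
    Finsupp.linearCombination ℂ (matUnit q) (coords n q f) = f := by
  have h : coords n q ∘ₗ Finsupp.linearCombination ℂ (matUnit q) = LinearMap.id := by
    ext p : 2
    simp [coords_matUnit]
  exact coords_injective (LinearMap.congr_fun h (coords n q f))

theorem finiteFun_lin_ext {M : Type*} [AddCommMonoid M] [Module ℂ M]
    {φ φ' : finiteFun n q →ₗ[ℂ] M} (h : ∀ p, φ (matUnit q p) = φ' (matUnit q p)) : φ = φ' := by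
  have h1 : φ ∘ₗ Finsupp.linearCombination ℂ (matUnit q) =
      φ' ∘ₗ Finsupp.linearCombination ℂ (matUnit q) := by
    ext p : 2
    simpa using h p
  ext1 f
  have := LinearMap.congr_fun h1 (coords n q f)
  rwa [LinearMap.comp_apply, LinearMap.comp_apply, linearCombination_coords] at this

/-- The linear map on finite functions with prescribed values on the matrix units. -/
noncomputable def liftUnit {M : Type*} [AddCommMonoid M] [Module ℂ M]
    (F : (Fin n → ℕ) × (Fin n → ℕ) → M) : finiteFun n q →ₗ[ℂ] M :=
  Finsupp.linearCombination ℂ F ∘ₗ coords n q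

theorem liftUnit_matUnit {M : Type*} [AddCommMonoid M] [Module ℂ M]
    (F : (Fin n → ℕ) × (Fin n → ℕ) → M) (p : (Fin n → ℕ) × (Fin n → ℕ)) :
    liftUnit F (matUnit q p) = F p := by
  simp [liftUnit, coords_matUnit]

/-- A functional that is nonzero on finitely many matrix units only is given by a finite
function. -/
theorem exists_finiteFun_pairing (φ : finiteFun n q →ₗ[ℂ] ℂ)
    (hφ : {p | φ (matUnit q p) ≠ 0}.Finite) :
    ∃ g : finiteFun n q, ∀ x, pairing (toDistr g) x = φ x := by
  obtain ⟨σ, hσ, -⟩ := existsUnique_distr φ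
  -- The trace pairing is transposed: the value on the matrix unit at `(l, m)` is a nonzero multiple
  -- of the entry of `σ` at `(m, l)`. Finiteness is therefore transported through `Prod.swap`.
  have h0 (p : (Fin n → ℕ) × (Fin n → ℕ)) : σ p.2 p.1 ≠ 0 → φ (matUnit q p) ≠ 0 := by
    intro h
    obtain ⟨c, hc, h'⟩ := pairing_unitF (q := q) p.1 p.2
    obtain ⟨d, hd, h''⟩ := mat_unitF (q := q) p.1 p.2
    have h1 := h' σ
    rw [hσ] at h1
    rw [matUnit, map_smul, h1, h'', if_pos ⟨rfl, rfl⟩]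
    exact smul_ne_zero (inv_ne_zero hd) (mul_ne_zero hc h)
  have hfin : (Function.support fun p : (Fin n → ℕ) × (Fin n → ℕ) => σ p.1 p.2).Finite := by
    refine (hφ.image Prod.swap).subset fun p hp => ⟨p.swap, h0 p.swap hp, Prod.swap_swap p⟩
  have hc : coords n q (Finsupp.linearCombination ℂ (matUnit q)
      (Finsupp.ofSupportFinite _ hfin)) = Finsupp.ofSupportFinite _ hfin := by
    have h : coords n q ∘ₗ Finsupp.linearCombination ℂ (matUnit q) = LinearMap.id := by
      ext p : 2
      simp [coords_matUnit]
    exact LinearMap.congr_fun h _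
  refine ⟨Finsupp.linearCombination ℂ (matUnit q) (Finsupp.ofSupportFinite _ hfin), fun x => ?_⟩
  rw [← hσ x]
  congr 1
  funext a b
  exact DFunLike.congr_fun hc (a, b)

/-- The polynomial `(q ^ s X; q²)_N`. -/
noncomputable def qPochPoly (q : QParam) (s N : ℕ) : ℂ[X] :=
  ∏ k ∈ Finset.range N, (1 - C (qc q ^ s * qc q ^ (2 * k)) * X)

theorem eval_qPochPoly (q : QParam) (s N : ℕ) (t : ℂ) :
    (qPochPoly q s N).eval t = qPoch q (t * qc q ^ s) N := by
  rw [qPochPoly, eval_prod, qPoch]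
  refine Finset.prod_congr rfl fun k _ => ?_
  simp
  ring

theorem coeff_zero_qPochPoly (q : QParam) (s N : ℕ) : (qPochPoly q s N).coeff 0 = 1 := by
  rw [coeff_zero_eq_eval_zero, eval_qPochPoly]
  simp [qPoch]

/-- `z^b` raises `k` to `k + b`, the matrix unit accepts only `p.2` and returns `p.1`, and `z^{*a}`
must lead back to `k`. So at most one `k` contributes to the integral. -/
theorem mat_antimono_matUnit_mono (p : (Fin n → ℕ) × (Fin n → ℕ)) (a b k : Fin n → ℕ) :
    mat (antimono q a * ((matUnit q p : FunAlg n q) * mono q b)) k k =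
      if k + a = p.1 ∧ k + b = p.2 then
        qc q ^ (∑ i, a i * tail i k) * qc q ^ (∑ i, b i * tail i k) * hnorm q p.1 / hnorm q k
      else 0 := by
  rw [mat, map_mul, map_mul, Module.End.mul_apply, Module.End.mul_apply, fock_mono_eq, map_smul,
    fock_matUnit]
  by_cases hb : k + b = p.2
  · have h := mat_flip (q := q) (mono q a) k p.1
    rw [flip_mono, mat, mat, fock_mono_eq, Finsupp.smul_apply, bv_apply] at h
    rw [if_pos hb, map_smul, Finsupp.smul_apply, eq_div_of_mul_eq (hnorm_ne k) h]
    by_cases ha : k + a = p.1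
    · simp [ha, hb]; ring
    · simp [ha]
  · simp [hb]

/-- The integral collapses to the single index `k = p.1 - a = p.2 - b`, whose weight supplies
`t^{|k|}`; division by the Bergman norm contributes the polynomial `(tq^{2n+2};q²)_{|a|}`. The two
divisibilities record this power of `t` through either index, and the constant term says that `T_f`
tends to the Fock matrix of `f` as `t → 0`. The polynomial is chosen before `α`. -/
theorem toeplitz_matUnit (p : (Fin n → ℕ) × (Fin n → ℕ)) (a b : Fin n → ℕ) :
    ∃ τ : ℂ[X], (∀ α : ℝ, 0 < α → toeplitz α (matUnit q p) (bv b) a =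
        qPoch q (tPar q α * qc q ^ 2) n * τ.eval (tPar q α)) ∧
      (¬ (a ≤ p.1 ∧ b ≤ p.2) → τ = 0) ∧
      X ^ (∑ i, p.1 i - ∑ i, a i) ∣ τ ∧ X ^ (∑ i, p.2 i - ∑ i, b i) ∣ τ ∧
      τ.coeff 0 = if a = p.1 ∧ b = p.2 then 1 else 0 := by
  have key (α : ℝ) (hα : 0 < α) : toeplitz α (matUnit q p) (bv b) a =
      qPoch q (tPar q α * qc q ^ 2) n *
        (∑' k, mat (antimono q a * ((matUnit q p : FunAlg n q) * mono q b)) k k * wWeight q α k) *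
        (qPoch q (tPar q α * qc q ^ (2 * n + 2)) (∑ i, a i) / hnorm q a) := by
    have h := toeplitz_apply hα (matUnit q p) (bv b) a
    rw [wInner_mono q hα, wInt] at h
    have h1 := hnorm_ne (q := q) a
    have h2 := qPoch_tPar_ne q hα (2 * n + 2) (∑ i, a i)
    rw [phi_bv] at h
    rw [← h]
    field_simp
  by_cases hk : ∃ k, k + a = p.1 ∧ k + b = p.2
  · obtain ⟨k, hka, hkb⟩ := hk
    have hs1 : ∑ i, p.1 i - ∑ i, a i = ∑ i, k i := by
      rw [← hka]; simp [Finset.sum_add_distrib]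
    have hs2 : ∑ i, p.2 i - ∑ i, b i = ∑ i, k i := by
      rw [← hkb]; simp [Finset.sum_add_distrib]
    set κ := qc q ^ (∑ i, a i * tail i k) * qc q ^ (∑ i, b i * tail i k) * hnorm q p.1 /
      hnorm q k with hκ
    refine ⟨C (κ * qc q ^ (∑ i, (2 + 2 * (i.val : ℤ)) * k i) / hnorm q a) *
      qPochPoly q (2 * n + 2) (∑ i, a i) * X ^ (∑ i, k i), fun α hα => ?_, fun h => ?_, ?_, ?_, ?_⟩
    · rw [key α hα, tsum_eq_single k, mat_antimono_matUnit_mono, if_pos ⟨hka, hkb⟩, wWeight_eq, ← hκ]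
      · simp only [eval_mul, eval_C, eval_pow, eval_X, eval_qPochPoly]
        ring
      · intro k' hk'
        rw [mat_antimono_matUnit_mono, if_neg, zero_mul]
        rintro ⟨h, -⟩
        exact hk' (add_right_cancel (h.trans hka.symm))
    · refine absurd ⟨?_, ?_⟩ h
      · rw [← hka]; exact le_add_of_nonneg_left fun i => Nat.zero_le _
      · rw [← hkb]; exact le_add_of_nonneg_left fun i => Nat.zero_le _
    · rw [hs1]; exact dvd_mul_left _ _
    · rw [hs2]; exact dvd_mul_left _ _
    -- For `k = 0` the norm of `z^{p.1}` cancels that of `z^a`, leaving exactly `1`; otherwise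
    -- `t^{|k|}` removes the constant term.
    · by_cases h0 : k = 0
      · subst h0
        rw [zero_add] at hka hkb
        have : hnorm q a ≠ 0 := hnorm_ne a
        rw [if_pos ⟨hka, hkb⟩]
        simp [mul_coeff_zero, coeff_zero_qPochPoly, hκ, tail_zero, hnorm_zero, ← hka, this]
      · have h1 : ∑ i, k i ≠ 0 := by
          intro h
          exact h0 (funext fun i => Finset.sum_eq_zero_iff.1 h i (Finset.mem_univ i))
        rw [if_neg, mul_coeff_zero, coeff_X_pow, if_neg (Ne.symm h1), mul_zero]
        rintro ⟨h, -⟩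
        rw [← hka] at h
        exact h0 (by simpa using h)
  · refine ⟨0, fun α hα => ?_, fun _ => rfl, dvd_zero _, dvd_zero _, ?_⟩
    · have hz (k : Fin n → ℕ) : mat (antimono q a * ((matUnit q p : FunAlg n q) * mono q b)) k k = 0 := by
        rw [mat_antimono_matUnit_mono, if_neg fun h => hk ⟨k, h⟩]
      simp [key α hα, hz]
    · rw [if_neg, coeff_zero]
      rintro ⟨rfl, rfl⟩
      exact hk ⟨0, by simp⟩

theorem trW_mul_matUnit (A : Module.End ℂ (Hol n)) {X : Module.End ℂ (Hol n)}
    {p : (Fin n → ℕ) × (Fin n → ℕ)} (h : ∀ a b, X (bv b) a ≠ 0 → a ≤ p.1 ∧ b ≤ p.2) :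
    trW (invWeight q) (A * X) = ∑ a ∈ Finset.Iic p.1 ∪ Finset.Iic p.2,
      ∑ b ∈ Finset.Iic p.1 ∪ Finset.Iic p.2, X (bv a) b * A (bv b) a * invWeight q a := by
  refine trW_mul_eq_sum _ _ fun m l hml => ?_
  obtain ⟨h1, h2⟩ := h m l hml
  simp [h1, h2]

/-- The trace is a finite sum over products of one entry from each Toeplitz operator. The degree
bounds hold because the entries for `p'` carry powers of `t` growing with `p'`, while those for `p`
confine the indices below `p`. -/
theorem exists_poly_matUnit (p p' : (Fin n → ℕ) × (Fin n → ℕ)) : ∃ P : ℂ[X],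
    (∀ α : ℝ, 0 < α → pairing (berezin α (matUnit q p)) (matUnit q p') = P.eval (tPar q α)) ∧
    P.coeff 0 = pairing (toDistr (matUnit q p)) (matUnit q p') ∧
    ∀ j, P.coeff j ≠ 0 → ∑ i, p'.1 i ≤ ∑ i, p.2 i + j ∧ ∑ i, p'.2 i ≤ ∑ i, p.1 i + j := by
  choose τ h1 h2 h3 h4 h5 using toeplitz_matUnit (q := q) p
  choose τ' h1' h2' h3' h4' h5' using toeplitz_matUnit (q := q) p'
  set S := Finset.Iic p'.1 ∪ Finset.Iic p'.2
  -- Only indices with `a ≤ p.1` and `b ≤ p.2` matter for the power of `t`, as otherwise the entry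
  -- belonging to `p` is zero.
  have hdvd {d : ℕ} (hd : ∀ a b, a ≤ p.1 → b ≤ p.2 → X ^ d ∣ τ' b a) :
      X ^ d ∣ ∑ a ∈ S, ∑ b ∈ S, τ' b a * τ a b * C (invWeight q a) := by
    refine Finset.dvd_sum fun a _ => Finset.dvd_sum fun b _ => ?_
    by_cases h : a ≤ p.1 ∧ b ≤ p.2
    · exact ((hd a b h.1 h.2).mul_right _).mul_right _
    · rw [h2 a b h]; simp
  have hle {a b : Fin n → ℕ} (h : a ≤ b) : ∑ i, a i ≤ ∑ i, b i := Finset.sum_le_sum fun i _ => h i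
  -- Each of the two Toeplitz entries contains `(tq²;q²)_n` and the normalization divides by it
  -- once, so one such factor survives.
  refine ⟨C (qPoch q (qc q ^ 2) n) * qPochPoly q 2 n *
    ∑ a ∈ S, ∑ b ∈ S, τ' b a * τ a b * C (invWeight q a), fun α hα => ?_, ?_, fun j hj => ?_⟩
  · have h0 := qPoch_tPar_ne q hα 2 n
    rw [pairing_berezin, trW_mul_matUnit (p := p')]
    · simp only [eval_mul, eval_C, eval_finsetSum, eval_qPochPoly, h1 _ _ α hα, h1' _ _ α hα,
        Finset.mul_sum]
      refine Finset.sum_congr rfl fun a _ => Finset.sum_congr rfl fun b _ => ?_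
      field_simp
    · intro a b hab
      by_contra h
      rw [h1' _ _ α hα, h2' _ _ h] at hab
      simp at hab
  · rw [pairing_toDistr, traceForm_apply, trW_mul_matUnit (p := p')]
    · simp only [mul_coeff_zero, coeff_C_zero, coeff_zero_qPochPoly, finsetSum_coeff, h5, h5',
        mul_one]
      congr 1
      refine Finset.sum_congr rfl fun a _ => Finset.sum_congr rfl fun b _ => ?_
      rw [fockL_apply, fockL_apply, ← mat, ← mat, mat_matUnit, mat_matUnit]
    · intro a b hab
      rw [fockL_apply, ← mat, mat_matUnit] at hab
      split_ifs at hab with h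
      · exact ⟨h.1.le, h.2.le⟩
      · exact absurd rfl hab
  · have hcoeff {d : ℕ} (hd : ∀ a b, a ≤ p.1 → b ≤ p.2 → X ^ d ∣ τ' b a) : d ≤ j := by
      by_contra h
      exact hj (X_pow_dvd_iff.1 ((hdvd hd).mul_left _) j (not_le.1 h))
    constructor
    -- Since `|b| ≤ |p.2|`, the entry for `p'` at `(b, a)` is divisible by `t` to the power `|p'.1|
    -- - |p.2|`, with truncated subtraction; the second bound is the same with `a` and the other
    -- components.
    · have := hcoeff (d := ∑ i, p'.1 i - ∑ i, p.2 i) fun a b _ hb =>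
        (pow_dvd_pow X (Nat.sub_le_sub_left (hle hb) _)).trans (h3' b a)
      omega
    · have := hcoeff (d := ∑ i, p'.2 i - ∑ i, p.1 i) fun a b ha _ =>
        (pow_dvd_pow X (Nat.sub_le_sub_left (hle ha) _)).trans (h4' b a)
      omega

theorem finite_sum_le (N : ℕ) : {a : Fin n → ℕ | ∑ i, a i ≤ N}.Finite :=
  (Set.finite_Iic fun _ => N).subset fun a ha i =>
    (Finset.single_le_sum (f := a) (fun _ _ => Nat.zero_le _) (Finset.mem_univ i)).trans ha

theorem pairing_berezin_eq_traceForm {α : ℝ} (hα : 0 < α) (f g : finiteFun n q) :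
    pairing (berezin α f) g = qPoch q (qc q ^ 2) n / qPoch q (tPar q α * qc q ^ 2) n *
      traceForm (toeplitzL n q α) (isQuantization_toeplitzL hα) f g :=
  pairing_berezin q α f g

/-- The Berezin transform as a polynomial in `t`, in the weak sense. -/
theorem exists_berezin_poly (n : ℕ) (q : QParam) :
    ∃ P : finiteFun n q →ₗ[ℂ] finiteFun n q →ₗ[ℂ] ℂ[X],
      (∀ α : ℝ, 0 < α → ∀ f g, pairing (berezin α f) g = (P f g).eval (tPar q α)) ∧
      (∀ f g, (P f g).coeff 0 = pairing (toDistr f) g) ∧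
      ∀ j p, {p' | (P (matUnit q p) (matUnit q p')).coeff j ≠ 0}.Finite := by
  choose P h1 h2 h3 using exists_poly_matUnit (n := n) (q := q)
  have hP (p p') : liftUnit (q := q) (fun p => liftUnit (q := q) (P p)) (matUnit q p)
      (matUnit q p') = P p p' := by
    rw [liftUnit_matUnit, liftUnit_matUnit]
  refine ⟨liftUnit fun p => liftUnit (P p), fun α hα f g => ?_, fun f g => ?_, fun j p => ?_⟩
  · have : (qPoch q (qc q ^ 2) n / qPoch q (tPar q α * qc q ^ 2) n) •
        traceForm (toeplitzL n q α) (isQuantization_toeplitzL hα) =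
        (liftUnit (q := q) fun p => liftUnit (q := q) (P p)).compr₂ (leval (tPar q α)) := by
      refine finiteFun_lin_ext fun p => finiteFun_lin_ext fun p' => ?_
      rw [LinearMap.compr₂_apply, hP, leval_apply, ← h1 p p' α hα, pairing_berezin_eq_traceForm hα]
      rfl
    rw [pairing_berezin_eq_traceForm hα]
    exact LinearMap.congr_fun₂ this f g
  · have : (liftUnit (q := q) fun p => liftUnit (q := q) (P p)).compr₂ (lcoeff ℂ 0) =
        qPoch q (qc q ^ 2) n • traceForm (fockL n q) isQuantization_fockL := by
      refine finiteFun_lin_ext fun p => finiteFun_lin_ext fun p' => ?_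
      rw [LinearMap.compr₂_apply, hP, lcoeff_apply, h2, pairing_toDistr]
      rfl
    rw [pairing_toDistr]
    exact LinearMap.congr_fun₂ this f g
  · refine ((finite_sum_le (∑ i, p.2 i + j)).prod (finite_sum_le (∑ i, p.1 i + j))).subset
      fun p' hp' => ?_
    rw [Set.mem_ofPred_eq, hP] at hp'
    exact h3 p p' j hp'

/-- For fixed first argument the `j`-th coefficient is a functional supported on finitely many
matrix units, hence is represented by a finite function. This is what makes `B j` an endomorphism of
the finite functions, not merely a map into distributions. -/
theorem exists_coefficients (n : ℕ) (q : QParam) :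
    ∃ (P : finiteFun n q →ₗ[ℂ] finiteFun n q →ₗ[ℂ] ℂ[X])
      (B : ℕ → (finiteFun n q →ₗ[ℂ] finiteFun n q)),
      (∀ α : ℝ, 0 < α → ∀ f g, pairing (berezin α f) g = (P f g).eval (tPar q α)) ∧
      (∀ f g, (P f g).coeff 0 = pairing (toDistr f) g) ∧
      ∀ j f g, pairing (toDistr (B j f)) g = (P f g).coeff j := by
  obtain ⟨P, h1, h2, h3⟩ := exists_berezin_poly n q
  choose b hb using fun j p => exists_finiteFun_pairing (lcoeff ℂ j ∘ₗ P (matUnit q p)) (h3 j p)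
  refine ⟨P, fun j => liftUnit (b j), h1, h2, fun j f g => ?_⟩
  have : (qPoch q (qc q ^ 2) n • traceForm (fockL n q) isQuantization_fockL) ∘ₗ
      liftUnit (b j) = P.compr₂ (lcoeff ℂ j) := by
    refine finiteFun_lin_ext fun p => LinearMap.ext fun g => ?_
    rw [LinearMap.comp_apply, liftUnit_matUnit]
    exact (pairing_toDistr _ _).symm.trans (hb j p g)
  rw [pairing_toDistr]
  exact LinearMap.congr_fun₂ this f g

/-- The values `q^{2α}` with `α > 0` are pairwise distinct, so the two polynomials agree at
infinitely many points. -/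
theorem poly_ext {p p' : ℂ[X]} (h : ∀ α : ℝ, 0 < α → p.eval (tPar q α) = p'.eval (tPar q α)) :
    p = p' := by
  refine Polynomial.eq_of_infinite_eval_eq p p' ?_
  refine Set.Infinite.mono (s := tPar q '' Set.Ioi 0) ?_ ?_
  · rintro _ ⟨α, hα, rfl⟩
    exact h α hα
  · refine (Set.Ioi_infinite 0).image fun α _ β _ hαβ => ?_
    have h1 : (q : ℝ) ^ (2 * α) = (q : ℝ) ^ (2 * β) := by
      have h2 : tPar q α = tPar q β := hαβ
      unfold tPar at h2
      exact_mod_cast h2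
    have h2 := (Real.rpow_right_inj q.2.1 q.2.2.ne).1 h1
    linarith

end expansion
/-! ### Equivariance of the coefficients -/

section equivariance
variable {n : ℕ} {q : QParam}

/-- The symmetries shared by the trace forms of all equivariant quantizations. -/
structure IsInvariantForm {M : Type*} [AddCommGroup M] [Module ℂ M]
    (β : finiteFun n q →ₗ[ℂ] finiteFun n q →ₗ[ℂ] M) : Prop where
  torus : ∀ w f g, β (torusFin w f) (torusFin w g) = β f g
  actE : ∀ k f g, β (eFin k f) g + β (torusFin (wtK k) f) (eFin k g) = 0
  flip : ∀ f g, β (flipFin f) (flipFin g) = β g f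
  swap : ∀ f g, β g f = β f (torusFin (invW n) g)

theorem isInvariantForm_traceForm {ρ : finiteFun n q →ₗ[ℂ] Module.End ℂ (Hol n)}
    (hρ : IsQuantization ρ) : IsInvariantForm (traceForm ρ hρ) :=
  ⟨traceForm_torus hρ, traceForm_actE hρ, traceForm_flip hρ, traceForm_swap hρ⟩

theorem IsInvariantForm.compr₂ {M N : Type*} [AddCommGroup M] [Module ℂ M] [AddCommGroup N]
    [Module ℂ N] {β : finiteFun n q →ₗ[ℂ] finiteFun n q →ₗ[ℂ] M} (hβ : IsInvariantForm β)
    (φ : M →ₗ[ℂ] N) : IsInvariantForm (β.compr₂ φ) where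
  torus w f g := by simp only [LinearMap.compr₂_apply, hβ.torus]
  actE k f g := by simp only [LinearMap.compr₂_apply, ← map_add, hβ.actE, map_zero]
  flip f g := by simp only [LinearMap.compr₂_apply, hβ.flip]
  swap f g := by simp only [LinearMap.compr₂_apply, hβ.swap f g]

/-- Each symmetry is an identity between polynomials in `t` that holds at all `t = q^{2α}`, hence
identically. Applying a coefficient functional then preserves it. -/
theorem isInvariantForm_of_eval
    {P : finiteFun n q →ₗ[ℂ] finiteFun n q →ₗ[ℂ] Polynomial ℂ}
    (hP : ∀ α : ℝ, 0 < α → IsInvariantForm (P.compr₂ (Polynomial.leval (tPar q α)))) :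
    IsInvariantForm P where
  torus w f g := poly_ext (q := q) fun α hα => (hP α hα).torus w f g
  actE k f g := poly_ext (q := q) fun α hα => by
    simpa using (hP α hα).actE k f g
  flip f g := poly_ext (q := q) fun α hα => (hP α hα).flip f g
  swap f g := poly_ext (q := q) fun α hα => (hP α hα).swap f g

theorem fFin_eq (k : Fin n) (f : finiteFun n q) : fFin k f =
    (if k.val + 1 < n then -(rc q ^ 4) else rc q ^ 4) • flipFin (eFin k (flipFin f)) :=
  Subtype.ext (actF_apply k (f : FunAlg n q))

variable {β γ : finiteFun n q →ₗ[ℂ] finiteFun n q →ₗ[ℂ] ℂ} (hβ : IsInvariantForm β)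
  (hγ : IsInvariantForm γ) (hnd : ∀ f f', (∀ g, β f g = β f' g) → f = f')
  {B : finiteFun n q →ₗ[ℂ] finiteFun n q} (hB : ∀ f g, β (B f) g = γ f g)

include hβ hγ hnd hB

theorem map_torusFin (w : Fin n → ℤ) (f : finiteFun n q) :
    B (torusFin w f) = torusFin w (B f) := by
  refine hnd _ _ fun g => ?_
  have hg : g = torusFin w (torusFin (-w) g) := by
    rw [torusFin_torusFin, add_neg_cancel, torusFin_zero]
  rw [hg, hB, hγ.torus, hβ.torus, hB]

/-- Invariance of `γ` moves `E_k` to the second argument, where `γ` may be replaced by `β` composed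
with `B`; invariance of `β` moves it back, and the `K_k` this leaves on `f` commutes with `B`. -/
theorem map_eFin (k : Fin n) (f : finiteFun n q) : B (eFin k f) = eFin k (B f) := by
  refine hnd _ _ fun g => ?_
  have h1 := hβ.actE k (B f) g
  have h2 := hγ.actE k f g
  rw [← map_torusFin hβ hγ hnd hB, hB] at h1
  rw [hB]
  linear_combination h2 - h1

/-- `flip` interchanges the arguments of both forms, which puts `f` in the slot where `B` is not
available. The swap rule returns it to the first slot at the price of the same torus twist for both
forms. -/
theorem map_flipFin (f : finiteFun n q) : B (flipFin f) = flipFin (B f) := by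
  refine hnd _ _ fun g => ?_
  rw [← flipFin_flipFin g, hB, hγ.flip, hβ.flip, hγ.swap, hβ.swap, hB]

theorem map_fFin (k : Fin n) (f : finiteFun n q) : B (fFin k f) = fFin k (B f) := by
  rw [fFin_eq, fFin_eq, map_smul, map_flipFin hβ hγ hnd hB, map_eFin hβ hγ hnd hB,
    map_flipFin hβ hγ hnd hB]

theorem map_uqActFin (ξ : Uq n q) (f : finiteFun n q) :
    B (uqActFin ξ f) = uqActFin ξ (B f) := by
  obtain ⟨y, rfl⟩ := Uq.mk_surjective ξ
  have key (ξ ξ' : FreeAlgebra ℂ (UGen n)) (f : finiteFun n q) :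
      uqActFin (Uq.mk n q (ξ * ξ')) f = uqActFin (Uq.mk n q ξ) (uqActFin (Uq.mk n q ξ') f) :=
    Subtype.ext (by simp [uqActFin, LinearMap.restrict_apply])
  induction y using FreeAlgebra.induction generalizing f with
  | grade0 c =>
    have h (f : finiteFun n q) : uqActFin (Uq.mk n q (algebraMap ℂ _ c)) f = c • f :=
      Subtype.ext (by simp [uqActFin, LinearMap.restrict_apply])
    rw [h, h, map_smul]
  | grade1 g =>
    have h (f : finiteFun n q) : (uqActFin (Uq.mk n q (FreeAlgebra.ι ℂ g)) f : FunAlg n q) =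
        uGenAct q g f := by
      simp [uqActFin, LinearMap.restrict_apply, uqAct_mk]
    cases g with
    | E k =>
      have h' (f : finiteFun n q) : uqActFin (Uq.mk n q (FreeAlgebra.ι ℂ (.E k))) f = eFin k f :=
        Subtype.ext (h f)
      rw [h', h', map_eFin hβ hγ hnd hB]
    | F k =>
      have h' (f : finiteFun n q) : uqActFin (Uq.mk n q (FreeAlgebra.ι ℂ (.F k))) f = fFin k f :=
        Subtype.ext (h f)
      rw [h', h', map_fFin hβ hγ hnd hB]
    | K k =>
      have h' (f : finiteFun n q) :
          uqActFin (Uq.mk n q (FreeAlgebra.ι ℂ (.K k))) f = torusFin (wtK k) f :=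
        Subtype.ext (h f)
      rw [h', h', map_torusFin hβ hγ hnd hB]
    | Kinv k =>
      have h' (f : finiteFun n q) :
          uqActFin (Uq.mk n q (FreeAlgebra.ι ℂ (.Kinv k))) f = torusFin (-wtK k) f :=
        Subtype.ext (h f)
      rw [h', h', map_torusFin hβ hγ hnd hB]
  | mul a b ha hb => rw [key, key, ha, hb]
  | add a b ha hb =>
    have h (f : finiteFun n q) : uqActFin (Uq.mk n q (a + b)) f =
        uqActFin (Uq.mk n q a) f + uqActFin (Uq.mk n q b) f :=
      Subtype.ext (by simp [uqActFin, LinearMap.restrict_apply])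
    rw [h, h, map_add, ha, hb]

end equivariance

/-! ### Assembling the series from its coefficients -/

section main
variable {n : ℕ} {q : QParam}

theorem isInvariantForm_smul {β : finiteFun n q →ₗ[ℂ] finiteFun n q →ₗ[ℂ] ℂ}
    (hβ : IsInvariantForm β) (c : ℂ) : IsInvariantForm (c • β) :=
  hβ.compr₂ (c • LinearMap.id)

/-- The sum is finite. The constant term is split off because the series starts at `j = 1`, the term
`j = 0` being `f` itself. -/
theorem hasSum_coeff_pnat (p : Polynomial ℂ) (t : ℂ) :
    HasSum (fun j : ℕ+ => t ^ (j : ℕ) * p.coeff j) (p.eval t - p.coeff 0) := by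
  have h : HasSum (fun j => t ^ j * p.coeff j) (p.eval t) := by
    rw [Polynomial.eval_eq_sum_range]
    simp only [mul_comm (p.coeff _)]
    refine hasSum_sum_of_ne_finset_zero fun j hj => ?_
    rw [Polynomial.coeff_eq_zero_of_natDegree_lt, mul_zero]
    simpa using hj
  have h1 := (hasSum_nat_add_iff' 1).2 h
  simp only [Finset.sum_range_one, pow_zero, one_mul] at h1
  exact Equiv.pnatEquivNat.symm.hasSum_iff.1 h1

end main
end QuantumBall

theorem proposition4p1 (n : ℕ) (hn : 1 ≤ n) (q : QuantumBall.QParam) :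
    ∃ B : ℕ+ → (QuantumBall.finiteFun n q →ₗ[ℂ] QuantumBall.finiteFun n q),
      (∀ (j : ℕ+) (ξ : QuantumBall.Uq n q) (f : QuantumBall.finiteFun n q),
        B j (QuantumBall.uqActFin ξ f) = QuantumBall.uqActFin ξ (B j f)) ∧
      (∀ α : ℝ, 0 < α → ∀ f : QuantumBall.finiteFun n q,
        HasSum (fun j : ℕ+ =>
            QuantumBall.tPar q α ^ (j : ℕ) • QuantumBall.toDistr (B j f))
          (QuantumBall.berezin α f - QuantumBall.toDistr f)) ∧
      (∀ f g : QuantumBall.finiteFun n q, ∃ p : Polynomial ℂ, ∀ α : ℝ, 0 < α →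
        QuantumBall.pairing (QuantumBall.berezin α f) g =
          p.eval (QuantumBall.tPar q α)) := by
  obtain ⟨P, B, h1, h2, h3⟩ := QuantumBall.exists_coefficients n q
  -- At each admissible `t` the polynomial form is a multiple of the trace form of the Toeplitz
  -- quantization, hence invariant.
  have hP : QuantumBall.IsInvariantForm P := QuantumBall.isInvariantForm_of_eval fun α hα => by
    have h : P.compr₂ (Polynomial.leval (QuantumBall.tPar q α)) =
        (QuantumBall.qPoch q (QuantumBall.qc q ^ 2) n /
          QuantumBall.qPoch q (QuantumBall.tPar q α * QuantumBall.qc q ^ 2) n) •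
        QuantumBall.traceForm _ (QuantumBall.isQuantization_toeplitzL hα) :=
      LinearMap.ext₂ fun f g => (h1 α hα f g).symm.trans
        (QuantumBall.pairing_berezin_eq_traceForm hα f g)
    rw [h]
    exact QuantumBall.isInvariantForm_smul (QuantumBall.isInvariantForm_traceForm _) _
  refine ⟨fun j => B j, fun j => ?_, fun α hα f => ?_, fun f g => ⟨P f g, fun α hα => h1 α hα f g⟩⟩
  -- The nondegenerate form is `∫ f g dν_q`, a nonzero multiple of the Fock trace form; the second
  -- form is the `j`-th coefficient of `P`.
  · refine QuantumBall.map_uqActFin (QuantumBall.isInvariantForm_smul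
      (QuantumBall.isInvariantForm_traceForm QuantumBall.isQuantization_fockL) _)
      (hP.compr₂ (Polynomial.lcoeff ℂ j)) (fun f f' h => QuantumBall.traceForm_fock_ext fun g =>
        mul_left_cancel₀ (QuantumBall.qPoch_ne q n) (h g))
      (fun f g => (QuantumBall.pairing_toDistr _ g).symm.trans (h3 j f g))
  -- Convergence is entrywise, and the entry at `(m, l)` is obtained, up to a nonzero constant, by
  -- pairing with `z^l f_0 z^{*m}`; this turns the claim into the expansion of one polynomial.
  · refine Pi.hasSum.2 fun m => Pi.hasSum.2 fun l => ?_
    obtain ⟨c, hc, h⟩ := QuantumBall.pairing_unitF (q := q) l m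
    have key := QuantumBall.hasSum_coeff_pnat (P f ⟨_, QuantumBall.unitF_mem l m⟩)
      (QuantumBall.tPar q α)
    rw [h2, ← h1 α hα, h, h, ← mul_sub] at key
    refine (hasSum_mul_left_iff hc).1 (key.congr_fun fun j => ?_)
    rw [← h3, h]
    exact mul_left_comm _ _ _
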